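/- Lemma 5.1. Let $M$ be a closed (compact, without boundary) connected smooth manifold of dimension $n$ whose fundamental group $\pi_1(M)$ is infinite, let $g$ be a Riemannian metric on $M$, and let $p:\widetilde M\to M$ be the universal covering, with the lifted metric $p^*g$. Let $\theta$ be a smooth real closed 1-form on $M$, and let $d_\theta=d+p^*\theta\wedge\cdot$ be the twisted differential, regarded as a closed unbounded operator between the spaces $\Omega^{j}_{(2)}(\widetilde M)$ of complex-valued $L^2$ $j$-forms on $\widetilde M$ (the $L^2$-closure of $d_\theta$ on the smooth $L^2$ forms $\omega$ for which $d_\theta\omega$ is $L^2$). Let $$H^{j}_{(2)}(\widetilde M,\theta)=\frac{\operatorname{Ker}\big(d_\theta|_{\Omega^{j}_{(2)}(\widetilde M)}\big)}{\operatorname{cl}\,\operatorname{Im}\big(d_\theta|_{\Omega^{j-1}_{(2)}(\widetilde M)}\big)}$$ be the reduced twisted $L^2$ cohomology (with $\Omega^{-1}_{(2)}=0$). Then $$H^{0}_{(2)}(\widetilde M,\theta)=\{0\}=H^{n}_{(2)}(\widetilde M,\theta).$$ -/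

import Mathlib

open Set MeasureTheory
open scoped Manifold ContDiff ENNReal Topology

noncomputable section

namespace TwistedL2

/-- The model space `ℝⁿ`. -/
abbrev Model (n : ℕ) : Type := EuclideanSpace ℝ (Fin n)

/-! ### Differential forms on a manifold without boundary -/

section Forms

variable {n : ℕ} {M : Type*} [TopologicalSpace M] [ChartedSpace (Model n) M]
variable {F : Type*} [NormedAddCommGroup F] [NormedSpace ℝ F]

/-- Sections (with no regularity) of the bundle of `F`-valued alternating `k`-forms on the
tangent spaces of an `n`-manifold `M`. -/
abbrev Form (n : ℕ) (M : Type*) [TopologicalSpace M] [ChartedSpace (Model n) M]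
    (F : Type*) [NormedAddCommGroup F] [NormedSpace ℝ F] (k : ℕ) :=
  ∀ x : M, TangentSpace (𝓡 n) x [⋀^Fin k]→L[ℝ] F

/-- The coordinate expression of a form in the chart around `x₀`: its pullback under the inverse
chart. It is meaningful on the (open) target of the chart. -/
def Form.inChart {k : ℕ} (w : Form n M F k) (x₀ : M) (y : Model n) :
    Model n [⋀^Fin k]→L[ℝ] F :=
  (w ((extChartAt (𝓡 n) x₀).symm y)).compContinuousLinearMap
    (mfderiv 𝓘(ℝ, Model n) (𝓡 n) (extChartAt (𝓡 n) x₀).symm y)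

/-- Smooth forms: all coordinate expressions are smooth. -/
def Form.Smooth {k : ℕ} (w : Form n M F k) : Prop :=
  ∀ x₀ : M, ContDiffOn ℝ ∞ (w.inChart x₀) (extChartAt (𝓡 n) x₀).target

/-- The exterior derivative, computed at `x` in the chart around `x`. -/
def Form.d {k : ℕ} (w : Form n M F k) : Form n M F (k + 1) := fun x =>
  (extDeriv (w.inChart x) (extChartAt (𝓡 n) x x)).compContinuousLinearMap
    (mfderiv (𝓡 n) 𝓘(ℝ, Model n) (extChartAt (𝓡 n) x) x)

/-- A smooth closed form. -/
def Form.IsClosedForm {k : ℕ} (w : Form n M F k) : Prop := w.Smooth ∧ w.d = 0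

/-- Exterior multiplication by a real covector on a normed space:
`(a ∧ β)(v₀, …, v_k) = ∑ᵢ (-1)ⁱ a(vᵢ) β(v₀, …, v̂ᵢ, …, v_k)`. -/
def extMul {E : Type*} [NormedAddCommGroup E] [NormedSpace ℝ E] {k : ℕ}
    (a : E [⋀^Fin 1]→L[ℝ] ℝ) (β : E [⋀^Fin k]→L[ℝ] F) : E [⋀^Fin (k + 1)]→L[ℝ] F :=
  ContinuousAlternatingMap.alternatizeUncurryFin
    (((ContinuousAlternatingMap.ofSubsingleton ℝ E ℝ (0 : Fin 1)).symm a).smulRight β)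

/-- Exterior multiplication `e(θ)` by a real 1-form (on `TangentSpace (𝓡 n) x = ℝⁿ`). -/
def Form.e {k : ℕ} (θ : Form n M ℝ 1) (w : Form n M F k) : Form n M F (k + 1) := fun x =>
  extMul (E := Model n) (θ x) (w x)

/-- The twisted differential `d_θ = d + e(θ)`. -/
def Form.twistedD {k : ℕ} (θ : Form n M ℝ 1) (w : Form n M F k) : Form n M F (k + 1) :=
  w.d + Form.e θ w

variable {N : Type*} [TopologicalSpace N] [ChartedSpace (Model n) N]

/-- Pullback of forms under a map between manifolds of the same dimension. -/
def Form.pullback {k : ℕ} (p : N → M) (w : Form n M F k) : Form n N F k := fun x =>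
  (w (p x)).compContinuousLinearMap (mfderiv (𝓡 n) (𝓡 n) p x)

end Forms

/-! ### Metrics, Riemannian volume and the pointwise norm of forms -/

section Metric

variable {n : ℕ} {M : Type*} [TopologicalSpace M] [ChartedSpace (Model n) M]

/-- Smooth Riemannian metrics on `M`. -/
abbrev RiemannianMetricOn (n : ℕ) (M : Type*) [TopologicalSpace M] [ChartedSpace (Model n) M]
    [IsManifold (𝓡 n) ∞ M] :=
  Bundle.ContMDiffRiemannianMetric (𝓡 n) ∞ (Model n) (fun x : M => TangentSpace (𝓡 n) x)

/-- Fields of bilinear forms on the tangent spaces. -/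
abbrev MetricTensor (n : ℕ) (M : Type*) [TopologicalSpace M] [ChartedSpace (Model n) M] :=
  ∀ x : M, TangentSpace (𝓡 n) x → TangentSpace (𝓡 n) x → ℝ

/-- The pullback `p^* g` of a Riemannian metric. -/
def pullbackMetric [IsManifold (𝓡 n) ∞ M] {N : Type*} [TopologicalSpace N]
    [ChartedSpace (Model n) N] (p : N → M) (g : RiemannianMetricOn n M) : MetricTensor n N :=
  fun x v w => g.inner (p x) (mfderiv (𝓡 n) (𝓡 n) p x v) (mfderiv (𝓡 n) (𝓡 n) p x w)

/-- The Gram matrix `g_{ij}` in the chart around `x₀`. -/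
def gram (h : MetricTensor n M) (x₀ : M) (y : Model n) : Matrix (Fin n) (Fin n) ℝ :=
  Matrix.of fun i j =>
    h ((extChartAt (𝓡 n) x₀).symm y)
      (mfderiv 𝓘(ℝ, Model n) (𝓡 n) (extChartAt (𝓡 n) x₀).symm y (EuclideanSpace.single i 1))
      (mfderiv 𝓘(ℝ, Model n) (𝓡 n) (extChartAt (𝓡 n) x₀).symm y (EuclideanSpace.single j 1))

/-- The measure `√(det g_{ij}) dy₁ ⋯ dyₙ` of the chart around `x₀`, transported to `M`
(it lives on the domain of the chart). -/
def chartVolume [MeasurableSpace M] (h : MetricTensor n M) (x₀ : M) : Measure M :=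
  Measure.map (extChartAt (𝓡 n) x₀).symm
    ((volume.restrict (extChartAt (𝓡 n) x₀).target).withDensity
      fun y => ENNReal.ofReal (Real.sqrt (gram h x₀ y).det))

/-- The Riemannian volume measure: the least measure that dominates the coordinate volume
`√(det g_{ij}) dy₁ ⋯ dyₙ` of every chart. (By the change of variables formula the coordinate
volumes agree on overlaps, so this measure restricts on each chart domain to the coordinate
volume.) -/
def riemannianVolume [MeasurableSpace M] (h : MetricTensor n M) : Measure M :=
  ⨆ x₀ : M, chartVolume h x₀

/-- `e₁, …, eₙ` is an orthonormal basis of `T_x M`. -/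
def IsOrthonormalFrame (h : MetricTensor n M) (x : M) (e : Fin n → TangentSpace (𝓡 n) x) : Prop :=
  ∀ i j, h x (e i) (e j) = if i = j then 1 else 0

/-- The pointwise square norm of a complex-valued `k`-form,
`|w|² = ∑_{i₁ < ⋯ < i_k} |w(e_{i₁}, …, e_{i_k})|²` for an orthonormal basis `e` of `T_x M`. The sum
does not depend on `e`; the supremum over all `e` is its common value. -/
def Form.normSq (h : MetricTensor n M) {k : ℕ} (w : Form n M ℂ k) (x : M) : ℝ≥0∞ :=
  ⨆ (e : Fin n → TangentSpace (𝓡 n) x) (_ : IsOrthonormalFrame h x e),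
    ∑ I : Fin k ↪o Fin n, ‖w x (fun a => e (I a))‖ₑ ^ 2

/-- The upper Lebesgue integral; it is `∫⁻ x, f x ∂μ` as soon as `f` is measurable. -/
def upperIntegral {X : Type*} [MeasurableSpace X] (μ : Measure X) (f : X → ℝ≥0∞) : ℝ≥0∞ :=
  ⨅ (u : X → ℝ≥0∞) (_ : Measurable u) (_ : ∀ x, f x ≤ u x), ∫⁻ x, u x ∂μ

/-- The square `∫_M |w|² dvol` of the `L²` norm. (The integrand is almost everywhere measurable
whenever `w` is a measurable form.) -/
def Form.l2Sq [MeasurableSpace M] (h : MetricTensor n M) {k : ℕ} (w : Form n M ℂ k) : ℝ≥0∞ :=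
  upperIntegral (riemannianVolume h) (w.normSq h)

/-- `L²` forms: (almost everywhere) measurable sections with `∫_M |w|² dvol < ∞`. -/
def Form.MemL2 [MeasurableSpace M] (h : MetricTensor n M) {k : ℕ} (w : Form n M ℂ k) : Prop :=
  (∀ x₀ : M, AEStronglyMeasurable (w.inChart x₀)
    (volume.restrict (extChartAt (𝓡 n) x₀).target)) ∧ w.l2Sq h < ⊤

end Metric

/-! ### Linearity facts that the definition of the cohomology spaces needs -/

section Facts

variable {n : ℕ} {M : Type*} [TopologicalSpace M] [ChartedSpace (Model n) M]

theorem inChart_add {k : ℕ} (w η : Form n M ℂ k) (x₀ : M) :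
    (w + η).inChart x₀ = w.inChart x₀ + η.inChart x₀ := rfl

theorem inChart_smul {k : ℕ} (c : ℂ) (w : Form n M ℂ k) (x₀ : M) :
    (c • w).inChart x₀ = c • w.inChart x₀ := rfl

theorem inChart_zero {k : ℕ} (x₀ : M) : (0 : Form n M ℂ k).inChart x₀ = 0 := rfl

theorem smooth_add {k : ℕ} {w η : Form n M ℂ k} (hw : w.Smooth) (hη : η.Smooth) :
    (w + η).Smooth := fun x₀ => (hw x₀).add (hη x₀)

theorem smooth_smul {k : ℕ} (c : ℂ) {w : Form n M ℂ k} (hw : w.Smooth) : (c • w).Smooth :=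
  fun x₀ => (hw x₀).const_smul c

theorem smooth_zero {k : ℕ} : (0 : Form n M ℂ k).Smooth :=
  fun x₀ => by rw [inChart_zero]; exact contDiffOn_const

theorem Form.Smooth.differentiableAt {k : ℕ} {w : Form n M ℂ k} (hw : w.Smooth) (x : M) :
    DifferentiableAt ℝ (w.inChart x) (extChartAt (𝓡 n) x x) :=
  ((hw x).contDiffAt ((isOpen_extChartAt_target x).mem_nhds (mem_extChartAt_target x))).differentiableAt
    (by simp)

theorem extMul_add {E : Type*} [NormedAddCommGroup E] [NormedSpace ℝ E] {k : ℕ}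
    (a : E [⋀^Fin 1]→L[ℝ] ℝ) (β γ : E [⋀^Fin k]→L[ℝ] ℂ) :
    extMul a (β + γ) = extMul a β + extMul a γ := by
  ext v
  simp only [extMul, ContinuousAlternatingMap.alternatizeUncurryFin_apply,
    ContinuousLinearMap.smulRight_apply, ← Finset.sum_add_distrib, smul_add,
    ContinuousAlternatingMap.add_apply]

theorem extMul_smul {E : Type*} [NormedAddCommGroup E] [NormedSpace ℝ E] {k : ℕ}
    (a : E [⋀^Fin 1]→L[ℝ] ℝ) (c : ℂ) (β : E [⋀^Fin k]→L[ℝ] ℂ) :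
    extMul a (c • β) = c • extMul a β := by
  ext v
  simp only [extMul, ContinuousAlternatingMap.alternatizeUncurryFin_apply,
    ContinuousLinearMap.smulRight_apply, Finset.smul_sum,
    ContinuousAlternatingMap.smul_apply]
  refine Finset.sum_congr rfl fun i _ => ?_
  rw [smul_comm c, smul_comm c]

theorem twistedD_add {k : ℕ} (θ : Form n M ℝ 1) {w η : Form n M ℂ k} (hw : w.Smooth)
    (hη : η.Smooth) : Form.twistedD θ (w + η) = Form.twistedD θ w + Form.twistedD θ η := by
  have h1 : (w + η).d = w.d + η.d := by
    funext x
    simp only [Form.d, inChart_add, Pi.add_apply]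
    rw [extDeriv_add (hw.differentiableAt x) (hη.differentiableAt x)]
    rfl
  have h2 : Form.e θ (w + η) = Form.e θ w + Form.e θ η := by
    funext x
    exact extMul_add (E := Model n) (θ x) (w x) (η x)
  rw [Form.twistedD, Form.twistedD, Form.twistedD, h1, h2]
  abel

theorem twistedD_smul {k : ℕ} (θ : Form n M ℝ 1) (c : ℂ) {w : Form n M ℂ k} (hw : w.Smooth) :
    Form.twistedD θ (c • w) = c • Form.twistedD θ w := by
  have h1 : (c • w).d = c • w.d := by
    funext x
    refine ContinuousAlternatingMap.ext fun v => ?_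
    change extDeriv (c • w.inChart x) (extChartAt (𝓡 n) x x) _ =
      c • extDeriv (w.inChart x) (extChartAt (𝓡 n) x x) _
    simp only [extDeriv, ContinuousAlternatingMap.alternatizeUncurryFin_apply,
      fderiv_const_smul (hw.differentiableAt x), Finset.smul_sum]
    refine Finset.sum_congr rfl fun i _ => ?_
    rw [smul_comm]
    rfl
  have h2 : Form.e θ (c • w) = c • Form.e θ w := by
    funext x
    exact extMul_smul (E := Model n) (θ x) c (w x)
  rw [Form.twistedD, Form.twistedD, h1, h2, smul_add]

theorem twistedD_zero {k : ℕ} (θ : Form n M ℝ 1) :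
    Form.twistedD θ (0 : Form n M ℂ k) = 0 := by
  simpa using twistedD_smul θ (0 : ℂ) (smooth_zero (n := n) (M := M) (k := k))

theorem upperIntegral_lt_iff {X : Type*} [MeasurableSpace X] {μ : Measure X} {f : X → ℝ≥0∞}
    {c : ℝ≥0∞} : upperIntegral μ f < c ↔
      ∃ u : X → ℝ≥0∞, Measurable u ∧ (∀ x, f x ≤ u x) ∧ ∫⁻ x, u x ∂μ < c := by
  simp only [upperIntegral, iInf_lt_iff, exists_prop]

theorem upperIntegral_eq_lintegral {X : Type*} [MeasurableSpace X] {μ : Measure X}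
    {f : X → ℝ≥0∞} (hf : Measurable f) : upperIntegral μ f = ∫⁻ x, f x ∂μ :=
  le_antisymm (iInf_le_of_le f (iInf_le_of_le hf (iInf_le_of_le (fun _ => le_rfl) le_rfl)))
    (le_iInf fun _ => le_iInf fun _ => le_iInf fun h => lintegral_mono h)

theorem enorm_add_sq_le (a b : ℂ) : ‖a + b‖ₑ ^ 2 ≤ 2 * ‖a‖ₑ ^ 2 + 2 * ‖b‖ₑ ^ 2 := by
  have h : ‖a + b‖₊ ^ 2 ≤ 2 * ‖a‖₊ ^ 2 + 2 * ‖b‖₊ ^ 2 := by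
    rw [← NNReal.coe_le_coe]
    push_cast
    have := norm_add_le a b
    nlinarith [norm_nonneg (a + b), sq_nonneg (‖a‖ - ‖b‖)]
  simp only [enorm_eq_nnnorm]
  exact_mod_cast h

theorem normSq_add_le (h : MetricTensor n M) {k : ℕ} (w η : Form n M ℂ k) (x : M) :
    (w + η).normSq h x ≤ 2 * w.normSq h x + 2 * η.normSq h x := by
  refine iSup₂_le fun e he => ?_
  calc _ ≤ ∑ I : Fin k ↪o Fin n, (2 * ‖w x (fun a => e (I a))‖ₑ ^ 2
        + 2 * ‖η x (fun a => e (I a))‖ₑ ^ 2) := Finset.sum_le_sum fun I _ => enorm_add_sq_le _ _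
    _ = 2 * (∑ I : Fin k ↪o Fin n, ‖w x (fun a => e (I a))‖ₑ ^ 2)
        + 2 * (∑ I : Fin k ↪o Fin n, ‖η x (fun a => e (I a))‖ₑ ^ 2) := by
      rw [Finset.sum_add_distrib, Finset.mul_sum, Finset.mul_sum]
    _ ≤ _ := by
      gcongr
      · exact le_iSup₂_of_le (f := fun (e : Fin n → TangentSpace (𝓡 n) x)
          (_ : IsOrthonormalFrame h x e) => ∑ I : Fin k ↪o Fin n, ‖w x (fun a => e (I a))‖ₑ ^ 2)
          e he le_rfl
      · exact le_iSup₂_of_le (f := fun (e : Fin n → TangentSpace (𝓡 n) x)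
          (_ : IsOrthonormalFrame h x e) => ∑ I : Fin k ↪o Fin n, ‖η x (fun a => e (I a))‖ₑ ^ 2)
          e he le_rfl

theorem normSq_smul_le (h : MetricTensor n M) {k : ℕ} (c : ℂ) (w : Form n M ℂ k) (x : M) :
    (c • w).normSq h x ≤ ‖c‖ₑ ^ 2 * w.normSq h x := by
  refine iSup₂_le fun e he => ?_
  calc _ = ‖c‖ₑ ^ 2 * ∑ I : Fin k ↪o Fin n, ‖w x (fun a => e (I a))‖ₑ ^ 2 := by
        rw [Finset.mul_sum]
        refine Finset.sum_congr rfl fun I _ => ?_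
        rw [← mul_pow, ← enorm_smul]
        rfl
    _ ≤ _ := by
      refine mul_le_mul' le_rfl ?_
      exact le_iSup₂_of_le (f := fun (e : Fin n → TangentSpace (𝓡 n) x)
          (_ : IsOrthonormalFrame h x e) => ∑ I : Fin k ↪o Fin n, ‖w x (fun a => e (I a))‖ₑ ^ 2)
          e he le_rfl

variable [MeasurableSpace M]

theorem l2Sq_add_lt {h : MetricTensor n M} {k : ℕ} {w η : Form n M ℂ k} {s t : ℝ≥0∞}
    (hw : w.l2Sq h < s) (hη : η.l2Sq h < t) : (w + η).l2Sq h < 2 * s + 2 * t := by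
  obtain ⟨u, hu, hu1, hu2⟩ := upperIntegral_lt_iff.1 hw
  obtain ⟨v, hv, hv1, hv2⟩ := upperIntegral_lt_iff.1 hη
  refine upperIntegral_lt_iff.2 ⟨fun x => 2 * u x + 2 * v x, by fun_prop, fun x => ?_, ?_⟩
  · refine (normSq_add_le h w η x).trans ?_
    exact add_le_add (mul_le_mul' le_rfl (hu1 x)) (mul_le_mul' le_rfl (hv1 x))
  · rw [lintegral_add_left (by fun_prop), lintegral_const_mul _ hu, lintegral_const_mul _ hv]
    have h2 : (2 : ℝ≥0∞) ≠ ⊤ := by simp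
    exact ENNReal.add_lt_add ((ENNReal.mul_lt_mul_iff_right (by simp) h2).2 hu2)
      ((ENNReal.mul_lt_mul_iff_right (by simp) h2).2 hv2)

theorem l2Sq_smul_le (h : MetricTensor n M) {k : ℕ} (c : ℂ) (w : Form n M ℂ k) :
    (c • w).l2Sq h ≤ ‖c‖ₑ ^ 2 * w.l2Sq h := by
  by_cases hc : ‖c‖ₑ ^ 2 = 0
  · have hz : c = 0 := by simpa using hc
    rw [hc, zero_mul]
    refine iInf_le_of_le (fun _ => 0) (iInf_le_of_le measurable_const (iInf_le_of_le
      (fun x => ?_) (by simp)))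
    exact (normSq_smul_le h c w x).trans (by simp [hz])
  · have hc' : ‖c‖ₑ ^ 2 ≠ ⊤ := by simp
    rw [mul_comm, ← ENNReal.div_le_iff hc hc']
    refine le_iInf fun u => le_iInf fun hu => le_iInf fun hle => ?_
    rw [ENNReal.div_le_iff hc hc', mul_comm, ← lintegral_const_mul _ hu]
    refine iInf_le_of_le _ (iInf_le_of_le (hu.const_mul _) (iInf_le_of_le (fun x => ?_) le_rfl))
    exact (normSq_smul_le h c w x).trans (mul_le_mul_right (hle x) _)

theorem l2Sq_zero (h : MetricTensor n M) {k : ℕ} : (0 : Form n M ℂ k).l2Sq h = 0 := by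
  simpa using l2Sq_smul_le h 0 (0 : Form n M ℂ k)

theorem memL2_add {h : MetricTensor n M} {k : ℕ} {w η : Form n M ℂ k} (hw : w.MemL2 h)
    (hη : η.MemL2 h) : (w + η).MemL2 h := by
  refine ⟨fun x₀ => (hw.1 x₀).add (hη.1 x₀), ?_⟩
  simpa using l2Sq_add_lt hw.2 hη.2

theorem memL2_smul {h : MetricTensor n M} {k : ℕ} (c : ℂ) {w : Form n M ℂ k}
    (hw : w.MemL2 h) : (c • w).MemL2 h :=
  ⟨fun x₀ => (hw.1 x₀).const_smul c,
    (l2Sq_smul_le h c w).trans_lt (ENNReal.mul_lt_top (by simp) hw.2)⟩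

theorem memL2_zero (h : MetricTensor n M) {k : ℕ} : (0 : Form n M ℂ k).MemL2 h :=
  ⟨fun x₀ => by rw [inChart_zero]; exact aestronglyMeasurable_const, by simp [l2Sq_zero]⟩

end Facts

/-! ### The twisted `L²` complex and its reduced cohomology -/

section Cohomology

variable {n : ℕ} {M : Type*} [TopologicalSpace M] [ChartedSpace (Model n) M] [MeasurableSpace M]

/-- The core of the twisted differential: smooth `L²` forms `w` such that `d_θ w` is `L²`. -/
def smoothCore (h : MetricTensor n M) (θ : Form n M ℝ 1) (k : ℕ) : Submodule ℂ (Form n M ℂ k) where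
  carrier := {w | w.Smooth ∧ w.MemL2 h ∧ (Form.twistedD θ w).MemL2 h}
  zero_mem' := ⟨smooth_zero, memL2_zero h, by rw [twistedD_zero]; exact memL2_zero h⟩
  add_mem' := fun ha hb => ⟨smooth_add ha.1 hb.1, memL2_add ha.2.1 hb.2.1, by
    rw [twistedD_add θ ha.1 hb.1]; exact memL2_add ha.2.2 hb.2.2⟩
  smul_mem' := fun c _ ha => ⟨smooth_smul c ha.1, memL2_smul c ha.2.1, by
    rw [twistedD_smul θ c ha.1]; exact memL2_smul c ha.2.2⟩

theorem exists_small (c ε : ℝ≥0∞) (hc : c ≠ ⊤) (hε : 0 < ε) : ∃ δ > 0, c * δ ≤ ε := by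
  by_cases h0 : c = 0
  · exact ⟨1, by simp, by simp [h0]⟩
  · by_cases ht : ε = ⊤
    · exact ⟨1, by simp, by simp [ht]⟩
    · exact ⟨ε / c, ENNReal.div_pos hε.ne' hc, by rw [ENNReal.mul_div_cancel h0 hc]⟩

/-- The graph of the closure of the unbounded operator `d_θ` from `L²` `k`-forms to `L²`
`(k+1)`-forms: the closure, in `L² × L²`, of the graph of `d_θ` on its smooth core. -/
def closedGraph (h : MetricTensor n M) (θ : Form n M ℝ 1) (k : ℕ) :
    Submodule ℂ (Form n M ℂ k × Form n M ℂ (k + 1)) where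
  carrier := {q | q.1.MemL2 h ∧ q.2.MemL2 h ∧ ∀ ε > (0 : ℝ≥0∞), ∃ ζ ∈ smoothCore h θ k,
    (q.1 - ζ).l2Sq h < ε ∧ (q.2 - Form.twistedD θ ζ).l2Sq h < ε}
  zero_mem' := ⟨memL2_zero h, memL2_zero h, fun ε hε => ⟨0, Submodule.zero_mem _, by
    simpa [l2Sq_zero] using hε, by simpa [l2Sq_zero, twistedD_zero] using hε⟩⟩
  add_mem' := by
    rintro ⟨a, a'⟩ ⟨b, b'⟩ ⟨ha, ha', hA⟩ ⟨hb, hb', hB⟩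
    refine ⟨memL2_add ha hb, memL2_add ha' hb', fun ε hε => ?_⟩
    obtain ⟨δ, hδ, hδε⟩ := exists_small 4 ε (by simp) hε
    have h4 : 2 * δ + 2 * δ ≤ ε := by rw [← add_mul]; norm_num; exact hδε
    obtain ⟨z, hz, hz1, hz2⟩ := hA δ hδ
    obtain ⟨w, hw, hw1, hw2⟩ := hB δ hδ
    refine ⟨z + w, Submodule.add_mem _ hz hw, ?_, ?_⟩
    · simpa only [Prod.fst_add, add_sub_add_comm] using (l2Sq_add_lt hz1 hw1).trans_le h4
    · rw [twistedD_add θ hz.1 hw.1]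
      simpa only [Prod.snd_add, add_sub_add_comm] using (l2Sq_add_lt hz2 hw2).trans_le h4
  smul_mem' := by
    rintro c ⟨a, a'⟩ ⟨ha, ha', hA⟩
    refine ⟨memL2_smul c ha, memL2_smul c ha', fun ε hε => ?_⟩
    obtain ⟨ε', hε', hlt⟩ := exists_between hε
    obtain ⟨δ, hδ, hδε⟩ := exists_small (‖c‖ₑ ^ 2) ε' (by simp) hε'
    obtain ⟨z, hz, hz1, hz2⟩ := hA δ hδ
    refine ⟨c • z, Submodule.smul_mem _ c hz, ?_, ?_⟩
    · rw [Prod.smul_fst, ← smul_sub]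
      exact (((l2Sq_smul_le h c _).trans (by gcongr)).trans hδε).trans_lt hlt
    · rw [Prod.smul_snd, twistedD_smul θ c hz.1, ← smul_sub]
      exact (((l2Sq_smul_le h c _).trans (by gcongr)).trans hδε).trans_lt hlt

/-- The closure of a space of forms in the space of `L²` forms. It contains all forms that
vanish almost everywhere. -/
def l2Closure (h : MetricTensor n M) {k : ℕ} (S : Submodule ℂ (Form n M ℂ k)) :
    Submodule ℂ (Form n M ℂ k) where
  carrier := {w | w.MemL2 h ∧ ∀ ε > (0 : ℝ≥0∞), ∃ η ∈ S, (w - η).l2Sq h < ε}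
  zero_mem' := ⟨memL2_zero h, fun ε hε => ⟨0, S.zero_mem, by simpa [l2Sq_zero] using hε⟩⟩
  add_mem' := by
    rintro a b ⟨ha, hA⟩ ⟨hb, hB⟩
    refine ⟨memL2_add ha hb, fun ε hε => ?_⟩
    obtain ⟨δ, hδ, hδε⟩ := exists_small 4 ε (by simp) hε
    have h4 : 2 * δ + 2 * δ ≤ ε := by rw [← add_mul]; norm_num; exact hδε
    obtain ⟨z, hz, hz1⟩ := hA δ hδ
    obtain ⟨w, hw, hw1⟩ := hB δ hδ
    refine ⟨z + w, S.add_mem hz hw, ?_⟩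
    rw [add_sub_add_comm]
    exact (l2Sq_add_lt hz1 hw1).trans_le h4
  smul_mem' := by
    rintro c a ⟨ha, hA⟩
    refine ⟨memL2_smul c ha, fun ε hε => ?_⟩
    obtain ⟨ε', hε', hlt⟩ := exists_between hε
    obtain ⟨δ, hδ, hδε⟩ := exists_small (‖c‖ₑ ^ 2) ε' (by simp) hε'
    obtain ⟨z, hz, hz1⟩ := hA δ hδ
    refine ⟨c • z, S.smul_mem c hz, ?_⟩
    rw [← smul_sub]
    exact (((l2Sq_smul_le h c _).trans (by gcongr)).trans hδε).trans_lt hlt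

/-- `Ker d_θ` on `L²` `k`-forms, for the closed operator `d_θ`. -/
def cocycles (h : MetricTensor n M) (θ : Form n M ℝ 1) (k : ℕ) : Submodule ℂ (Form n M ℂ k) :=
  (closedGraph h θ k).comap (LinearMap.inl ℂ (Form n M ℂ k) (Form n M ℂ (k + 1)))

/-- `Im d_θ` on `L²` `(k-1)`-forms, for the closed operator `d_θ`; it is `0` for `k = 0`. -/
def imageD (h : MetricTensor n M) (θ : Form n M ℝ 1) : ∀ k : ℕ, Submodule ℂ (Form n M ℂ k)
  | 0 => ⊥
  | k + 1 => (closedGraph h θ k).map (LinearMap.snd ℂ (Form n M ℂ k) (Form n M ℂ (k + 1)))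

/-- The reduced twisted `L²` cohomology `H^k_{(2)} = Ker d_θ / cl(Im d_θ)`. (Forms that agree almost
everywhere are identified by the quotient.) -/
abbrev Cohomology (h : MetricTensor n M) (θ : Form n M ℝ 1) (k : ℕ) : Type _ :=
  ↥(cocycles h θ k) ⧸ (l2Closure h (imageD h θ k)).submoduleOf (cocycles h θ k)

end Cohomology

/-- `p : N → M` is a universal covering of smooth manifolds: a covering by a simply connected
manifold and a local diffeomorphism. -/
structure IsUniversalCovering {n : ℕ} {M N : Type*} [TopologicalSpace M]
    [ChartedSpace (Model n) M] [TopologicalSpace N] [ChartedSpace (Model n) N] (p : N → M) :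
    Prop where
  simplyConnected : SimplyConnectedSpace N
  isCovering : IsCoveringMap p
  isLocalDiffeomorph : IsLocalDiffeomorph (𝓡 n) (𝓡 n) ∞ p

/-- The twisted `L²` cohomology `H^k_{(2)}(M̃, θ)` of a covering `p : M̃ → M`, with respect to the
lifted metric `p^* g` and the lifted form `p^* θ`. -/
abbrev TwistedL2Cohomology {n : ℕ} {M N : Type*} [TopologicalSpace M] [ChartedSpace (Model n) M]
    [IsManifold (𝓡 n) ∞ M] [TopologicalSpace N] [ChartedSpace (Model n) N] [MeasurableSpace N]
    (p : N → M) (g : RiemannianMetricOn n M) (θ : Form n M ℝ 1) (k : ℕ) : Type _ :=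
  Cohomology (pullbackMetric p g) (θ.pullback p) k

end TwistedL2

end

namespace TwistedL2

/-! ### Distributions with vanishing gradient -/

section Euclid

variable {E : Type*} [NormedAddCommGroup E] [InnerProductSpace ℝ E] [FiniteDimensional ℝ E]
  [MeasurableSpace E] [BorelSpace E]

open Filter in
/-- An integrable function whose distributional gradient vanishes on a ball is almost everywhere
constant on this ball. -/
theorem ae_eq_const_of_weak_fderiv_eq_zero {c : E} {R : ℝ} (hR : 0 < R) {w : E → ℂ}
    (hw : Integrable w)
    (H : ∀ χ : E → ℝ, ContDiff ℝ ∞ χ → HasCompactSupport χ → tsupport χ ⊆ Metric.ball c R →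
      ∀ v : E, ∫ y, (fderiv ℝ χ y v) • w y = 0) :
    ∃ C : ℂ, ∀ᵐ y, y ∈ Metric.ball c R → w y = C := by
  let φ : ℕ → ContDiffBump (0 : E) := fun k =>
    ⟨1 / ((k : ℝ) + 1) / 2, 1 / ((k : ℝ) + 1), by positivity, by
      have : (0 : ℝ) < 1 / ((k : ℝ) + 1) := by positivity
      linarith⟩
  have hout : ∀ k, (φ k).rOut = 1 / ((k : ℝ) + 1) := fun k => rfl
  have hlim : Tendsto (fun k => (φ k).rOut) atTop (𝓝 0) := by
    simp only [hout]; exact tendsto_one_div_add_atTop_nhds_zero_nat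
  let h : ℕ → E → ℂ := fun k =>
    convolution ((φ k).normed volume) w (ContinuousLinearMap.lsmul ℝ ℝ) volume
  have hae : ∀ᵐ y : E, Tendsto (fun k => h k y) atTop (𝓝 (w y)) :=
    ContDiffBump.ae_convolution_tendsto_right_of_locallyIntegrable (K := 2) hlim
      (Eventually.of_forall fun k => by simp only [φ]; linarith) hw.locallyIntegrable
  have hsm : ∀ k, ContDiff ℝ ∞ ((φ k).normed volume) := fun k => (φ k).contDiff_normed
  have hcs : ∀ k, HasCompactSupport ((φ k).normed volume) := fun k => (φ k).hasCompactSupport_normed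
  have hder : ∀ k y, HasFDerivAt (h k) (convolution (fderiv ℝ ((φ k).normed volume)) w
      ((ContinuousLinearMap.lsmul ℝ ℝ).precompL E) volume y) y := fun k y =>
    (hcs k).hasFDerivAt_convolution_left _ ((hsm k).of_le (by simp)) hw.locallyIntegrable y
  have hzero : ∀ k, ∀ y ∈ Metric.ball c (R - (φ k).rOut), fderiv ℝ (h k) y = 0 := by
    intro k y hy
    rw [(hder k y).fderiv]
    ext v
    have hex : ConvolutionExistsAt (fderiv ℝ ((φ k).normed volume)) w y
        ((ContinuousLinearMap.lsmul ℝ ℝ).precompL E) volume :=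
      ((hcs k).fderiv ℝ).convolutionExists_left _ ((hsm k).continuous_fderiv (by simp))
        hw.locallyIntegrable y
    rw [convolution_def, ContinuousLinearMap.integral_apply hex]
    simp only [ContinuousLinearMap.precompL_apply, ContinuousLinearMap.lsmul_apply,
      zero_apply]
    rw [← integral_sub_left_eq_self _ volume y]
    simp only [sub_sub_cancel]
    have hs : ContDiff ℝ ∞ (fun t => (φ k).normed volume (y - t)) :=
      (hsm k).comp (contDiff_const.sub contDiff_id)
    have hsupp : tsupport (fun t => (φ k).normed volume (y - t)) ⊆
        Metric.closedBall y (φ k).rOut := by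
      refine closure_minimal (fun t ht => ?_) Metric.isClosed_closedBall
      have : y - t ∈ Function.support ((φ k).normed volume) := ht
      rw [(φ k).support_normed_eq] at this
      rw [Metric.mem_closedBall, dist_eq_norm, ← norm_neg, neg_sub]
      exact (mem_ball_zero_iff.1 this).le
    have hcs' : HasCompactSupport (fun t => (φ k).normed volume (y - t)) :=
      HasCompactSupport.of_support_subset_isCompact (isCompact_closedBall y (φ k).rOut)
        ((subset_tsupport _).trans hsupp)
    have := H _ hs hcs' (hsupp.trans fun t ht => by
      rw [Metric.mem_closedBall] at ht; rw [Metric.mem_ball] at hy ⊢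
      linarith [dist_triangle t y c]) v
    have hf : ∀ t, fderiv ℝ (fun t => (φ k).normed volume (y - t)) t v =
        - fderiv ℝ ((φ k).normed volume) (y - t) v := by
      intro t
      have h1 : HasFDerivAt ((φ k).normed volume) (fderiv ℝ ((φ k).normed volume) (y - t)) (y - t) :=
        ((hsm k).differentiable (by simp) _).hasFDerivAt
      have h2 : HasFDerivAt (fun t => y - t) (-ContinuousLinearMap.id ℝ E) t := by
        simpa using (hasFDerivAt_id t).const_sub y
      have h3 : HasFDerivAt (fun t => (φ k).normed volume (y - t)) _ t := h1.comp t h2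
      rw [h3.fderiv]
      simp
    simp only [hf, neg_smul, integral_neg, neg_eq_zero] at this
    exact this
  have hconst : ∀ k, ∀ y ∈ Metric.ball c (R - (φ k).rOut), ∀ z ∈ Metric.ball c (R - (φ k).rOut),
      h k y = h k z := fun k y hy z hz =>
    (convex_ball c _).is_const_of_fderivWithin_eq_zero (𝕜 := ℝ)
      (fun x _ => (hder k x).differentiableAt.differentiableWithinAt)
      (fun x hx => by rw [fderivWithin_of_isOpen Metric.isOpen_ball hx]; exact hzero k x hx) hy hz
  have hmem : ∀ y ∈ Metric.ball c R, ∀ᶠ k in atTop, y ∈ Metric.ball c (R - (φ k).rOut) := by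
    intro y hy
    rw [Metric.mem_ball] at hy
    filter_upwards [hlim.eventually (gt_mem_nhds (sub_pos.2 hy))] with k hk
    rw [Metric.mem_ball]; linarith
  have : ∃ y₀ ∈ Metric.ball c R, Tendsto (fun k => h k y₀) atTop (𝓝 (w y₀)) := by
    by_contra! hne
    have : Metric.ball c R ⊆ {y | ¬ Tendsto (fun k => h k y) atTop (𝓝 (w y))} := hne
    have h0 := measure_mono_null this (ae_iff.1 hae)
    exact (Metric.measure_ball_pos volume c hR).ne' h0
  obtain ⟨y₀, hy₀, ht₀⟩ := this
  refine ⟨w y₀, ?_⟩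
  filter_upwards [hae] with y hy hyB
  refine tendsto_nhds_unique hy (ht₀.congr' ?_)
  filter_upwards [hmem y hyB, hmem y₀ hy₀] with k h1 h2
  exact hconst k _ h2 _ h1

/-- A local weak solution of `dw + a w = 0`, where `a = dG` is exact, is almost everywhere a
multiple of `exp (-G)`. -/
theorem ae_eq_const_mul_exp_of_weak_solution {c : E} {R : ℝ} (hR : 0 < R) {V : Set E}
    (hV : IsOpen V) (hRV : Metric.closedBall c R ⊆ V) {w : E → ℂ} {a : E → E →L[ℝ] ℝ}
    (ha : ContDiffOn ℝ ∞ a V) {G : E → ℝ} (hG : ∀ y ∈ V, HasFDerivAt G (a y) y)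
    (hw : IntegrableOn w (Metric.closedBall c R))
    (H : ∀ χ : E → ℝ, ContDiff ℝ ∞ χ → HasCompactSupport χ → tsupport χ ⊆ Metric.ball c R →
      ∀ v : E, ∫ y, (fderiv ℝ χ y v - a y v * χ y) • w y = 0) :
    ∃ C : ℂ, ∀ᵐ y, y ∈ Metric.ball c R → w y = C * Real.exp (-G y) := by
  have hGs : ContDiffOn ℝ ∞ G V := by
    rw [contDiffOn_infty_iff_fderiv_of_isOpen hV]
    exact ⟨fun y hy => (hG y hy).differentiableAt.differentiableWithinAt,
      ha.congr fun y hy => (hG y hy).fderiv⟩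
  have hcont : ContinuousOn (fun y => ((Real.exp (G y) : ℝ) : ℂ)) (Metric.closedBall c R) :=
    Complex.continuous_ofReal.comp_continuousOn
      (Real.continuous_exp.comp_continuousOn (hGs.continuousOn.mono hRV))
  have hint : IntegrableOn (fun y => ((Real.exp (G y) : ℝ) : ℂ) * w y) (Metric.closedBall c R) :=
    hw.continuousOn_mul hcont (isCompact_closedBall c R)
  obtain ⟨C, hC⟩ := ae_eq_const_of_weak_fderiv_eq_zero hR
    (w := (Metric.closedBall c R).indicator fun y => ((Real.exp (G y) : ℝ) : ℂ) * w y)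
    (hint.integrable_indicator Metric.isClosed_closedBall.measurableSet) (by
      intro χ hχ hcs hsub v
      have hsubV : tsupport χ ⊆ V := hsub.trans (Metric.ball_subset_closedBall.trans hRV)
      have hψs : tsupport (fun y => Real.exp (G y) * χ y) ⊆ tsupport χ :=
        closure_mono fun y hy => right_ne_zero_of_mul hy
      have hψ : ContDiff ℝ ∞ (fun y => Real.exp (G y) * χ y) := by
        rw [contDiff_iff_contDiffAt]
        intro y
        by_cases hy : y ∈ tsupport χ
        · exact ((hGs.contDiffAt (hV.mem_nhds (hsubV hy))).exp).mul hχ.contDiffAt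
        · exact contDiffAt_const.congr_of_eventuallyEq
            (notMem_tsupport_iff_eventuallyEq.1 fun h => hy (hψs h))
      have := H _ hψ (hcs.mono fun y hy => right_ne_zero_of_mul hy) (hψs.trans hsub) v
      rw [← this]
      refine integral_congr_ae (Filter.Eventually.of_forall fun y => ?_)
      by_cases hy : y ∈ tsupport χ
      · have h1 : HasFDerivAt (fun y => Real.exp (G y) * χ y)
            (Real.exp (G y) • fderiv ℝ χ y + χ y • (Real.exp (G y) • a y)) y :=
          ((hG y (hsubV hy)).exp).mul (hχ.differentiable (by simp) y).hasFDerivAt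
        simp only
        rw [h1.fderiv, Set.indicator_of_mem (Metric.ball_subset_closedBall (hsub hy))]
        simp only [add_apply, smul_apply, smul_eq_mul,
          Complex.real_smul]
        push_cast
        ring
      · have e1 : fderiv ℝ χ y = 0 := by
          rw [(notMem_tsupport_iff_eventuallyEq.1 hy).fderiv_eq]; simp
        have e2 : fderiv ℝ (fun y => Real.exp (G y) * χ y) y = 0 := by
          rw [(notMem_tsupport_iff_eventuallyEq.1 fun h => hy (hψs h)).fderiv_eq]; simp
        simp only
        rw [e1, e2, image_eq_zero_of_notMem_tsupport hy]
        simp)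
  refine ⟨C, ?_⟩
  filter_upwards [hC] with y hy hyB
  have := hy hyB
  rw [Set.indicator_of_mem (Metric.ball_subset_closedBall hyB)] at this
  rw [← this, mul_right_comm, ← Complex.ofReal_mul, ← Real.exp_add]
  simp

end Euclid

/-! ### Pullback of alternating maps, and the determinant form -/

section Alternating

variable {E E' F : Type*} [NormedAddCommGroup E] [NormedSpace ℝ E] [NormedAddCommGroup E']
  [NormedSpace ℝ E'] [NormedAddCommGroup F] [NormedSpace ℝ F]

/-- Normalized alternatization, as a continuous linear map. -/
noncomputable def alternatizeCLM (k : ℕ) : ContinuousMultilinearMap ℝ (fun _ : Fin k => E) F →L[ℝ]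
    E [⋀^Fin k]→L[ℝ] F :=
  LinearMap.mkContinuous
    { toFun := fun f => ((k.factorial : ℝ)⁻¹) • ContinuousMultilinearMap.alternatization f
      map_add' := fun f g => by rw [map_add, smul_add]
      map_smul' := fun c f => by
        ext v
        simp [ContinuousMultilinearMap.alternatization_apply_apply, Finset.smul_sum, smul_comm c] }
    ((k.factorial : ℝ)⁻¹ * Fintype.card (Equiv.Perm (Fin k))) (fun f => by
      simp only [LinearMap.coe_mk, AddHom.coe_mk]
      rw [norm_smul, mul_assoc, Real.norm_of_nonneg (by positivity)]
      refine mul_le_mul_of_nonneg_left ?_ (by positivity)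
      refine ContinuousAlternatingMap.opNorm_le_bound _ (mul_nonneg (Nat.cast_nonneg _) (norm_nonneg _)) fun v => ?_
      rw [ContinuousMultilinearMap.alternatization_apply_apply]
      refine (norm_sum_le _ _).trans ?_
      rw [mul_assoc, Fintype.card, ← nsmul_eq_mul]
      refine Finset.sum_le_card_nsmul _ _ _ fun σ _ => ?_
      have h1 : ‖Equiv.Perm.sign σ • f (v ∘ σ)‖ = ‖f (v ∘ σ)‖ := by
        rcases Int.units_eq_one_or (Equiv.Perm.sign σ) with h | h <;> simp [h]
      rw [h1]
      refine (f.le_opNorm _).trans_eq ?_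
      congr 1
      exact Equiv.prod_comp σ fun i => ‖v i‖)

theorem alternatizeCLM_coe {k : ℕ} (f : E [⋀^Fin k]→L[ℝ] F) :
    alternatizeCLM k f.toContinuousMultilinearMap = f := by
  ext v
  change ((k.factorial : ℝ)⁻¹) • (ContinuousMultilinearMap.alternatization
    f.toContinuousMultilinearMap) v = f v
  rw [ContinuousMultilinearMap.alternatization_apply_apply]
  have : ∀ σ : Equiv.Perm (Fin k),
      Equiv.Perm.sign σ • f.toContinuousMultilinearMap (v ∘ σ) = f v := by
    intro σ
    have := f.toAlternatingMap.map_perm v σ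
    change _ • f (v ∘ σ) = f v
    change f (v ∘ σ) = _ • f v at this
    rw [this, smul_smul, Int.units_mul_self, one_smul]
  simp only [this, Finset.sum_const, Finset.card_univ, Fintype.card_perm, Fintype.card_fin]
  rw [← Nat.cast_smul_eq_nsmul ℝ, smul_smul, inv_mul_cancel₀ (by positivity), one_smul]

theorem contDiff_compContinuousLinearMap (k : ℕ) : ContDiff ℝ ∞
    (fun q : (E' [⋀^Fin k]→L[ℝ] F) × (E →L[ℝ] E') => q.1.compContinuousLinearMap q.2) := by
  have h : (fun q : (E' [⋀^Fin k]→L[ℝ] F) × (E →L[ℝ] E') => q.1.compContinuousLinearMap q.2) =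
      fun q => alternatizeCLM k
        (ContinuousMultilinearMap.compContinuousLinearMapContinuousMultilinear ℝ
          (fun _ : Fin k => E) (fun _ : Fin k => E') F (fun _ => q.2)
          (ContinuousAlternatingMap.toContinuousMultilinearMapCLM ℝ q.1)) := by
    funext q
    exact (alternatizeCLM_coe _).symm
  rw [h]
  refine ContDiff.comp (ContinuousLinearMap.contDiff (𝕜 := ℝ) (E := ContinuousMultilinearMap ℝ (fun _ : Fin k => E) F)
    (alternatizeCLM k)) (ContDiff.clm_apply ?_ ?_)
  · exact (ContinuousMultilinearMap.contDiff _).comp (contDiff_pi.2 fun _ => contDiff_snd)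
  · exact (ContinuousLinearMap.contDiff _).comp contDiff_fst

theorem extMul_apply {k : ℕ} (a : E [⋀^Fin 1]→L[ℝ] ℝ) (β : E [⋀^Fin k]→L[ℝ] F)
    (v : Fin (k + 1) → E) :
    extMul a β v = ∑ i, (-1) ^ i.val • a (fun _ => v i) • β (i.removeNth v) := by
  rw [extMul, ContinuousAlternatingMap.alternatizeUncurryFin_apply]
  rfl

theorem extMul_compContinuousLinearMap {k : ℕ} (a : E' [⋀^Fin 1]→L[ℝ] ℝ)
    (β : E' [⋀^Fin k]→L[ℝ] F) (A : E →L[ℝ] E') :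
    (extMul a β).compContinuousLinearMap A =
      extMul (a.compContinuousLinearMap A) (β.compContinuousLinearMap A) := by
  ext v
  rw [ContinuousAlternatingMap.compContinuousLinearMap_apply, extMul_apply, extMul_apply]
  rfl

theorem continuous_extMul {k : ℕ} : Continuous
    (fun q : (E [⋀^Fin 1]→L[ℝ] ℝ) × (E [⋀^Fin k]→L[ℝ] F) => extMul q.1 q.2) := by
  have h : (fun q : (E [⋀^Fin 1]→L[ℝ] ℝ) × (E [⋀^Fin k]→L[ℝ] F) => extMul q.1 q.2) =
      fun q => ContinuousAlternatingMap.alternatizeUncurryFinCLM ℝ E F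
        (ContinuousLinearMap.smulRightL ℝ E (E [⋀^Fin k]→L[ℝ] F)
          ((ContinuousAlternatingMap.ofSubsingletonLIE (𝕜 := ℝ) (E := E) (F := ℝ)
            (0 : Fin 1)).symm q.1) q.2) := rfl
  rw [h]
  refine (ContinuousLinearMap.continuous _).comp ?_
  refine (((ContinuousLinearMap.continuous _).comp
    ((LinearIsometryEquiv.continuous _).comp continuous_fst)).clm_apply continuous_snd)

theorem continuousOn_extMul {X : Type*} [TopologicalSpace X] {s : Set X} {k : ℕ}
    {a : X → E [⋀^Fin 1]→L[ℝ] ℝ} {β : X → E [⋀^Fin k]→L[ℝ] F} (ha : ContinuousOn a s)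
    (hβ : ContinuousOn β s) : ContinuousOn (fun x => extMul (a x) (β x)) s := by
  intro x hx
  have h1 : Filter.Tendsto (fun x => (a x, β x)) (𝓝[s] x) (𝓝 (a x, β x)) :=
    (ha x hx).prodMk_nhds (hβ x hx)
  have h0 := (continuous_extMul (E := E) (F := F) (k := k)).tendsto (a x, β x)
  have h2 := h0.comp h1
  dsimp only [Function.comp_def] at h2
  exact h2

end Alternating

section Det

/-- The standard basis of `ℝⁿ`. -/
noncomputable abbrev stdVec {n : ℕ} (i : Fin n) : Model n := EuclideanSpace.single i (1 : ℝ)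

/-- The determinant as a continuous complex-valued alternating form on `ℝⁿ`. -/
noncomputable def detForm (n : ℕ) : Model n [⋀^Fin n]→L[ℝ] ℂ :=
  { toMultilinearMap := Complex.ofRealCLM.toLinearMap.compMultilinearMap
      (EuclideanSpace.basisFun (Fin n) ℝ).toBasis.det.toMultilinearMap
    cont := by
      change Continuous fun v : Fin n → Model n =>
        Complex.ofRealCLM ((EuclideanSpace.basisFun (Fin n) ℝ).toBasis.det v)
      refine Complex.ofRealCLM.continuous.comp ?_
      change Continuous fun v : Fin n → Model n =>
        ((EuclideanSpace.basisFun (Fin n) ℝ).toBasis.toMatrix v).det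
      refine Continuous.matrix_det ?_
      refine continuous_matrix fun i j => ?_
      simp only [Module.Basis.toMatrix_apply]
      have : (fun a : Fin n → Model n =>
          (EuclideanSpace.basisFun (Fin n) ℝ).toBasis.repr (a j) i) = fun a => (a j) i := by
        funext a; simp
      rw [this]
      fun_prop
    map_eq_zero_of_eq' := fun v i j h hij => by
      change Complex.ofRealCLM ((EuclideanSpace.basisFun (Fin n) ℝ).toBasis.det v) = 0
      rw [AlternatingMap.map_eq_zero_of_eq _ v h hij, map_zero] }

theorem detForm_std (n : ℕ) : detForm n stdVec = 1 := by
  change Complex.ofRealCLM ((EuclideanSpace.basisFun (Fin n) ℝ).toBasis.det _) = 1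
  have : (stdVec : Fin n → Model n) = (EuclideanSpace.basisFun (Fin n) ℝ).toBasis := by
    funext i; simp
  rw [this, Module.Basis.det_self]; simp

/-- `a ∧ ι_v det = a(v) det`. -/
theorem alternatizeUncurryFin_smulRight_curryLeft {k : ℕ} (a : Model (k + 1) →L[ℝ] ℝ)
    (v : Model (k + 1)) (w : Fin (k + 1) → Model (k + 1)) :
    ∑ i, (-1) ^ i.val • a (w i) • detForm (k + 1) (Fin.cons v (i.removeNth w)) =
      a v • detForm (k + 1) w := by
  let T : Model (k + 1) [⋀^Fin (k + 2)]→L[ℝ] ℂ :=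
    ContinuousAlternatingMap.alternatizeUncurryFin (a.smulRight (detForm (k + 1)))
  have h : T (Fin.cons v w) = 0 := by
    refine T.toAlternatingMap.map_linearDependent _ fun hli => ?_
    have := hli.fintype_card_le_finrank
    simp at this
  rw [ContinuousAlternatingMap.alternatizeUncurryFin_apply, Fin.sum_univ_succ] at h
  simp only [Fin.val_zero, pow_zero, one_smul, Fin.cons_zero, Fin.val_succ, Fin.cons_succ,
    ContinuousLinearMap.smulRight_apply] at h
  rw [eq_comm, ← sub_eq_zero, ← h, sub_eq_add_neg, ← Finset.sum_neg_distrib]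
  refine congr_arg₂ _ ?_ (Finset.sum_congr rfl fun i _ => ?_)
  · rw [Fin.removeNth_zero, Fin.tail_cons]; rfl
  · rw [pow_succ, mul_smul, neg_one_smul, smul_neg]
    have : (i.succ.removeNth (Fin.cons v w : Fin (k + 2) → Model (k + 1))) =
        (Fin.cons v (i.removeNth w) : Fin (k + 1) → Model (k + 1)) :=
      Fin.cons_comp_succ_succAbove v w i
    rw [this]
    rfl

end Det

/-! ### Coordinate expressions of maps and forms -/

section Charts

variable {n : ℕ} {M : Type*} [TopologicalSpace M] [ChartedSpace (Model n) M]
  [IsManifold (𝓡 n) ∞ M] {N : Type*} [TopologicalSpace N] [ChartedSpace (Model n) N]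
  [IsManifold (𝓡 n) ∞ N]

theorem contMDiffAt_extChartAt_symm' {x₀ : N} {y : Model n}
    (hy : y ∈ (extChartAt (𝓡 n) x₀).target) :
    ContMDiffAt 𝓘(ℝ, Model n) (𝓡 n) ∞ (extChartAt (𝓡 n) x₀).symm y :=
  (contMDiffOn_extChartAt_symm x₀).contMDiffAt ((isOpen_extChartAt_target x₀).mem_nhds hy)

theorem mdifferentiableAt_extChartAt_symm' {x₀ : N} {y : Model n}
    (hy : y ∈ (extChartAt (𝓡 n) x₀).target) :
    MDifferentiableAt 𝓘(ℝ, Model n) (𝓡 n) (extChartAt (𝓡 n) x₀).symm y :=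
  (contMDiffAt_extChartAt_symm' hy).mdifferentiableAt (by simp)

theorem mdifferentiableAt_extChartAt' {x₀ x : N} (hx : x ∈ (extChartAt (𝓡 n) x₀).source) :
    MDifferentiableAt (𝓡 n) 𝓘(ℝ, Model n) (extChartAt (𝓡 n) x₀) x :=
  (contMDiffAt_extChartAt' (n := ∞) (by rwa [extChartAt_source] at hx)).mdifferentiableAt (by simp)

theorem mfderiv_extChartAt_symm_comp {x₀ x : N} (hx : x ∈ (extChartAt (𝓡 n) x₀).source) :
    (mfderiv 𝓘(ℝ, Model n) (𝓡 n) (extChartAt (𝓡 n) x₀).symm (extChartAt (𝓡 n) x₀ x)).comp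
      (mfderiv (𝓡 n) 𝓘(ℝ, Model n) (extChartAt (𝓡 n) x₀) x) =
      ContinuousLinearMap.id ℝ (TangentSpace (𝓡 n) x) := by
  have := mfderivWithin_extChartAt_symm_comp_mfderiv_extChartAt' hx
  simpa [ModelWithCorners.range_eq_univ, mfderivWithin_univ] using this

theorem mfderiv_extChartAt_comp_symm {x₀ : N} {y : Model n}
    (hy : y ∈ (extChartAt (𝓡 n) x₀).target) :
    (mfderiv (𝓡 n) 𝓘(ℝ, Model n) (extChartAt (𝓡 n) x₀) ((extChartAt (𝓡 n) x₀).symm y)).comp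
      (mfderiv 𝓘(ℝ, Model n) (𝓡 n) (extChartAt (𝓡 n) x₀).symm y) =
      ContinuousLinearMap.id ℝ (TangentSpace 𝓘(ℝ, Model n) y) := by
  have := mfderiv_extChartAt_comp_mfderivWithin_extChartAt_symm hy
  simpa [ModelWithCorners.range_eq_univ, mfderivWithin_univ] using this

/-- The expression of a map in the charts around `x₀` and `m`. -/
noncomputable def coordMap (p : N → M) (x₀ : N) (m : M) : Model n → Model n :=
  extChartAt (𝓡 n) m ∘ p ∘ (extChartAt (𝓡 n) x₀).symm

/-- The domain of the expression of a map in the charts around `x₀` and `m`. -/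
def coordDom (p : N → M) (x₀ : N) (m : M) : Set (Model n) :=
  (extChartAt (𝓡 n) x₀).target ∩
    (extChartAt (𝓡 n) x₀).symm ⁻¹' (p ⁻¹' (extChartAt (𝓡 n) m).source)

omit [IsManifold (𝓡 n) ∞ M] [IsManifold (𝓡 n) ∞ N] in
theorem isOpen_coordDom {p : N → M} (hp : Continuous p) (x₀ : N) (m : M) :
    IsOpen (coordDom (n := n) p x₀ m) :=
  (continuousOn_extChartAt_symm x₀).isOpen_inter_preimage (isOpen_extChartAt_target x₀)
    ((isOpen_extChartAt_source m).preimage hp)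

variable {p : N → M}

theorem contDiffAt_coordMap (hp : ContMDiff (𝓡 n) (𝓡 n) ∞ p) {x₀ : N} {m : M} {y : Model n}
    (hy : y ∈ coordDom p x₀ m) : ContDiffAt ℝ ∞ (coordMap p x₀ m) y := by
  rw [← contMDiffAt_iff_contDiffAt]
  refine ContMDiffAt.comp y (I' := 𝓡 n) (contMDiffAt_extChartAt' (n := ∞) ?_)
    (ContMDiffAt.comp y (I' := 𝓡 n) (hp.contMDiffAt) (contMDiffAt_extChartAt_symm' hy.1))
  have := hy.2
  rwa [mem_preimage, mem_preimage, extChartAt_source] at this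

theorem contDiffOn_coordMap (hp : ContMDiff (𝓡 n) (𝓡 n) ∞ p) (x₀ : N) (m : M) :
    ContDiffOn ℝ ∞ (coordMap (n := n) p x₀ m) (coordDom p x₀ m) :=
  fun _ hy => (contDiffAt_coordMap hp hy).contDiffWithinAt

omit [IsManifold (𝓡 n) ∞ M] [IsManifold (𝓡 n) ∞ N] in
theorem coordMap_mem_target {x₀ : N} {m : M} {y : Model n} (hy : y ∈ coordDom p x₀ m) :
    coordMap p x₀ m y ∈ (extChartAt (𝓡 n) m).target :=
  (extChartAt (𝓡 n) m).map_source hy.2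

omit [IsManifold (𝓡 n) ∞ M] [IsManifold (𝓡 n) ∞ N] in
theorem symm_coordMap {x₀ : N} {m : M} {y : Model n} (hy : y ∈ coordDom p x₀ m) :
    (extChartAt (𝓡 n) m).symm (coordMap p x₀ m y) = p ((extChartAt (𝓡 n) x₀).symm y) :=
  (extChartAt (𝓡 n) m).left_inv hy.2

theorem mfderiv_symm_comp_fderiv_coordMap (hp : ContMDiff (𝓡 n) (𝓡 n) ∞ p) {x₀ : N} {m : M}
    {y : Model n} (hy : y ∈ coordDom p x₀ m) (v : Model n) :
    mfderiv 𝓘(ℝ, Model n) (𝓡 n) (extChartAt (𝓡 n) m).symm (coordMap p x₀ m y)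
      (fderiv ℝ (coordMap p x₀ m) y v) =
    mfderiv (𝓡 n) (𝓡 n) p ((extChartAt (𝓡 n) x₀).symm y)
      (mfderiv 𝓘(ℝ, Model n) (𝓡 n) (extChartAt (𝓡 n) x₀).symm y v) := by
  have h1 : mfderiv 𝓘(ℝ, Model n) (𝓡 n) ((extChartAt (𝓡 n) m).symm ∘ coordMap p x₀ m) y =
      (mfderiv 𝓘(ℝ, Model n) (𝓡 n) (extChartAt (𝓡 n) m).symm (coordMap p x₀ m y)).comp
        (mfderiv 𝓘(ℝ, Model n) 𝓘(ℝ, Model n) (coordMap p x₀ m) y) :=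
    mfderiv_comp y (mdifferentiableAt_extChartAt_symm' (coordMap_mem_target hy))
      (((contDiffAt_coordMap hp hy).differentiableAt (by simp)).mdifferentiableAt)
  have h2 : mfderiv 𝓘(ℝ, Model n) (𝓡 n) (p ∘ (extChartAt (𝓡 n) x₀).symm) y =
      (mfderiv (𝓡 n) (𝓡 n) p ((extChartAt (𝓡 n) x₀).symm y)).comp
        (mfderiv 𝓘(ℝ, Model n) (𝓡 n) (extChartAt (𝓡 n) x₀).symm y) :=
    mfderiv_comp y (hp.mdifferentiableAt (by simp)) (mdifferentiableAt_extChartAt_symm' hy.1)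
  have h3 : (extChartAt (𝓡 n) m).symm ∘ coordMap p x₀ m =ᶠ[𝓝 y] p ∘ (extChartAt (𝓡 n) x₀).symm := by
    filter_upwards [(isOpen_coordDom hp.continuous x₀ m).mem_nhds hy] with z hz
    exact symm_coordMap hz
  have h4 := h3.mfderiv_eq (I := 𝓘(ℝ, Model n)) (I' := 𝓡 n)
  rw [mfderiv_eq_fderiv] at h1
  have h5 := h1.symm.trans (h4.trans h2)
  exact congr_arg (fun A : Model n →L[ℝ] Model n => A v) h5

theorem inChart_pullback {F : Type*} [NormedAddCommGroup F] [NormedSpace ℝ F]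
    (hp : ContMDiff (𝓡 n) (𝓡 n) ∞ p) {k : ℕ} (w : Form n M F k) {x₀ : N} {m : M}
    {y : Model n} (hy : y ∈ coordDom p x₀ m) :
    (w.pullback p).inChart x₀ y = (w.inChart m (coordMap p x₀ m y)).compContinuousLinearMap
      (fderiv ℝ (coordMap p x₀ m) y) := by
  ext v
  have h : ∀ z, p ((extChartAt (𝓡 n) x₀).symm y) = z → ∀ u : Fin k → Model n,
      w (p ((extChartAt (𝓡 n) x₀).symm y)) u = w z u := by rintro z rfl u; rfl
  refine (h _ (symm_coordMap hy).symm _).trans ?_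
  change w _ _ = w _ _
  congr 1
  funext i
  exact (mfderiv_symm_comp_fderiv_coordMap hp hy (v i)).symm

omit [IsManifold (𝓡 n) ∞ M] in
theorem pullback_id {F : Type*} [NormedAddCommGroup F] [NormedSpace ℝ F] {k : ℕ}
    (w : Form n M F k) : w.pullback id = w := by
  funext x
  ext v
  change w x _ = w x v
  congr 1
  funext i
  change mfderiv (𝓡 n) (𝓡 n) id x (v i) = v i
  rw [mfderiv_id]; rfl

theorem contDiffOn_inChart_pullback {F : Type*} [NormedAddCommGroup F] [NormedSpace ℝ F]
    (hp : ContMDiff (𝓡 n) (𝓡 n) ∞ p) {k : ℕ} (w : Form n M F k) {x₀ : N} {m : M}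
    {V : Set (Model n)} (hw : ContDiffOn ℝ ∞ (w.inChart m) V) :
    ContDiffOn ℝ ∞ ((w.pullback p).inChart x₀) (coordDom p x₀ m ∩ coordMap p x₀ m ⁻¹' V) := by
  have h1 : ContDiffOn ℝ ∞ (fun y => (w.inChart m (coordMap p x₀ m y)).compContinuousLinearMap
      (fderiv ℝ (coordMap p x₀ m) y)) (coordDom p x₀ m ∩ coordMap p x₀ m ⁻¹' V) := by
    refine (contDiff_compContinuousLinearMap k).comp_contDiffOn (ContDiffOn.prodMk ?_ ?_)
    · exact hw.comp ((contDiffOn_coordMap hp x₀ m).mono inter_subset_left) fun y hy => hy.2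
    · exact (((contDiffOn_coordMap hp x₀ m).fderiv_of_isOpen (isOpen_coordDom hp.continuous x₀ m)
        (by simp)).mono inter_subset_left)
  exact h1.congr fun y hy => inChart_pullback hp w hy.1

theorem Form.Smooth.pullback {F : Type*} [NormedAddCommGroup F] [NormedSpace ℝ F]
    (hp : ContMDiff (𝓡 n) (𝓡 n) ∞ p) {k : ℕ} {w : Form n M F k} (hw : w.Smooth) :
    (w.pullback p).Smooth := by
  intro x₀ y hy
  let m := p ((extChartAt (𝓡 n) x₀).symm y)
  have hym : y ∈ coordDom p x₀ m := ⟨hy, mem_extChartAt_source m⟩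
  have := contDiffOn_inChart_pullback hp w (x₀ := x₀) (hw m)
  have h2 : coordDom p x₀ m ∩ coordMap p x₀ m ⁻¹' (extChartAt (𝓡 n) m).target =
      coordDom p x₀ m := inter_eq_left.2 fun z hz => coordMap_mem_target hz
  rw [h2] at this
  exact (this.contDiffAt ((isOpen_coordDom hp.continuous x₀ m).mem_nhds hym)).contDiffWithinAt

omit [IsManifold (𝓡 n) ∞ M] in
theorem Form.Smooth.differentiableAt_inChart {F : Type*} [NormedAddCommGroup F] [NormedSpace ℝ F]
    {k : ℕ} {w : Form n M F k} (hw : w.Smooth) {m : M} {y : Model n}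
    (hy : y ∈ (extChartAt (𝓡 n) m).target) : DifferentiableAt ℝ (w.inChart m) y :=
  ((hw m).contDiffAt ((isOpen_extChartAt_target m).mem_nhds hy)).differentiableAt (by simp)

theorem extDeriv_inChart_pullback {F : Type*} [NormedAddCommGroup F] [NormedSpace ℝ F]
    (hp : ContMDiff (𝓡 n) (𝓡 n) ∞ p) {k : ℕ} {w : Form n M F k} (hw : w.Smooth) {x₀ : N} {m : M}
    {y : Model n} (hy : y ∈ coordDom p x₀ m) :
    extDeriv ((w.pullback p).inChart x₀) y =
      (extDeriv (w.inChart m) (coordMap p x₀ m y)).compContinuousLinearMap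
        (fderiv ℝ (coordMap p x₀ m) y) := by
  rw [← extDeriv_pullback (r := ∞) (hw.differentiableAt_inChart (coordMap_mem_target hy))
    (contDiffAt_coordMap hp hy)
    (by rw [minSmoothness_of_isRCLikeNormedField]; exact ENat.LEInfty.out)]
  refine Filter.EventuallyEq.extDeriv_eq ?_
  filter_upwards [(isOpen_coordDom hp.continuous x₀ m).mem_nhds hy] with z hz
  exact inChart_pullback hp w hz

/-- The exterior derivative can be computed in any chart. -/
theorem inChart_d {F : Type*} [NormedAddCommGroup F] [NormedSpace ℝ F] {k : ℕ}
    {w : Form n M F k} (hw : w.Smooth) {x₀ : M} {y : Model n}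
    (hy : y ∈ (extChartAt (𝓡 n) x₀).target) : w.d.inChart x₀ y = extDeriv (w.inChart x₀) y := by
  let x := (extChartAt (𝓡 n) x₀).symm y
  have hyx : y ∈ coordDom (id : M → M) x₀ x := ⟨hy, mem_extChartAt_source x⟩
  have h1 := extDeriv_inChart_pullback contMDiff_id hw hyx
  rw [pullback_id] at h1
  rw [h1]
  ext v
  change extDeriv (w.inChart x) (extChartAt (𝓡 n) x x) _ = extDeriv (w.inChart x) _ _
  congr 1
  funext i
  have h2 := mfderiv_symm_comp_fderiv_coordMap (p := (id : M → M)) contMDiff_id hyx (v i)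
  rw [mfderiv_id] at h2
  have h3 := congr_arg (fun u => mfderiv (𝓡 n) 𝓘(ℝ, Model n) (extChartAt (𝓡 n) x)
    ((extChartAt (𝓡 n) x).symm (coordMap id x₀ x y)) u) h2
  have h4 := mfderiv_extChartAt_comp_symm (coordMap_mem_target hyx)
  have h5 := congr_arg (fun A : Model n →L[ℝ] Model n =>
    A (fderiv ℝ (coordMap (id : M → M) x₀ x) y (v i))) h4
  have h6 := h5.symm.trans h3
  have h7 : (extChartAt (𝓡 n) x).symm (coordMap id x₀ x y) = x := symm_coordMap hyx
  refine Eq.trans ?_ h6.symm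
  have : ∀ z, z = x → mfderiv (𝓡 n) 𝓘(ℝ, Model n) (extChartAt (𝓡 n) x) x
      ((mfderiv 𝓘(ℝ, Model n) (𝓡 n) (extChartAt (𝓡 n) x₀).symm y) (v i)) =
      (mfderiv (𝓡 n) 𝓘(ℝ, Model n) (extChartAt (𝓡 n) x) z : Model n →L[ℝ] Model n)
        ((mfderiv 𝓘(ℝ, Model n) (𝓡 n) (extChartAt (𝓡 n) x₀).symm y) (v i)) := by
    rintro z rfl; rfl
  exact this _ h7

/-- The pullback of a closed form is closed in every chart. -/
theorem extDeriv_inChart_pullback_eq_zero {F : Type*} [NormedAddCommGroup F] [NormedSpace ℝ F]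
    (hp : ContMDiff (𝓡 n) (𝓡 n) ∞ p) {k : ℕ} {w : Form n M F k} (hw : w.IsClosedForm) {x₀ : N}
    {y : Model n} (hy : y ∈ (extChartAt (𝓡 n) x₀).target) :
    extDeriv ((w.pullback p).inChart x₀) y = 0 := by
  have hym : y ∈ coordDom p x₀ (p ((extChartAt (𝓡 n) x₀).symm y)) :=
    ⟨hy, mem_extChartAt_source _⟩
  rw [extDeriv_inChart_pullback hp hw.1 hym, ← inChart_d hw.1 (coordMap_mem_target hym), hw.2]
  rfl

omit [IsManifold (𝓡 n) ∞ M] in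
theorem inChart_e {F : Type*} [NormedAddCommGroup F] [NormedSpace ℝ F] {k : ℕ}
    (θ : Form n M ℝ 1) (w : Form n M F k) (x₀ : M) (y : Model n) :
    (Form.e θ w).inChart x₀ y = extMul (θ.inChart x₀ y) (w.inChart x₀ y) :=
  extMul_compContinuousLinearMap (E := Model n) (E' := Model n) _ _ _

theorem inChart_twistedD {F : Type*} [NormedAddCommGroup F] [NormedSpace ℝ F] {k : ℕ}
    (θ : Form n M ℝ 1) {w : Form n M F k} (hw : w.Smooth) {x₀ : M} {y : Model n}
    (hy : y ∈ (extChartAt (𝓡 n) x₀).target) :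
    (Form.twistedD θ w).inChart x₀ y =
      extDeriv (w.inChart x₀) y + extMul (θ.inChart x₀ y) (w.inChart x₀ y) := by
  rw [← inChart_d hw hy, ← inChart_e]
  rfl

theorem continuousOn_inChart_twistedD {F : Type*} [NormedAddCommGroup F] [NormedSpace ℝ F] {k : ℕ}
    {θ : Form n M ℝ 1} (hθ : θ.Smooth) {w : Form n M F k} (hw : w.Smooth) (x₀ : M) :
    ContinuousOn ((Form.twistedD θ w).inChart x₀) (extChartAt (𝓡 n) x₀).target := by
  have h : ContinuousOn (fun y => extDeriv (w.inChart x₀) y +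
      extMul (θ.inChart x₀ y) (w.inChart x₀ y)) (extChartAt (𝓡 n) x₀).target := by
    refine ContinuousOn.add ?_ ?_
    · have h1 : Continuous (ContinuousAlternatingMap.alternatizeUncurryFinCLM ℝ (Model n) F (n := k)) :=
        ContinuousLinearMap.continuous _
      have h2 : ContinuousOn (fderiv ℝ (w.inChart x₀)) (extChartAt (𝓡 n) x₀).target :=
        (hw x₀).continuousOn_fderiv_of_isOpen (isOpen_extChartAt_target x₀) (by simp)
      exact h1.comp_continuousOn h2
    · exact continuousOn_extMul (E := Model n) (hθ x₀).continuousOn (hw x₀).continuousOn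
  exact h.congr fun y hy => inChart_twistedD θ hw hy

end Charts

/-! ### Norms of alternating forms with respect to a scalar product -/

section ScalarProduct

variable {n : ℕ}

/-- Scalar products on `ℝⁿ`. -/
structure IsScalarProduct (B : Model n → Model n → ℝ) : Prop where
  bilin : ∃ L : LinearMap.BilinForm ℝ (Model n), ∀ v w, B v w = L v w
  symm : ∀ v w, B v w = B w v
  pos : ∀ v, v ≠ 0 → 0 < B v v

/-- Orthonormal frames of a scalar product. -/
def IsOrthoFrame (B : Model n → Model n → ℝ) (e : Fin n → Model n) : Prop :=
  ∀ i j, B (e i) (e j) = if i = j then 1 else 0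

/-- The square norm of an alternating form with respect to a scalar product. -/
noncomputable def altNormSq (B : Model n → Model n → ℝ) {k : ℕ} (α : Model n [⋀^Fin k]→L[ℝ] ℂ) : ℝ≥0∞ :=
  ⨆ (e : Fin n → Model n) (_ : IsOrthoFrame B e), ∑ I : Fin k ↪o Fin n, ‖α (fun a => e (I a))‖ₑ ^ 2

variable {B : Model n → Model n → ℝ}

theorem IsScalarProduct.exists_frame (hB : IsScalarProduct B) : ∃ e, IsOrthoFrame B e := by
  obtain ⟨L, hL⟩ := hB.bilin
  have : Invertible (2 : ℝ) := invertibleOfNonzero (by norm_num)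
  obtain ⟨v, hv⟩ := LinearMap.BilinForm.exists_orthogonal_basis (B := L)
    ⟨fun x y => by simp only [RingHom.id_apply, ← hL]; exact hB.symm x y⟩
  have hfin : Module.finrank ℝ (Model n) = n := by simp
  let u : Fin n → Model n := fun i => v (Fin.cast hfin.symm i)
  have hu : ∀ i, 0 < B (u i) (u i) := fun i => hB.pos _ (v.ne_zero _)
  refine ⟨fun i => (Real.sqrt (B (u i) (u i)))⁻¹ • u i, fun i j => ?_⟩
  rw [hL]
  simp only [map_smul, LinearMap.smul_apply, smul_eq_mul, ← hL]
  split_ifs with hij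
  · subst hij
    have h1 := Real.sqrt_pos.2 (hu i)
    have h2 := Real.mul_self_sqrt (hu i).le
    field_simp
    nlinarith
  · have h0 : B (u i) (u j) = 0 := by
      rw [hL]
      exact hv (fun h => hij (by simpa using h))
    rw [h0]; simp

theorem IsOrthoFrame.linearIndependent (hB : IsScalarProduct B) {e : Fin n → Model n}
    (he : IsOrthoFrame B e) : LinearIndependent ℝ e := by
  obtain ⟨L, hL⟩ := hB.bilin
  rw [Fintype.linearIndependent_iff]
  intro g hg j
  have h := congr_arg (fun v => L v (e j)) hg
  simp only [map_sum, map_smul, LinearMap.sum_apply, LinearMap.smul_apply, ← hL, he _ j,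
    smul_eq_mul, mul_ite, mul_one, mul_zero, Finset.sum_ite_eq', Finset.mem_univ, if_true,
    map_zero, LinearMap.zero_apply] at h
  exact h

theorem IsOrthoFrame.eq_sum (hB : IsScalarProduct B) {e : Fin n → Model n}
    (he : IsOrthoFrame B e) (v : Model n) : v = ∑ i, B v (e i) • e i := by
  obtain ⟨L, hL⟩ := hB.bilin
  let b := basisOfLinearIndependentOfCardEqFinrank' e (he.linearIndependent hB) (by simp)
  have hb : ∀ i, b i = e i := fun i => by simp [b]
  have hs := b.sum_repr v
  simp only [hb] at hs
  have hc : ∀ j, B v (e j) = b.repr v j := by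
    intro j
    conv_lhs => rw [hL, ← hs]
    simp only [map_sum, map_smul, LinearMap.sum_apply, LinearMap.smul_apply, ← hL, he _ j,
      smul_eq_mul, mul_ite, mul_one, mul_zero, Finset.sum_ite_eq', Finset.mem_univ, if_true]
  simp only [hc]
  exact hs.symm

theorem IsOrthoFrame.apply_eq_sum (hB : IsScalarProduct B) {e : Fin n → Model n}
    (he : IsOrthoFrame B e) (v w : Model n) : B v w = ∑ i, B v (e i) * B w (e i) := by
  obtain ⟨L, hL⟩ := hB.bilin
  have h : B v w = L v (∑ i, B w (e i) • e i) := by rw [← he.eq_sum hB w, hL]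
  rw [h, map_sum]
  refine Finset.sum_congr rfl fun i _ => ?_
  rw [map_smul, ← hL, smul_eq_mul, mul_comm]

/-- The Gram matrix of the standard basis. -/
noncomputable def stdGram (B : Model n → Model n → ℝ) : Matrix (Fin n) (Fin n) ℝ :=
  Matrix.of fun i j => B (stdVec i) (stdVec j)

theorem IsOrthoFrame.stdGram_eq (hB : IsScalarProduct B) {e : Fin n → Model n}
    (he : IsOrthoFrame B e) : stdGram B =
      Matrix.of (fun i j => B (stdVec i) (e j)) * (Matrix.of fun i j => B (stdVec i) (e j)).transpose := by
  ext i j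
  rw [Matrix.mul_apply]
  exact he.apply_eq_sum hB _ _

theorem IsOrthoFrame.apply_stdVec (hB : IsScalarProduct B) {e : Fin n → Model n}
    (he : IsOrthoFrame B e) (α : Model n [⋀^Fin n]→L[ℝ] ℂ) :
    α stdVec = (Matrix.of fun i j => B (stdVec i) (e j)).det • α e := by
  let b := basisOfLinearIndependentOfCardEqFinrank' e (he.linearIndependent hB) (by simp)
  have hb : ∀ i, b i = e i := fun i => by simp [b]
  have hbe : (b : Fin n → Model n) = e := funext hb
  have hm : b.toMatrix stdVec = (Matrix.of fun i j => B (stdVec i) (e j)).transpose := by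
    ext i j
    rw [Module.Basis.toMatrix_apply, Matrix.transpose_apply, Matrix.of_apply]
    have := he.eq_sum hB (stdVec j)
    simp only [← hb] at this
    conv_lhs => rw [this]
    rw [map_sum]
    simp only [map_smul, Module.Basis.repr_self, Finsupp.smul_single, smul_eq_mul, mul_one,
      Finsupp.finsetSum_apply, Finsupp.single_apply]
    simp [hb]
  -- both sides are alternating in the frame
  have key : ∀ v : Fin n → Model n, α v = (b.det v) • α e := by
    intro v
    have : α.toAlternatingMap = (LinearMap.toSpanSingleton ℝ ℂ (α e)).compAlternatingMap b.det := by
      refine b.ext_alternating fun s hs => ?_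
      let σ : Equiv.Perm (Fin n) := Equiv.ofBijective s (Finite.injective_iff_bijective.1 hs)
      have h2 := α.toAlternatingMap.map_perm e σ
      have h3 := b.det.map_perm b σ
      have h4 : (fun i => b (s i)) = e ∘ σ := by funext i; exact hb _
      have h5 : (fun i => b (s i)) = b ∘ σ := rfl
      rw [LinearMap.compAlternatingMap_apply, h5, h3, b.det_self, ← h5, h4]
      change α (e ∘ σ) = _
      change α (e ∘ σ) = _ • α e at h2
      rw [h2]
      rcases Int.units_eq_one_or (Equiv.Perm.sign σ) with h | h <;> simp [h]
    exact congr_arg (fun T : Model n [⋀^Fin n]→ₗ[ℝ] ℂ => T v) this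
  rw [key, Module.Basis.det_apply, hm, Matrix.det_transpose]

theorem IsScalarProduct.det_pos (hB : IsScalarProduct B) : 0 < (stdGram B).det := by
  obtain ⟨e, he⟩ := hB.exists_frame
  rw [he.stdGram_eq hB, Matrix.det_mul, Matrix.det_transpose]
  refine mul_self_pos.2 fun h0 => ?_
  have := he.apply_stdVec hB (detForm n)
  rw [h0, zero_smul, detForm_std] at this
  exact one_ne_zero this

theorem orderEmbedding_self_eq (I : Fin n ↪o Fin n) (a : Fin n) : I a = a := by
  have : I = (OrderIso.refl (Fin n)).toOrderEmbedding := by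
    have h : Function.Surjective I := Finite.surjective_of_injective I.injective
    have : RelIso.ofSurjective I h = OrderIso.refl (Fin n) := Subsingleton.elim _ _
    ext a
    exact congr_arg (fun f : Fin n ≃o Fin n => (f a).val) this
  rw [this]; rfl

theorem sum_orderEmbedding_self {f : (Fin n → Fin n) → ℝ≥0∞} :
    ∑ I : Fin n ↪o Fin n, f (fun a => I a) = f id := by
  have : ∀ I : Fin n ↪o Fin n, f (fun a => I a) = f id := fun I =>
    congr_arg f (funext (orderEmbedding_self_eq I))
  simp only [this]
  have hu : Fintype.card (Fin n ↪o Fin n) = 1 := by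
    rw [Fintype.card_eq_one_iff]
    exact ⟨(OrderIso.refl (Fin n)).toOrderEmbedding, fun I => by
      ext a; rw [orderEmbedding_self_eq]; rfl⟩
  simp [Finset.card_univ, hu]

/-- The norm of a form of top degree. -/
theorem IsScalarProduct.altNormSq_top (hB : IsScalarProduct B) (α : Model n [⋀^Fin n]→L[ℝ] ℂ) :
    ‖α stdVec‖ₑ ^ 2 = ENNReal.ofReal (stdGram B).det * altNormSq B α := by
  have h : ∀ e, IsOrthoFrame B e → ENNReal.ofReal (stdGram B).det *
      (∑ I : Fin n ↪o Fin n, ‖α (fun a => e (I a))‖ₑ ^ 2) = ‖α stdVec‖ₑ ^ 2 := by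
    intro e he
    rw [sum_orderEmbedding_self (f := fun s => ‖α (fun a => e (s a))‖ₑ ^ 2),
      he.apply_stdVec hB, he.stdGram_eq hB, Matrix.det_mul, Matrix.det_transpose, enorm_smul,
      mul_pow, ← pow_two, Real.enorm_eq_ofReal_abs, ← ENNReal.ofReal_pow (abs_nonneg _), sq_abs]
    rfl
  obtain ⟨e₀, he₀⟩ := hB.exists_frame
  refine le_antisymm ?_ ?_
  · rw [← h e₀ he₀]
    gcongr
    exact le_iSup₂_of_le (f := fun (e : Fin n → Model n) (_ : IsOrthoFrame B e) =>
      ∑ I : Fin n ↪o Fin n, ‖α (fun a => e (I a))‖ₑ ^ 2) e₀ he₀ le_rfl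
  · rw [altNormSq, ENNReal.mul_iSup]
    refine iSup_le fun e => ?_
    rw [ENNReal.mul_iSup]
    exact iSup_le fun he => (h e he).le

/-- The norm of a form of degree zero. -/
theorem IsScalarProduct.altNormSq_zero (hB : IsScalarProduct B) (α : Model n [⋀^Fin 0]→L[ℝ] ℂ) :
    altNormSq B α = ‖α ![]‖ₑ ^ 2 := by
  have hu : Fintype.card (Fin 0 ↪o Fin n) = 1 := by
    rw [Fintype.card_eq_one_iff]
    exact ⟨RelEmbedding.ofIsEmpty _ _, fun I => by ext a; exact a.elim0⟩
  have h : ∀ e : Fin n → Model n,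
      (∑ I : Fin 0 ↪o Fin n, ‖α (fun a => e (I a))‖ₑ ^ 2) = ‖α ![]‖ₑ ^ 2 := by
    intro e
    have : ∀ I : Fin 0 ↪o Fin n, ‖α (fun a => e (I a))‖ₑ ^ 2 = ‖α ![]‖ₑ ^ 2 := fun I => by
      congr 3
      exact Subsingleton.elim _ _
    simp only [this]
    simp [Finset.card_univ, hu]
  obtain ⟨e₀, he₀⟩ := hB.exists_frame
  simp only [altNormSq, h]
  exact le_antisymm (iSup₂_le fun _ _ => le_rfl)
    (le_iSup₂_of_le (f := fun (e : Fin n → Model n) (_ : IsOrthoFrame B e) => ‖α ![]‖ₑ ^ 2)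
      e₀ he₀ le_rfl)

/-- The Cauchy-Schwarz inequality for a form of degree one. -/
theorem IsScalarProduct.enorm_apply_sq_le (hB : IsScalarProduct B) (α : Model n [⋀^Fin 1]→L[ℝ] ℂ)
    (v : Model n) : ‖α (fun _ => v)‖ₑ ^ 2 ≤ ENNReal.ofReal (B v v) * altNormSq B α := by
  obtain ⟨e, he⟩ := hB.exists_frame
  have h1 : ENNReal.ofReal (∑ i, ‖α (fun _ => e i)‖ ^ 2) ≤ altNormSq B α := by
    refine le_trans ?_ (le_iSup₂_of_le (f := fun (e : Fin n → Model n) (_ : IsOrthoFrame B e) =>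
      ∑ I : Fin 1 ↪o Fin n, ‖α (fun a => e (I a))‖ₑ ^ 2) e he le_rfl)
    rw [ENNReal.ofReal_sum_of_nonneg fun _ _ => by positivity]
    let ι : Fin n → (Fin 1 ↪o Fin n) := fun i =>
      OrderEmbedding.ofStrictMono (fun _ => i) (fun a b h => by
        exact absurd h (by simp [Subsingleton.elim a b]))
    have hι : Function.Injective ι := fun i j hij => congr_arg (fun f => f 0) hij
    have : ∑ i, ENNReal.ofReal (‖α (fun _ => e i)‖ ^ 2) =
        ∑ I ∈ Finset.univ.map ⟨ι, hι⟩, ‖α (fun a => e (I a))‖ₑ ^ 2 := by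
      rw [Finset.sum_map]
      refine Finset.sum_congr rfl fun i _ => ?_
      rw [ENNReal.ofReal_pow (norm_nonneg _), ofReal_norm]
      rfl
    rw [this]
    exact Finset.sum_le_univ_sum_of_nonneg fun _ => by positivity
  refine le_trans ?_ (mul_le_mul_right h1 _)
  have hv : α (fun _ => v) = ∑ i, B v (e i) • α (fun _ => e i) := by
    let l : Model n →ₗ[ℝ] ℂ := ((ContinuousAlternatingMap.ofSubsingleton ℝ (Model n) ℂ (0 : Fin 1)).symm α)
    have : ∀ u, α (fun _ => u) = l u := fun u => rfl
    simp only [this]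
    conv_lhs => rw [he.eq_sum hB v]
    rw [map_sum]
    simp only [map_smul]
  have h2 : ‖α (fun _ => v)‖ ^ 2 ≤ B v v * ∑ i, ‖α (fun _ => e i)‖ ^ 2 := by
    have h3 : ‖α (fun _ => v)‖ ≤ ∑ i, |B v (e i)| * ‖α (fun _ => e i)‖ := by
      rw [hv]
      refine (norm_sum_le _ _).trans_eq (Finset.sum_congr rfl fun i _ => ?_)
      rw [norm_smul, Real.norm_eq_abs]
    refine (pow_le_pow_left₀ (norm_nonneg _) h3 2).trans ?_
    refine (Finset.sum_mul_sq_le_sq_mul_sq _ _ _).trans_eq ?_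
    congr 1
    rw [he.apply_eq_sum hB v v]
    exact Finset.sum_congr rfl fun i _ => by rw [sq_abs, pow_two]
  rw [← ofReal_norm, ← ENNReal.ofReal_pow (norm_nonneg _), ← ENNReal.ofReal_mul]
  · exact ENNReal.ofReal_le_ofReal h2
  · by_cases h0 : v = 0
    · obtain ⟨L, hL⟩ := hB.bilin
      rw [h0, hL]; simp
    · exact (hB.pos v h0).le

theorem altNormSq_le {C : ℝ} (hB : ∀ v, B v v = 1 → ‖v‖ ≤ C) {k : ℕ}
    (α : Model n [⋀^Fin k]→L[ℝ] ℂ) :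
    altNormSq B α ≤ Fintype.card (Fin k ↪o Fin n) * ENNReal.ofReal (‖α‖ * C ^ k) ^ 2 := by
  refine iSup₂_le fun e he => ?_
  rw [← nsmul_eq_mul]
  refine Finset.sum_le_card_nsmul _ _ _ fun I _ => ?_
  gcongr
  rw [← ofReal_norm]
  refine ENNReal.ofReal_le_ofReal ((α.le_opNorm _).trans ?_)
  gcongr
  refine (Finset.prod_le_prod (fun _ _ => norm_nonneg _) fun i _ => hB _ ?_).trans_eq (by simp)
  simpa using he (I i) (I i)

theorem altNormSq_comp {k : ℕ} (α : Model n [⋀^Fin k]→L[ℝ] ℂ) (A A' : Model n →L[ℝ] Model n)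
    (h1 : ∀ v, A (A' v) = v) :
    altNormSq (fun v w => B (A v) (A w)) (α.compContinuousLinearMap A) = altNormSq B α := by
  refine le_antisymm (iSup₂_le fun e he => ?_) (iSup₂_le fun e he => ?_)
  · exact le_iSup₂_of_le (f := fun (e : Fin n → Model n) (_ : IsOrthoFrame B e) =>
      ∑ I : Fin k ↪o Fin n, ‖α (fun a => e (I a))‖ₑ ^ 2) (fun i => A (e i)) he le_rfl
  · refine le_iSup₂_of_le (f := fun (e : Fin n → Model n)
      (_ : IsOrthoFrame (fun v w => B (A v) (A w)) e) =>
      ∑ I : Fin k ↪o Fin n, ‖(α.compContinuousLinearMap A) (fun a => e (I a))‖ₑ ^ 2)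
      (fun i => A' (e i)) (fun i j => ?_) ?_
    · simp only [h1]; exact he i j
    · refine le_of_eq (Finset.sum_congr rfl fun I _ => ?_)
      rw [ContinuousAlternatingMap.compContinuousLinearMap_apply]
      congr 3
      funext a
      exact (h1 _).symm

theorem IsScalarProduct.comp (hB : IsScalarProduct B) (A : Model n →L[ℝ] Model n)
    (hA : Function.Injective A) : IsScalarProduct fun v w => B (A v) (A w) := by
  obtain ⟨L, hL⟩ := hB.bilin
  refine ⟨⟨L.comp A.toLinearMap A.toLinearMap, fun v w => hL _ _⟩, fun v w => hB.symm _ _,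
    fun v hv => hB.pos _ fun h => hv (hA (by rw [h, map_zero]))⟩

theorem IsScalarProduct.det_stdGram_comp (hB : IsScalarProduct B) (A : Model n →L[ℝ] Model n) :
    (stdGram fun v w => B (A v) (A w)).det = A.det ^ 2 * (stdGram B).det := by
  obtain ⟨L, hL⟩ := hB.bilin
  let b := (EuclideanSpace.basisFun (Fin n) ℝ).toBasis
  have h1 : stdGram B = LinearMap.BilinForm.toMatrix b L := by
    ext i j
    simp [stdGram, b, hL]
  have h2 : (stdGram fun v w => B (A v) (A w)) =
      LinearMap.BilinForm.toMatrix b (L.comp A.toLinearMap A.toLinearMap) := by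
    ext i j
    simp [stdGram, b, hL]
  rw [h1, h2, LinearMap.BilinForm.toMatrix_comp b b, Matrix.det_mul, Matrix.det_mul,
    Matrix.det_transpose, LinearMap.det_toMatrix]
  change A.det * _ * A.det = _
  ring

end ScalarProduct

/-! ### Riemannian metric tensors in charts -/

section Riemannian

variable {n : ℕ} {N : Type*} [TopologicalSpace N] [ChartedSpace (Model n) N]

/-- Continuous fields of scalar products. -/
structure MetricTensor.IsRiemannian (h : MetricTensor n N) : Prop where
  isScalarProduct : ∀ x, IsScalarProduct (n := n) (h x)
  continuousOn_gram : ∀ x₀, ContinuousOn (gram h x₀) (extChartAt (𝓡 n) x₀).target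

/-- The coordinate expression of a metric tensor. -/
noncomputable def chartMetric (h : MetricTensor n N) (x₀ : N) (y : Model n) (v w : Model n) : ℝ :=
  h ((extChartAt (𝓡 n) x₀).symm y)
    (mfderiv 𝓘(ℝ, Model n) (𝓡 n) (extChartAt (𝓡 n) x₀).symm y v)
    (mfderiv 𝓘(ℝ, Model n) (𝓡 n) (extChartAt (𝓡 n) x₀).symm y w)

theorem stdGram_chartMetric (h : MetricTensor n N) (x₀ : N) (y : Model n) :
    stdGram (chartMetric h x₀ y) = gram h x₀ y := rfl

theorem normSq_eq_altNormSq (h : MetricTensor n N) {k : ℕ} (w : Form n N ℂ k) (x : N) :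
    w.normSq h x = altNormSq (n := n) (h x) (w x) := rfl

section

variable [IsManifold (𝓡 n) ∞ N]

theorem normSq_symm (h : MetricTensor n N) {k : ℕ} (w : Form n N ℂ k) {x₀ : N} {y : Model n}
    (hy : y ∈ (extChartAt (𝓡 n) x₀).target) :
    w.normSq h ((extChartAt (𝓡 n) x₀).symm y) =
      altNormSq (chartMetric h x₀ y) (w.inChart x₀ y) := by
  rw [normSq_eq_altNormSq]
  refine (altNormSq_comp (n := n) _
    (mfderiv 𝓘(ℝ, Model n) (𝓡 n) (extChartAt (𝓡 n) x₀).symm y)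
    (mfderiv (𝓡 n) 𝓘(ℝ, Model n) (extChartAt (𝓡 n) x₀) ((extChartAt (𝓡 n) x₀).symm y))
    fun v => ?_).symm
  have h1 := mfderiv_extChartAt_symm_comp ((extChartAt (𝓡 n) x₀).map_target hy)
  have h2 := congr_arg (fun A : Model n →L[ℝ] Model n => A v) h1
  have h3 : extChartAt (𝓡 n) x₀ ((extChartAt (𝓡 n) x₀).symm y) = y :=
    (extChartAt (𝓡 n) x₀).right_inv hy
  have h4 : ∀ z, z = y → ∀ u : Model n,
      (mfderiv 𝓘(ℝ, Model n) (𝓡 n) (extChartAt (𝓡 n) x₀).symm z : Model n →L[ℝ] Model n) u =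
      (mfderiv 𝓘(ℝ, Model n) (𝓡 n) (extChartAt (𝓡 n) x₀).symm y : Model n →L[ℝ] Model n) u := by
    rintro z rfl u; rfl
  exact (h4 _ h3 _).symm.trans h2

theorem mfderiv_extChartAt_symm_injective {x₀ : N} {y : Model n}
    (hy : y ∈ (extChartAt (𝓡 n) x₀).target) : Function.Injective
      (mfderiv 𝓘(ℝ, Model n) (𝓡 n) (extChartAt (𝓡 n) x₀).symm y : Model n →L[ℝ] Model n) := by
  intro u v huv
  have h := mfderiv_extChartAt_comp_symm hy
  have hu := congr_arg (fun A : Model n →L[ℝ] Model n => A u) h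
  have hv := congr_arg (fun A : Model n →L[ℝ] Model n => A v) h
  refine hu.symm.trans (Eq.trans ?_ hv)
  exact congr_arg (mfderiv (𝓡 n) 𝓘(ℝ, Model n) (extChartAt (𝓡 n) x₀)
    ((extChartAt (𝓡 n) x₀).symm y) : Model n →L[ℝ] Model n) huv

theorem MetricTensor.IsRiemannian.chartMetric {h : MetricTensor n N} (hh : h.IsRiemannian)
    {x₀ : N} {y : Model n} (hy : y ∈ (extChartAt (𝓡 n) x₀).target) :
    IsScalarProduct (TwistedL2.chartMetric h x₀ y) :=
  (hh.isScalarProduct _).comp _ (mfderiv_extChartAt_symm_injective hy)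

theorem chartMetric_eq_sum {h : MetricTensor n N} (hh : h.IsRiemannian)
    {x₀ : N} {y : Model n} (hy : y ∈ (extChartAt (𝓡 n) x₀).target) (v w : Model n) :
    chartMetric h x₀ y v w = ∑ i, ∑ j, v i * w j * gram h x₀ y i j := by
  obtain ⟨L, hL⟩ := (hh.chartMetric hy).bilin
  have hs : ∀ u : Model n, u = ∑ i, u i • stdVec i := fun u => by
    have := (EuclideanSpace.basisFun (Fin n) ℝ).sum_repr u
    simpa using this.symm
  have h1 : chartMetric h x₀ y v w = L (∑ i, v i • stdVec i) (∑ i, w i • stdVec i) := by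
    rw [← hs, ← hs, hL]
  rw [h1]
  simp only [map_sum, map_smul, LinearMap.sum_apply, LinearMap.smul_apply, smul_eq_mul,
    Finset.mul_sum]
  rw [Finset.sum_comm]
  refine Finset.sum_congr rfl fun i _ => Finset.sum_congr rfl fun j _ => ?_
  rw [← hL, ← stdGram_chartMetric, stdGram, Matrix.of_apply]
  ring

theorem MetricTensor.IsRiemannian.continuousOn_chartMetric {h : MetricTensor n N}
    (hh : h.IsRiemannian) (x₀ : N) :
    ContinuousOn (fun q : Model n × Model n => TwistedL2.chartMetric h x₀ q.1 q.2 q.2)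
      ((extChartAt (𝓡 n) x₀).target ×ˢ univ) := by
  have h1 : ∀ i j, ContinuousOn (fun y => gram h x₀ y i j) (extChartAt (𝓡 n) x₀).target :=
    fun i j => ((continuous_apply_apply i j).comp_continuousOn (hh.continuousOn_gram x₀))
  have h2 : ContinuousOn (fun q : Model n × Model n =>
      ∑ i, ∑ j, q.2 i * q.2 j * gram h x₀ q.1 i j) ((extChartAt (𝓡 n) x₀).target ×ˢ univ) := by
    refine continuousOn_finsetSum _ fun i _ => continuousOn_finsetSum _ fun j _ => ?_
    refine ContinuousOn.mul (Continuous.continuousOn (by fun_prop)) ?_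
    exact (h1 i j).comp continuousOn_fst fun q hq => hq.1
  exact h2.congr fun q hq => chartMetric_eq_sum hh hq.1 _ _

theorem MetricTensor.IsRiemannian.exists_bound {h : MetricTensor n N} (hh : h.IsRiemannian)
    {x₀ : N} {K : Set (Model n)} (hK : IsCompact K) (hKt : K ⊆ (extChartAt (𝓡 n) x₀).target) :
    ∃ C : ℝ, ∀ y ∈ K, ∀ v, TwistedL2.chartMetric h x₀ y v v = 1 → ‖v‖ ≤ C := by
  have hcomp : IsCompact (K ×ˢ Metric.sphere (0 : Model n) 1) := hK.prod (isCompact_sphere _ _)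
  rcases (K ×ˢ Metric.sphere (0 : Model n) 1).eq_empty_or_nonempty with he | hne
  · refine ⟨0, fun y hy v hv => ?_⟩
    by_contra! hv0
    have : (y, ‖v‖⁻¹ • v) ∈ K ×ˢ Metric.sphere (0 : Model n) 1 := ⟨hy, by
      rw [mem_sphere_zero_iff_norm, norm_smul, norm_inv, norm_norm, inv_mul_cancel₀ hv0.ne']⟩
    rw [he] at this; exact this
  obtain ⟨⟨y₀, v₀⟩, hmem, hmin⟩ := hcomp.exists_isMinOn hne
    ((hh.continuousOn_chartMetric x₀).mono (prod_mono hKt (subset_univ _)))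
  set m := TwistedL2.chartMetric h x₀ y₀ v₀ v₀ with hm
  have hm0 : 0 < m := (hh.chartMetric (hKt hmem.1)).pos v₀ (by
    rintro rfl
    have := hmem.2
    simp at this)
  refine ⟨Real.sqrt m⁻¹, fun y hy v hv => ?_⟩
  have hv0 : v ≠ 0 := by
    rintro rfl
    obtain ⟨L, hL⟩ := (hh.chartMetric (hKt hy)).bilin
    rw [hL] at hv; simp at hv
  have hvn : 0 < ‖v‖ := norm_pos_iff.2 hv0
  have h1 : m ≤ TwistedL2.chartMetric h x₀ y (‖v‖⁻¹ • v) (‖v‖⁻¹ • v) :=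
    hmin (show (y, ‖v‖⁻¹ • v) ∈ K ×ˢ Metric.sphere (0 : Model n) 1 from ⟨hy, by
      rw [mem_sphere_zero_iff_norm, norm_smul, norm_inv, norm_norm, inv_mul_cancel₀ hvn.ne']⟩)
  obtain ⟨L, hL⟩ := (hh.chartMetric (hKt hy)).bilin
  rw [hL] at h1 hv
  simp only [map_smul, LinearMap.smul_apply, smul_eq_mul, hv, mul_one] at h1
  refine Real.le_sqrt_of_sq_le ?_
  rw [← inv_inv (‖v‖ ^ 2)]
  refine inv_anti₀ hm0 (h1.trans_eq ?_)
  rw [← mul_inv, pow_two]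

end

variable {M : Type*} [TopologicalSpace M] [ChartedSpace (Model n) M]
  [IsManifold (𝓡 n) ∞ M] [IsManifold (𝓡 n) ∞ N]

theorem contMDiffOn_mfderiv_apply {f : Model n → M} {U : Set (Model n)} (hU : IsOpen U)
    (hf : ContMDiffOn 𝓘(ℝ, Model n) (𝓡 n) ∞ f U) (v : Model n) :
    ContinuousOn (fun y => (⟨f y, mfderiv 𝓘(ℝ, Model n) (𝓡 n) f y v⟩ : TangentBundle (𝓡 n) M)) U := by
  have h1 := hf.continuousOn_tangentMapWithin (by simp) hU.uniqueMDiffOn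
  have h2 : Continuous (fun y : Model n => (⟨y, v⟩ : TangentBundle 𝓘(ℝ, Model n) (Model n))) :=
    ((tangentBundleModelSpaceHomeomorph 𝓘(ℝ, Model n)).symm.continuous).comp
      (continuous_id.prodMk continuous_const)
  have h3 := h1.comp h2.continuousOn (s := U) fun y hy => hy
  refine h3.congr fun y hy => ?_
  simp only [Function.comp, tangentMapWithin]
  rw [mfderivWithin_of_isOpen hU hy]

theorem isRiemannian_pullbackMetric {p : N → M} (hp : IsLocalDiffeomorph (𝓡 n) (𝓡 n) ∞ p)
    (g : RiemannianMetricOn n M) : (pullbackMetric p g).IsRiemannian where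
  isScalarProduct x := by
    refine IsScalarProduct.comp (B := fun v w => g.inner (p x) v w) ⟨?_, ?_, ?_⟩
      (mfderiv (𝓡 n) (𝓡 n) p x) ((hp.mfderivToContinuousLinearEquiv (by simp) x).injective)
    · exact ⟨LinearMap.mk₂ ℝ (fun v w : Model n => g.inner (p x) v w) (fun a b c => by
        exact congr_arg (fun T : Model n →L[ℝ] ℝ => T c) ((g.inner (p x)).map_add a b))
        (fun r a b => by
          exact congr_arg (fun T : Model n →L[ℝ] ℝ => T b) ((g.inner (p x)).map_smul r a))
        (fun a b c => (g.inner (p x) a).map_add b c)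
        (fun r a b => (g.inner (p x) a).map_smul r b), fun v w => rfl⟩
    · exact fun v w => g.symm (p x) v w
    · exact fun v hv => g.pos (p x) v hv
  continuousOn_gram x₀ := by
    have hU := isOpen_extChartAt_target (I := 𝓡 n) x₀
    have hf : ContMDiffOn 𝓘(ℝ, Model n) (𝓡 n) ∞ (p ∘ (extChartAt (𝓡 n) x₀).symm)
        (extChartAt (𝓡 n) x₀).target :=
      hp.contMDiff.comp_contMDiffOn (contMDiffOn_extChartAt_symm x₀)
    refine continuousOn_pi.2 fun i => continuousOn_pi.2 fun j => ?_
    have h1 : ContinuousOn (fun y => g.inner ((p ∘ (extChartAt (𝓡 n) x₀).symm) y)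
        (mfderiv 𝓘(ℝ, Model n) (𝓡 n) (p ∘ (extChartAt (𝓡 n) x₀).symm) y (stdVec i))
        (mfderiv 𝓘(ℝ, Model n) (𝓡 n) (p ∘ (extChartAt (𝓡 n) x₀).symm) y (stdVec j)))
        (extChartAt (𝓡 n) x₀).target := by
      intro y hy
      have h := ((g.contMDiff.continuous.continuousAt.comp_continuousWithinAt
        (hf.continuousOn y hy)).clm_bundle_apply₂ (F₁ := Model n) (F₂ := Model n)
        (contMDiffOn_mfderiv_apply hU hf (stdVec i) y hy)
        (contMDiffOn_mfderiv_apply hU hf (stdVec j) y hy))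
      simp only [FiberBundle.continuousWithinAt_totalSpace] at h
      exact h.2
    refine h1.congr fun y hy => ?_
    have h2 : mfderiv 𝓘(ℝ, Model n) (𝓡 n) (p ∘ (extChartAt (𝓡 n) x₀).symm) y =
        (mfderiv (𝓡 n) (𝓡 n) p ((extChartAt (𝓡 n) x₀).symm y)).comp
          (mfderiv 𝓘(ℝ, Model n) (𝓡 n) (extChartAt (𝓡 n) x₀).symm y) :=
      mfderiv_comp y (hp.contMDiff.mdifferentiableAt (by simp))
        (mdifferentiableAt_extChartAt_symm' hy)
    have h3 : ∀ A : Model n →L[ℝ] Model n,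
        (mfderiv 𝓘(ℝ, Model n) (𝓡 n) (p ∘ (extChartAt (𝓡 n) x₀).symm) y : Model n →L[ℝ] Model n) =
          A → g.inner (p ((extChartAt (𝓡 n) x₀).symm y)) (A (stdVec i)) (A (stdVec j)) =
          g.inner ((p ∘ (extChartAt (𝓡 n) x₀).symm) y)
        (mfderiv 𝓘(ℝ, Model n) (𝓡 n) (p ∘ (extChartAt (𝓡 n) x₀).symm) y (stdVec i))
        (mfderiv 𝓘(ℝ, Model n) (𝓡 n) (p ∘ (extChartAt (𝓡 n) x₀).symm) y (stdVec j)) := by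
      rintro _ rfl; rfl
    exact h3 _ h2

end Riemannian

/-! ### The Riemannian volume in charts -/

theorem measurableSet_inter_preimage_of_continuousOn {X Y : Type*} [TopologicalSpace X]
    [MeasurableSpace X] [BorelSpace X] [TopologicalSpace Y] [MeasurableSpace Y] [BorelSpace Y]
    {f : X → Y} {s : Set X} (hf : ContinuousOn f s) (hs : MeasurableSet s) {t : Set Y}
    (ht : MeasurableSet t) : MeasurableSet (s ∩ f ⁻¹' t) := by
  have h1 : Measurable (s.domRestrict f) := (continuousOn_iff_continuous_domRestrict.1 hf).measurable
  have h2 := hs.subtype_image (h1 ht)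
  convert h2 using 1
  ext x
  simp only [mem_inter_iff, mem_preimage, mem_image, Subtype.exists, exists_and_right,
    exists_eq_right]
  exact ⟨fun h => ⟨h.1, h.2⟩, fun ⟨h1, h2⟩ => ⟨h1, h2⟩⟩

section Volume

variable {n : ℕ} {N : Type*} [TopologicalSpace N] [ChartedSpace (Model n) N]
  [MeasurableSpace N] [BorelSpace N]

/-- The Riemannian density in a chart. -/
noncomputable def density (h : MetricTensor n N) (x₀ : N) (y : Model n) : ℝ≥0∞ :=
  ENNReal.ofReal (Real.sqrt (gram h x₀ y).det)

variable {h : MetricTensor n N}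

omit [MeasurableSpace N] [BorelSpace N] in
theorem measurableSet_target (x₀ : N) : MeasurableSet (extChartAt (𝓡 n) x₀).target :=
  (isOpen_extChartAt_target x₀).measurableSet

theorem measurableSet_source (x₀ : N) : MeasurableSet (extChartAt (𝓡 n) x₀).source :=
  (isOpen_extChartAt_source x₀).measurableSet

omit [MeasurableSpace N] [BorelSpace N] in
theorem continuousOn_sqrt_det (hh : h.IsRiemannian) (x₀ : N) :
    ContinuousOn (fun y => Real.sqrt (gram h x₀ y).det) (extChartAt (𝓡 n) x₀).target :=
  Real.continuous_sqrt.comp_continuousOn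
    ((Continuous.matrix_det continuous_id).comp_continuousOn (hh.continuousOn_gram x₀))

omit [MeasurableSpace N] [BorelSpace N] in
theorem aemeasurable_density (hh : h.IsRiemannian) (x₀ : N) :
    AEMeasurable (density h x₀) (volume.restrict (extChartAt (𝓡 n) x₀).target) :=
  ((continuousOn_sqrt_det hh x₀).aemeasurable (measurableSet_target x₀)).ennreal_ofReal

omit [MeasurableSpace N] [BorelSpace N] in
theorem det_gram_pos [IsManifold (𝓡 n) ∞ N] (hh : h.IsRiemannian) {x₀ : N} {y : Model n}
    (hy : y ∈ (extChartAt (𝓡 n) x₀).target) : 0 < (gram h x₀ y).det :=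
  (hh.chartMetric hy).det_pos

omit [MeasurableSpace N] [BorelSpace N] in
theorem density_ne_zero [IsManifold (𝓡 n) ∞ N] (hh : h.IsRiemannian) {x₀ : N} {y : Model n}
    (hy : y ∈ (extChartAt (𝓡 n) x₀).target) : density h x₀ y ≠ 0 := by
  rw [density, ne_eq, ENNReal.ofReal_eq_zero, not_le, Real.sqrt_pos]
  exact det_gram_pos hh hy

theorem aemeasurable_symm (x₀ : N) :
    AEMeasurable (extChartAt (𝓡 n) x₀).symm (volume.restrict (extChartAt (𝓡 n) x₀).target) :=
  (continuousOn_extChartAt_symm x₀).aemeasurable (measurableSet_target x₀)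

theorem lintegral_chartVolume (hh : h.IsRiemannian) (x₀ : N) {F : N → ℝ≥0∞} (hF : Measurable F) :
    ∫⁻ x, F x ∂(chartVolume h x₀) =
      ∫⁻ y in (extChartAt (𝓡 n) x₀).target, density h x₀ y * F ((extChartAt (𝓡 n) x₀).symm y) := by
  rw [chartVolume, lintegral_map' hF.aemeasurable
    ((aemeasurable_symm x₀).mono_ac (withDensity_absolutelyContinuous _ _))]
  exact lintegral_withDensity_eq_lintegral_mul₀ (aemeasurable_density hh x₀)
    (hF.comp_aemeasurable (aemeasurable_symm x₀))

theorem chartVolume_apply (hh : h.IsRiemannian) (x₀ : N) {A : Set N} (hA : MeasurableSet A) :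
    chartVolume h x₀ A = ∫⁻ y in (extChartAt (𝓡 n) x₀).target ∩
      (extChartAt (𝓡 n) x₀).symm ⁻¹' A, density h x₀ y := by
  have h1 := measurableSet_inter_preimage_of_continuousOn
    (continuousOn_extChartAt_symm (I := 𝓡 n) x₀) (measurableSet_target x₀) hA
  rw [← lintegral_indicator_one hA, lintegral_chartVolume hh x₀ (measurable_one.indicator hA),
    ← lintegral_indicator h1, ← lintegral_indicator (measurableSet_target x₀)]
  refine lintegral_congr fun y => ?_
  by_cases hy : y ∈ (extChartAt (𝓡 n) x₀).target
  · by_cases hyA : (extChartAt (𝓡 n) x₀).symm y ∈ A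
    · have hmem : y ∈ (extChartAt (𝓡 n) x₀).target ∩ (extChartAt (𝓡 n) x₀).symm ⁻¹' A := ⟨hy, hyA⟩
      rw [indicator_of_mem hy, indicator_of_mem hyA, indicator_of_mem hmem]; simp
    · rw [indicator_of_mem hy, indicator_of_notMem hyA, indicator_of_notMem fun h => hyA h.2]; simp
  · rw [indicator_of_notMem hy, indicator_of_notMem fun h => hy h.1]

theorem chartVolume_inter_source (hh : h.IsRiemannian) (x₀ : N) {A : Set N}
    (hA : MeasurableSet A) :
    chartVolume h x₀ (A ∩ (extChartAt (𝓡 n) x₀).source) = chartVolume h x₀ A := by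
  rw [chartVolume_apply hh x₀ hA, chartVolume_apply hh x₀ (hA.inter (measurableSet_source x₀))]
  have : (extChartAt (𝓡 n) x₀).target ∩ (extChartAt (𝓡 n) x₀).symm ⁻¹'
      (A ∩ (extChartAt (𝓡 n) x₀).source) =
      (extChartAt (𝓡 n) x₀).target ∩ (extChartAt (𝓡 n) x₀).symm ⁻¹' A := by
    ext y
    exact ⟨fun hy => ⟨hy.1, hy.2.1⟩, fun hy => ⟨hy.1, hy.2, (extChartAt (𝓡 n) x₀).map_target hy.1⟩⟩
  rw [this]

variable [IsManifold (𝓡 n) ∞ N]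

omit [MeasurableSpace N] [BorelSpace N] in
theorem density_coordMap (hh : h.IsRiemannian) {Φ : N → N} (hΦ : ContMDiff (𝓡 n) (𝓡 n) ∞ Φ)
    (hiso : ∀ x (v w : Model n), h (Φ x) (mfderiv (𝓡 n) (𝓡 n) Φ x v) (mfderiv (𝓡 n) (𝓡 n) Φ x w) =
      h x v w) {x₀ x₁ : N} {y : Model n} (hy : y ∈ coordDom Φ x₀ x₁) :
    density h x₀ y = ENNReal.ofReal |(fderiv ℝ (coordMap Φ x₀ x₁) y).det| *
      density h x₁ (coordMap Φ x₀ x₁ y) := by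
  have h1 : chartMetric h x₀ y = fun v w => chartMetric h x₁ (coordMap Φ x₀ x₁ y)
      (fderiv ℝ (coordMap Φ x₀ x₁) y v) (fderiv ℝ (coordMap Φ x₀ x₁) y w) := by
    funext v w
    have h2 : ∀ z, z = Φ ((extChartAt (𝓡 n) x₀).symm y) → ∀ u u' : Model n,
        h (Φ ((extChartAt (𝓡 n) x₀).symm y)) u u' = h z u u' := by rintro z rfl u u'; rfl
    refine (hiso ((extChartAt (𝓡 n) x₀).symm y)
      (mfderiv 𝓘(ℝ, Model n) (𝓡 n) (extChartAt (𝓡 n) x₀).symm y v)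
      (mfderiv 𝓘(ℝ, Model n) (𝓡 n) (extChartAt (𝓡 n) x₀).symm y w)).symm.trans ?_
    refine (h2 _ (symm_coordMap hy) _ _).trans ?_
    exact congr_arg₂ (fun u u' : Model n => h ((extChartAt (𝓡 n) x₁).symm (coordMap Φ x₀ x₁ y)) u u')
      (mfderiv_symm_comp_fderiv_coordMap hΦ hy v).symm
      (mfderiv_symm_comp_fderiv_coordMap hΦ hy w).symm
  have h3 := (hh.chartMetric (coordMap_mem_target hy)).det_stdGram_comp
    (fderiv ℝ (coordMap Φ x₀ x₁) y)
  rw [← h1, stdGram_chartMetric, stdGram_chartMetric] at h3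
  rw [density, density, h3, Real.sqrt_mul (sq_nonneg _), Real.sqrt_sq_eq_abs,
    ENNReal.ofReal_mul (abs_nonneg _)]

theorem chartVolume_image (hh : h.IsRiemannian) {Φ : N → N} (hΦ : ContMDiff (𝓡 n) (𝓡 n) ∞ Φ)
    (hiso : ∀ x (v w : Model n), h (Φ x) (mfderiv (𝓡 n) (𝓡 n) Φ x v) (mfderiv (𝓡 n) (𝓡 n) Φ x w) =
      h x v w) (hinj : Function.Injective Φ) {x₀ x₁ : N} {A : Set N} (hA : MeasurableSet A)
    (hΦA : MeasurableSet (Φ '' A)) (h0 : A ⊆ (extChartAt (𝓡 n) x₀).source)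
    (h1 : Φ '' A ⊆ (extChartAt (𝓡 n) x₁).source) :
    chartVolume h x₁ (Φ '' A) = chartVolume h x₀ A := by
  rw [chartVolume_apply hh x₀ hA, chartVolume_apply hh x₁ hΦA]
  set S := (extChartAt (𝓡 n) x₀).target ∩ (extChartAt (𝓡 n) x₀).symm ⁻¹' A with hS
  have hSd : ∀ y ∈ S, y ∈ coordDom Φ x₀ x₁ := fun y hy => ⟨hy.1, h1 ⟨_, hy.2, rfl⟩⟩
  have himg : (extChartAt (𝓡 n) x₁).target ∩ (extChartAt (𝓡 n) x₁).symm ⁻¹' (Φ '' A) =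
      coordMap Φ x₀ x₁ '' S := by
    ext z
    constructor
    · rintro ⟨hz, a, ha, haz⟩
      refine ⟨extChartAt (𝓡 n) x₀ a, ⟨(extChartAt (𝓡 n) x₀).map_source (h0 ha), ?_⟩, ?_⟩
      · rw [mem_preimage, (extChartAt (𝓡 n) x₀).left_inv (h0 ha)]; exact ha
      · simp only [coordMap, Function.comp, (extChartAt (𝓡 n) x₀).left_inv (h0 ha), haz]
        exact (extChartAt (𝓡 n) x₁).right_inv hz
    · rintro ⟨y, hy, rfl⟩
      exact ⟨coordMap_mem_target (hSd y hy), by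
        rw [mem_preimage, symm_coordMap (hSd y hy)]; exact ⟨_, hy.2, rfl⟩⟩
  rw [himg, lintegral_image_eq_lintegral_abs_det_fderiv_mul volume
    (f' := fun y => fderiv ℝ (coordMap Φ x₀ x₁) y)]
  · refine setLIntegral_congr_fun ?_ fun y hy => (density_coordMap hh hΦ hiso (hSd y hy)).symm
    exact measurableSet_inter_preimage_of_continuousOn
      (continuousOn_extChartAt_symm (I := 𝓡 n) x₀) (measurableSet_target x₀) hA
  · exact measurableSet_inter_preimage_of_continuousOn
      (continuousOn_extChartAt_symm (I := 𝓡 n) x₀) (measurableSet_target x₀) hA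
  · exact fun y hy => (((contDiffAt_coordMap hΦ (hSd y hy)).differentiableAt
      (by simp)).hasFDerivAt).hasFDerivWithinAt
  · intro y hy z hz hyz
    have h2 := congr_arg (extChartAt (𝓡 n) x₁).symm hyz
    rw [symm_coordMap (hSd y hy), symm_coordMap (hSd z hz)] at h2
    exact (extChartAt (𝓡 n) x₀).symm.injOn hy.1 hz.1 (hinj h2)

theorem chartVolume_eq (hh : h.IsRiemannian) {x₀ x₁ : N} {A : Set N} (hA : MeasurableSet A)
    (h0 : A ⊆ (extChartAt (𝓡 n) x₀).source) (h1 : A ⊆ (extChartAt (𝓡 n) x₁).source) :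
    chartVolume h x₁ A = chartVolume h x₀ A := by
  have := chartVolume_image hh (Φ := id) contMDiff_id (fun x v w => by
    rw [mfderiv_id]; rfl) Function.injective_id hA (by simpa using hA) h0 (by simpa using h1)
  simpa using this

omit [MeasurableSpace N] [BorelSpace N] [IsManifold (𝓡 n) ∞ N] in
theorem exists_countable_charts [SecondCountableTopology N] [Nonempty N] :
    ∃ x : ℕ → N, ⋃ i, (extChartAt (𝓡 n) (x i)).source = univ := by
  obtain ⟨s, hs, hU⟩ := TopologicalSpace.countable_cover_nhds
    (f := fun x : N => (extChartAt (𝓡 n) x).source) fun x => extChartAt_source_mem_nhds x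
  have hne : s.Nonempty := by
    by_contra! h0
    rw [h0] at hU
    simp only [mem_empty_iff_false, iUnion_of_empty, iUnion_empty] at hU
    exact empty_ne_univ hU
  obtain ⟨x, rfl⟩ := hs.exists_eq_range hne
  exact ⟨x, by simpa using hU⟩

theorem riemannianVolume_eq_chartVolume [SecondCountableTopology N] (hh : h.IsRiemannian) {x₀ : N}
    {A : Set N} (hA : MeasurableSet A) (h0 : A ⊆ (extChartAt (𝓡 n) x₀).source) :
    riemannianVolume h A = chartVolume h x₀ A := by
  refine le_antisymm ?_ (Measure.le_iff.1 (le_iSup (chartVolume h) x₀) A hA)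
  have : Nonempty N := ⟨x₀⟩
  obtain ⟨x, hx⟩ := exists_countable_charts (n := n) (N := N)
  let P : ℕ → Set N := disjointed fun i => (extChartAt (𝓡 n) (x i)).source
  have hPm : ∀ i, MeasurableSet (P i) := .disjointed fun i => measurableSet_source (x i)
  have hPd : Pairwise (Function.onFun Disjoint P) := disjoint_disjointed _
  have hPs : ∀ i, P i ⊆ (extChartAt (𝓡 n) (x i)).source := fun i => disjointed_subset _ i
  have hPU : ⋃ i, P i = univ := by rw [iUnion_disjointed, hx]
  let ν : Measure N := Measure.sum fun i => (chartVolume h (x i)).restrict (P i)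
  have hν : ∀ B, MeasurableSet B → ν B = ∑' i, chartVolume h (x i) (B ∩ P i) := fun B hB => by
    rw [Measure.sum_apply _ hB]
    exact tsum_congr fun i => Measure.restrict_apply hB
  have hdec : ∀ z B, MeasurableSet B → B ⊆ (extChartAt (𝓡 n) z).source →
      chartVolume h z B = ∑' i, chartVolume h (x i) (B ∩ P i) := fun z B hB hBs => by
    have h1 : B = ⋃ i, B ∩ P i := by rw [← inter_iUnion, hPU, inter_univ]
    conv_lhs => rw [h1]
    rw [measure_iUnion (fun i j hij => (hPd hij).mono inter_subset_right inter_subset_right)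
      fun i => hB.inter (hPm i)]
    exact tsum_congr fun i => chartVolume_eq hh (hB.inter (hPm i))
      (inter_subset_right.trans (hPs i)) (inter_subset_left.trans hBs)
  have hle : riemannianVolume h ≤ ν := by
    refine iSup_le fun z => Measure.le_iff.2 fun B hB => ?_
    rw [← chartVolume_inter_source hh z hB,
      hdec z _ (hB.inter (measurableSet_source z)) inter_subset_right, hν B hB]
    exact ENNReal.tsum_le_tsum fun i => measure_mono (by gcongr; exact inter_subset_left)
  refine (Measure.le_iff.1 hle A hA).trans_eq ?_
  rw [hν A hA, hdec x₀ A hA h0]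

theorem riemannianVolume_restrict_source [SecondCountableTopology N] (hh : h.IsRiemannian)
    (x₀ : N) : (riemannianVolume h).restrict (extChartAt (𝓡 n) x₀).source = chartVolume h x₀ := by
  ext A hA
  rw [Measure.restrict_apply hA, riemannianVolume_eq_chartVolume hh
    (hA.inter (measurableSet_source x₀)) inter_subset_right, chartVolume_inter_source hh x₀ hA]

theorem riemannianVolume_image [SecondCountableTopology N]
    (hh : h.IsRiemannian) {Φ : N → N} (hΦ : ContMDiff (𝓡 n) (𝓡 n) ∞ Φ)
    (hiso : ∀ x (v w : Model n), h (Φ x) (mfderiv (𝓡 n) (𝓡 n) Φ x v) (mfderiv (𝓡 n) (𝓡 n) Φ x w) =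
      h x v w) (hinj : Function.Injective Φ) {x₀ x₁ : N} {A : Set N} (hA : MeasurableSet A)
    (hΦA : MeasurableSet (Φ '' A)) (h0 : A ⊆ (extChartAt (𝓡 n) x₀).source)
    (h1 : Φ '' A ⊆ (extChartAt (𝓡 n) x₁).source) :
    riemannianVolume h (Φ '' A) = riemannianVolume h A := by
  rw [riemannianVolume_eq_chartVolume hh hA h0, riemannianVolume_eq_chartVolume hh hΦA h1,
    chartVolume_image hh hΦ hiso hinj hA hΦA h0 h1]

theorem setLIntegral_source [SecondCountableTopology N] (hh : h.IsRiemannian) (x₀ : N)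
    {F : N → ℝ≥0∞} (hF : Measurable F) :
    ∫⁻ x in (extChartAt (𝓡 n) x₀).source, F x ∂(riemannianVolume h) =
      ∫⁻ y in (extChartAt (𝓡 n) x₀).target, density h x₀ y * F ((extChartAt (𝓡 n) x₀).symm y) := by
  rw [riemannianVolume_restrict_source hh, lintegral_chartVolume hh x₀ hF]

/-- Null sets can be detected in a chart. -/
theorem ae_of_ae_chart [SecondCountableTopology N] (hh : h.IsRiemannian) (x₀ : N)
    {W : Set (Model n)} (hW : W ⊆ (extChartAt (𝓡 n) x₀).target) {P : N → Prop}
    (hP : ∀ᵐ y, y ∈ W → P ((extChartAt (𝓡 n) x₀).symm y)) :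
    ∀ᵐ x ∂(riemannianVolume h), x ∈ (extChartAt (𝓡 n) x₀).symm '' W → P x := by
  obtain ⟨Z, hZ, hZm, hZ0⟩ := exists_measurable_superset_of_null (ae_iff.1 hP)
  have hm : MeasurableSet ((extChartAt (𝓡 n) x₀).source ∩ extChartAt (𝓡 n) x₀ ⁻¹' Z) :=
    measurableSet_inter_preimage_of_continuousOn (continuousOn_extChartAt x₀)
      (measurableSet_source x₀) hZm
  rw [ae_iff]
  refine measure_mono_null (t := (extChartAt (𝓡 n) x₀).source ∩ extChartAt (𝓡 n) x₀ ⁻¹' Z) ?_ ?_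
  · intro x hx
    simp only [mem_ofPred_eq, Classical.not_imp] at hx
    obtain ⟨⟨y, hy, rfl⟩, hx⟩ := hx
    refine ⟨(extChartAt (𝓡 n) x₀).map_target (hW hy), ?_⟩
    rw [mem_preimage, (extChartAt (𝓡 n) x₀).right_inv (hW hy)]
    exact hZ fun hc => hx (hc hy)
  · rw [riemannianVolume_eq_chartVolume hh hm inter_subset_left, chartVolume_apply hh x₀ hm]
    refine setLIntegral_measure_zero _ _ (measure_mono_null ?_ hZ0)
    rintro y ⟨hy, -, hyZ⟩
    rwa [mem_preimage, (extChartAt (𝓡 n) x₀).right_inv hy] at hyZ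

theorem ae_chart_of_ae (hh : h.IsRiemannian) (x₀ : N) {P : N → Prop}
    (hP : ∀ᵐ x ∂(riemannianVolume h), P x) :
    ∀ᵐ y ∂(volume.restrict (extChartAt (𝓡 n) x₀).target), P ((extChartAt (𝓡 n) x₀).symm y) := by
  have h1 : ∀ᵐ x ∂(chartVolume h x₀), P x :=
    (Measure.absolutelyContinuous_of_le (le_iSup (chartVolume h) x₀)).ae_le hP
  have h2 := ae_of_ae_map
    ((aemeasurable_symm x₀).mono_ac (withDensity_absolutelyContinuous _ _)) h1
  refine (withDensity_absolutelyContinuous' (aemeasurable_density hh x₀) ?_).ae_le h2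
  filter_upwards [ae_restrict_mem (measurableSet_target x₀)] with y hy
  exact density_ne_zero hh hy

theorem riemannianVolume_pos [SecondCountableTopology N] (hh : h.IsRiemannian) {U : Set N}
    (hU : IsOpen U) (hne : U.Nonempty) : riemannianVolume h U ≠ 0 := by
  intro h0
  obtain ⟨x₀, hx₀⟩ := hne
  have h1 : ∀ᵐ x ∂(riemannianVolume h), x ∉ U := by rw [ae_iff]; simpa using h0
  have h2 := ae_chart_of_ae hh x₀ h1
  rw [ae_restrict_iff' (measurableSet_target x₀), ae_iff] at h2
  have h3 : IsOpen ((extChartAt (𝓡 n) x₀).target ∩ (extChartAt (𝓡 n) x₀).symm ⁻¹' U) :=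
    (continuousOn_extChartAt_symm x₀).isOpen_inter_preimage (isOpen_extChartAt_target x₀) hU
  refine (h3.measure_pos volume ⟨extChartAt (𝓡 n) x₀ x₀, mem_extChartAt_target x₀, ?_⟩).ne' ?_
  · rw [mem_preimage, extChartAt_to_inv]; exact hx₀
  · refine measure_mono_null ?_ h2
    rintro y ⟨hy, hyU⟩
    simp only [mem_ofPred_eq, Classical.not_imp, not_not]
    exact ⟨hy, hyU⟩

end Volume

/-! ### Deck transformations -/

section Deck

variable {n : ℕ} {M : Type*} [TopologicalSpace M] [ChartedSpace (Model n) M]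
  {N : Type*} [TopologicalSpace N] [ChartedSpace (Model n) N] {p : N → M}

theorem IsUniversalCovering.exists_deck (hp : IsUniversalCovering (n := n) p) {x y : N}
    (hxy : p x = p y) : ∃ γ : N ≃ₜ N, γ x = y ∧ ∀ z, p (γ z) = p z := by
  have := hp.simplyConnected
  have : LocallyPathConnectedSpace N := ChartedSpace.locallyPathConnectedSpace (Model n) N
  obtain ⟨γ, ⟨h1, h2⟩, -⟩ := hp.isCovering.existsUnique_continuousMap_lifts
    ⟨p, hp.isCovering.continuous⟩ x y hxy.symm
  obtain ⟨δ, ⟨h3, h4⟩, -⟩ := hp.isCovering.existsUnique_continuousMap_lifts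
    ⟨p, hp.isCovering.continuous⟩ y x hxy
  have h2' : ∀ z, p (γ z) = p z := fun z => congr_fun h2 z
  have h4' : ∀ z, p (δ z) = p z := fun z => congr_fun h4 z
  have h5 : δ ∘ γ = id := hp.isCovering.eq_of_comp_eq (δ.continuous.comp γ.continuous)
    continuous_id (funext fun z => by simp [h2', h4']) x (by simp [h1, h3])
  have h6 : γ ∘ δ = id := hp.isCovering.eq_of_comp_eq (γ.continuous.comp δ.continuous)
    continuous_id (funext fun z => by simp [h2', h4']) y (by simp [h1, h3])
  exact ⟨{ toFun := γ, invFun := δ, left_inv := congr_fun h5, right_inv := congr_fun h6,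
           continuous_toFun := γ.continuous, continuous_invFun := δ.continuous }, h1, h2'⟩

theorem IsUniversalCovering.deck_unique (hp : IsUniversalCovering (n := n) p) {γ δ : N ≃ₜ N}
    (hγ : ∀ z, p (γ z) = p z) (hδ : ∀ z, p (δ z) = p z) {x : N} (hx : γ x = δ x) (z : N) :
    γ z = δ z := by
  have := hp.simplyConnected
  exact congr_fun (hp.isCovering.eq_of_comp_eq γ.continuous δ.continuous
    (funext fun z => by simp [hγ, hδ]) x hx) z

theorem IsUniversalCovering.contMDiff_deck (hp : IsUniversalCovering (n := n) p) {γ : N ≃ₜ N}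
    (hγ : ∀ z, p (γ z) = p z) : ContMDiff (𝓡 n) (𝓡 n) ∞ γ := by
  intro x
  have hl := hp.isLocalDiffeomorph (γ x)
  have h1 : ContMDiffAt (𝓡 n) (𝓡 n) ∞ (hl.localInverse ∘ p) x := by
    refine ContMDiffAt.comp x ?_ hp.isLocalDiffeomorph.contMDiff.contMDiffAt
    rw [← hγ x]
    exact hl.localInverse_contMDiffAt
  refine h1.congr_of_eventuallyEq ?_
  filter_upwards [γ.continuous.continuousAt.eventually hl.localInverse_eventuallyEq_left] with z hz
  simp only [Function.comp, hγ, id] at hz ⊢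
  exact hz.symm

/-- The fibre of the universal covering over the base point of an infinite fundamental group is
infinite. -/
theorem IsUniversalCovering.exists_infinite_fibre [ConnectedSpace M]
    (hp : IsUniversalCovering (n := n) p) {x₀ : M} (hπ : Infinite (FundamentalGroup M x₀)) :
    ∃ x : N, {y | p y = p x}.Infinite := by
  have := hp.simplyConnected
  have : LocallyPathConnectedSpace M := ChartedSpace.locallyPathConnectedSpace (Model n) M
  have : PathConnectedSpace M := PathConnectedSpace.of_locallyPathConnectedSpace
  have cov := hp.isCovering
  let z : N := Classical.arbitrary N
  let e : p ⁻¹' {x₀} := cov.monodromy (Path.Homotopic.Quotient.mk (PathConnectedSpace.somePath (p z) x₀))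
    ⟨z, rfl⟩
  have hlift : ∀ (c : Path.Homotopic.Quotient x₀ x₀) (e' : p ⁻¹' {x₀}), cov.monodromy c e = e' →
      ∃ Γ : Path.Homotopic.Quotient e.1 e'.1, Γ.map ⟨p, cov.continuous⟩ = c.cast e.2 e'.2 := by
    rintro c _ rfl
    exact ⟨_, cov.map_liftPathQuotient c e⟩
  have hinj : Function.Injective (fun c : Path.Homotopic.Quotient x₀ x₀ => cov.monodromy c e) := by
    intro c c' hcc
    obtain ⟨Γ, hΓ⟩ := hlift c _ rfl
    obtain ⟨Γ', hΓ'⟩ := hlift c' _ hcc.symm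
    have h1 : Γ = Γ' := Subsingleton.elim _ _
    rw [h1, hΓ'] at hΓ
    have h2 : HEq c c' := (c.cast_heq e.2 (cov.monodromy c e).2).symm.trans
      ((heq_of_eq hΓ.symm).trans (c'.cast_heq _ _))
    exact eq_of_heq h2
  have hinf : Infinite (Path.Homotopic.Quotient x₀ x₀) := hπ
  have hfib : Infinite (p ⁻¹' {x₀}) := Infinite.of_injective _ hinj
  refine ⟨e.1, ?_⟩
  have he : p e.1 = x₀ := e.2
  rw [he]
  exact Set.infinite_coe_iff.1 hfib

variable [IsManifold (𝓡 n) ∞ M] [IsManifold (𝓡 n) ∞ N]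

omit [IsManifold (𝓡 n) ∞ M] [IsManifold (𝓡 n) ∞ N] in
theorem IsUniversalCovering.mfderiv_deck (hp : IsUniversalCovering (n := n) p) {γ : N ≃ₜ N}
    (hγ : ∀ z, p (γ z) = p z) (x : N) (v : Model n) :
    (mfderiv (𝓡 n) (𝓡 n) p (γ x) : Model n →L[ℝ] Model n) (mfderiv (𝓡 n) (𝓡 n) γ x v) =
      (mfderiv (𝓡 n) (𝓡 n) p x : Model n →L[ℝ] Model n) v := by
  have h1 : mfderiv (𝓡 n) (𝓡 n) (p ∘ γ) x =
      (mfderiv (𝓡 n) (𝓡 n) p (γ x)).comp (mfderiv (𝓡 n) (𝓡 n) γ x) :=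
    mfderiv_comp x (hp.isLocalDiffeomorph.contMDiff.mdifferentiableAt (by simp))
      ((hp.contMDiff_deck hγ).mdifferentiableAt (by simp))
  have h2 : p ∘ γ = p := funext hγ
  have h3 : ∀ q : N → M, q = p → (mfderiv (𝓡 n) (𝓡 n) q x : Model n →L[ℝ] Model n) v =
      (mfderiv (𝓡 n) (𝓡 n) p x : Model n →L[ℝ] Model n) v := by rintro q rfl; rfl
  rw [← h3 _ h2]
  exact (congr_arg (fun A : Model n →L[ℝ] Model n => A v) h1).symm

omit [IsManifold (𝓡 n) ∞ N] in
theorem IsUniversalCovering.pullbackMetric_deck (hp : IsUniversalCovering (n := n) p)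
    (g : RiemannianMetricOn n M) {γ : N ≃ₜ N}
    (hγ : ∀ z, p (γ z) = p z) (x : N) (v w : Model n) :
    pullbackMetric p g (γ x) (mfderiv (𝓡 n) (𝓡 n) γ x v) (mfderiv (𝓡 n) (𝓡 n) γ x w) =
      pullbackMetric p g x v w := by
  have h1 : ∀ m, m = p x → ∀ u u' : Model n, g.inner m u u' = g.inner (p x) u u' := by
    rintro m rfl u u'; rfl
  refine (h1 _ (hγ x) _ _).trans ?_
  exact congr_arg₂ (fun u u' : Model n => g.inner (p x) u u') (hp.mfderiv_deck hγ x v)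
    (hp.mfderiv_deck hγ x w)

theorem riemannianVolume_image_homeomorph [SecondCountableTopology N] [MeasurableSpace N]
    [BorelSpace N] {h : MetricTensor n N} (hh : h.IsRiemannian) {γ : N ≃ₜ N}
    (hγ : ContMDiff (𝓡 n) (𝓡 n) ∞ γ)
    (hiso : ∀ x (v w : Model n), h (γ x) (mfderiv (𝓡 n) (𝓡 n) γ x v) (mfderiv (𝓡 n) (𝓡 n) γ x w) =
      h x v w) {x₀ : N} {A : Set N} (hA : MeasurableSet A)
    (h0 : A ⊆ (extChartAt (𝓡 n) x₀).source) :
    riemannianVolume h (γ '' A) = riemannianVolume h A := by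
  have : Nonempty N := ⟨x₀⟩
  obtain ⟨x, hx⟩ := exists_countable_charts (n := n) (N := N)
  let P : ℕ → Set N := disjointed fun i => (extChartAt (𝓡 n) (x i)).source
  have hPm : ∀ i, MeasurableSet (P i) := .disjointed fun i => measurableSet_source (x i)
  have hPd : Pairwise (Function.onFun Disjoint P) := disjoint_disjointed _
  have hPs : ∀ i, P i ⊆ (extChartAt (𝓡 n) (x i)).source := fun i => disjointed_subset _ i
  have hPU : ⋃ i, P i = univ := by rw [iUnion_disjointed, hx]
  have hm : ∀ i, MeasurableSet (A ∩ γ ⁻¹' P i) := fun i => hA.inter (γ.measurable (hPm i))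
  have hd : Pairwise (Function.onFun Disjoint fun i => A ∩ γ ⁻¹' P i) := fun i j hij =>
    ((hPd hij).preimage γ).mono inter_subset_right inter_subset_right
  have hmi : ∀ i, MeasurableSet (γ '' (A ∩ γ ⁻¹' P i)) := fun i =>
    γ.toMeasurableEquiv.measurableSet_image.2 (hm i)
  have hA1 : A = ⋃ i, A ∩ γ ⁻¹' P i := by
    rw [← inter_iUnion, ← preimage_iUnion, hPU, preimage_univ, inter_univ]
  have hA2 : γ '' A = ⋃ i, γ '' (A ∩ γ ⁻¹' P i) := by rw [← image_iUnion, ← hA1]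
  rw [hA2, measure_iUnion (fun i j hij => (disjoint_image_iff γ.injective).2 (hd hij)) hmi]
  conv_rhs => rw [hA1, measure_iUnion hd hm]
  refine tsum_congr fun i => ?_
  refine riemannianVolume_image hh hγ hiso γ.injective (hm i) (hmi i) (x₁ := x i)
    (inter_subset_left.trans h0) ?_
  rintro _ ⟨z, hz, rfl⟩
  exact hPs i hz.2

end Deck

/-! ### Square integrable functions that are locally exponentials of primitives -/

section Global

variable {n : ℕ} {N : Type*} [TopologicalSpace N] [ChartedSpace (Model n) N]
  [IsManifold (𝓡 n) ∞ N]

theorem eq_of_hasMFDerivAt_zero [ConnectedSpace N] {f : N → ℝ}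
    (hf : ∀ x, HasMFDerivAt (𝓡 n) 𝓘(ℝ, ℝ) f x (0 : Model n →L[ℝ] ℝ)) (x y : N) : f x = f y := by
  refine IsLocallyConstant.apply_eq_of_preconnectedSpace ?_ x y
  rw [IsLocallyConstant.iff_eventually_eq]
  intro x₀
  obtain ⟨ε, hε, hball⟩ := Metric.isOpen_iff.1 (isOpen_extChartAt_target (I := 𝓡 n) x₀) _
    (mem_extChartAt_target x₀)
  have hd : ∀ y ∈ Metric.ball (extChartAt (𝓡 n) x₀ x₀) ε,
      HasFDerivAt (f ∘ (extChartAt (𝓡 n) x₀).symm) (0 : Model n →L[ℝ] ℝ) y := fun y hy => by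
    have h1 := (hf ((extChartAt (𝓡 n) x₀).symm y)).comp y
      (mdifferentiableAt_extChartAt_symm' (hball hy)).hasMFDerivAt
    refine HasMFDerivAt.hasFDerivAt (h1.congr_mfderiv ?_)
    exact ContinuousLinearMap.zero_comp _
  have hc : ∀ y ∈ Metric.ball (extChartAt (𝓡 n) x₀ x₀) ε,
      f ((extChartAt (𝓡 n) x₀).symm y) = f x₀ := fun y hy => by
    have := (convex_ball (extChartAt (𝓡 n) x₀ x₀) ε).is_const_of_fderivWithin_eq_zero (𝕜 := ℝ)
      (f := f ∘ (extChartAt (𝓡 n) x₀).symm)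
      (fun z hz => (hd z hz).differentiableAt.differentiableWithinAt)
      (fun z hz => by
        rw [fderivWithin_of_isOpen Metric.isOpen_ball hz, (hd z hz).fderiv])
      hy (Metric.mem_ball_self hε)
    simpa using this
  filter_upwards [extChartAt_source_mem_nhds (I := 𝓡 n) x₀,
    (continuousAt_extChartAt (I := 𝓡 n) x₀).preimage_mem_nhds (Metric.ball_mem_nhds _ hε)] with x hx hx'
  rw [← hc _ hx', (extChartAt (𝓡 n) x₀).left_inv hx]

variable [MeasurableSpace N] [BorelSpace N] [SecondCountableTopology N]

/-- Local primitives glue, on a connected manifold, to a global one. -/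
theorem exists_primitive_or_ae_eq_zero [ConnectedSpace N] {h : MetricTensor n N}
    (hh : h.IsRiemannian) {σ : N → Model n →L[ℝ] ℝ} {r : N → ℝ}
    (hr : ∀ x₀, ∃ U, IsOpen U ∧ x₀ ∈ U ∧ ((∀ᵐ x ∂(riemannianVolume h), x ∈ U → r x = 0) ∨
      ∃ F : N → ℝ, (∀ x ∈ U, HasMFDerivAt (𝓡 n) 𝓘(ℝ, ℝ) F x (σ x)) ∧
        ∀ᵐ x ∂(riemannianVolume h), x ∈ U → r x = Real.exp (F x))) :
    (∀ᵐ x ∂(riemannianVolume h), r x = 0) ∨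
      ∃ F : N → ℝ, (∀ x, HasMFDerivAt (𝓡 n) 𝓘(ℝ, ℝ) F x (σ x)) ∧
        ∀ᵐ x ∂(riemannianVolume h), r x = Real.exp (F x) := by
  have hloc : ∀ P : N → Prop, (∀ x₀, ∃ U, IsOpen U ∧ x₀ ∈ U ∧
      ∀ᵐ x ∂(riemannianVolume h), x ∈ U → P x) → ∀ᵐ x ∂(riemannianVolume h), P x := by
    intro P hP
    rw [ae_iff]
    refine measure_null_of_locally_null _ fun x₀ _ => ?_
    obtain ⟨U, hU, hx, hae⟩ := hP x₀
    refine ⟨U ∩ {x | ¬ P x}, Filter.inter_mem (mem_nhdsWithin_of_mem_nhds (hU.mem_nhds hx))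
      self_mem_nhdsWithin, ?_⟩
    rw [ae_iff] at hae
    refine measure_mono_null ?_ hae
    rintro x ⟨h1, h2⟩
    simp only [mem_ofPred_eq, Classical.not_imp]
    exact ⟨h1, h2⟩
  have hpos : ∀ U : Set N, IsOpen U → U.Nonempty → ¬ ∀ᵐ x ∂(riemannianVolume h), x ∉ U := by
    intro U hU hne hae
    rw [ae_iff] at hae
    exact riemannianVolume_pos hh hU hne (by simpa using hae)
  let Z : Set N := {x₀ | ∃ U, IsOpen U ∧ x₀ ∈ U ∧ ∀ᵐ x ∂(riemannianVolume h), x ∈ U → r x = 0}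
  have hZo : IsOpen Z := isOpen_iff_forall_mem_open.2 fun x ⟨U, hU, hx, hae⟩ =>
    ⟨U, fun y hy => ⟨U, hU, hy, hae⟩, hU, hx⟩
  have hZc : IsOpen Zᶜ := isOpen_iff_forall_mem_open.2 fun x hx => by
    obtain ⟨U, hU, hxU, h0 | ⟨F, -, hF⟩⟩ := hr x
    · exact absurd ⟨U, hU, hxU, h0⟩ hx
    · refine ⟨U, ?_, hU, hxU⟩
      rintro y hy ⟨V, hV, hyV, hae⟩
      refine hpos _ (hU.inter hV) ⟨y, hy, hyV⟩ ?_
      filter_upwards [hF, hae] with z h1 h2 ⟨h3, h4⟩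
      have := h1 h3
      rw [h2 h4] at this
      exact (Real.exp_pos _).ne this
  rcases isClopen_iff.1 (⟨⟨hZc⟩, hZo⟩ : IsClopen Z) with hZ | hZ
  · right
    have hr' : ∀ x₀, ∃ U, IsOpen U ∧ x₀ ∈ U ∧
      ∃ F : N → ℝ, (∀ x ∈ U, HasMFDerivAt (𝓡 n) 𝓘(ℝ, ℝ) F x (σ x)) ∧
        ∀ᵐ x ∂(riemannianVolume h), x ∈ U → r x = Real.exp (F x) := fun x₀ => by
      obtain ⟨U, hU, hxU, h0 | h1⟩ := hr x₀
      · have : x₀ ∈ Z := ⟨U, hU, hxU, h0⟩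
        rw [hZ] at this
        exact absurd this (notMem_empty _)
      · exact ⟨U, hU, hxU, h1⟩
    choose U hU hxU F hF hae using hr'
    have hcont : ∀ x, ContinuousOn (F x) (U x) := fun x y hy =>
      (hF x y hy).continuousAt.continuousWithinAt
    have heq : ∀ x, ∀ y ∈ U x, F y y = F x y := fun x y hy => by
      by_contra hne
      have ho : IsOpen ((U x ∩ U y) ∩ (fun z => F y z - F x z) ⁻¹' {0}ᶜ) :=
        (((hcont y).mono inter_subset_right).sub ((hcont x).mono inter_subset_left)
          ).isOpen_inter_preimage ((hU x).inter (hU y)) isOpen_compl_singleton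
      refine hpos _ ho ⟨y, ⟨hy, hxU y⟩, by simpa [sub_eq_zero] using hne⟩ ?_
      filter_upwards [hae x, hae y] with z h1 h2 ⟨⟨h3, h4⟩, h5⟩
      refine h5 ?_
      have := (h1 h3).symm.trans (h2 h4)
      simp [Real.exp_injective this]
    refine ⟨fun x => F x x, fun x => ?_, hloc _ fun x => ⟨U x, hU x, hxU x, ?_⟩⟩
    · refine (hF x x (hxU x)).congr_of_eventuallyEq ?_
      filter_upwards [(hU x).mem_nhds (hxU x)] with y hy using heq x y hy
    · filter_upwards [hae x] with y hy hyU
      rw [hy hyU, heq x y hyU]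
  · left
    refine hloc _ fun x => ?_
    have : x ∈ Z := hZ ▸ mem_univ x
    exact this

variable {M : Type*} [TopologicalSpace M] [ChartedSpace (Model n) M] [IsManifold (𝓡 n) ∞ M]
  [ConnectedSpace M] {p : N → M}

/-- The exponential of a primitive of a form that is invariant under the deck transformations is
not square integrable on the universal covering if the fundamental group is infinite. -/
theorem IsUniversalCovering.lintegral_exp_primitive_eq_top
    (hp : IsUniversalCovering (n := n) p) {m₀ : M} (hπ : Infinite (FundamentalGroup M m₀))
    (g : RiemannianMetricOn n M) {σ : N → Model n →L[ℝ] ℝ}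
    (hσ : ∀ γ : N ≃ₜ N, (∀ z, p (γ z) = p z) → ∀ x (v : Model n),
      σ (γ x) (mfderiv (𝓡 n) (𝓡 n) γ x v) = σ x v) {F : N → ℝ}
    (hF : ∀ x, HasMFDerivAt (𝓡 n) 𝓘(ℝ, ℝ) F x (σ x)) :
    ∫⁻ x, ‖Real.exp (F x)‖ₑ ^ 2 ∂(riemannianVolume (pullbackMetric p g)) = ⊤ := by
  have := hp.simplyConnected
  have hh := isRiemannian_pullbackMetric hp.isLocalDiffeomorph g
  obtain ⟨x₁, hinf⟩ := hp.exists_infinite_fibre hπ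
  have hdeck : ∀ y : {y | p y = p x₁}, ∃ γ : N ≃ₜ N, γ x₁ = y ∧ ∀ z, p (γ z) = p z :=
    fun y => hp.exists_deck y.2.symm
  choose γ hγ1 hγp using hdeck
  have hFc : Continuous F := continuous_iff_continuousAt.2 fun x => (hF x).continuousAt
  have hshift : ∀ y z, F (γ y z) = F z + (F y - F x₁) := fun y z => by
    have h1 : ∀ x, HasMFDerivAt (𝓡 n) 𝓘(ℝ, ℝ) (fun x => F (γ y x) - F x) x
        (0 : Model n →L[ℝ] ℝ) := fun x => by
      have h2 := ((hF (γ y x)).comp x (((hp.contMDiff_deck (hγp y)).mdifferentiableAt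
        (by simp)).hasMFDerivAt)).sub (hF x)
      refine h2.congr_mfderiv ?_
      refine ContinuousLinearMap.ext fun v => ?_
      exact sub_eq_zero.2 (hσ _ (hγp y) x v)
    have h3 := eq_of_hasMFDerivAt_zero h1 z x₁
    simp only [hγ1] at h3
    linarith
  have hinj : ∀ {y y' z}, γ y z = γ y' z → y = y' := fun {y y' z} hz => Subtype.ext (by
    rw [← hγ1 y, ← hγ1 y', hp.deck_unique (hγp y) (hγp y') hz])
  have hinf' : Infinite {y : {y | p y = p x₁} | F x₁ ≤ F y} := by
    rw [Set.infinite_coe_iff]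
    intro hfin
    have hi : Infinite {y | p y = p x₁} := Set.infinite_coe_iff.2 hinf
    have hcompl : ({y : {y | p y = p x₁} | F x₁ ≤ F y}ᶜ).Infinite := hfin.infinite_compl
    let ι : {y | p y = p x₁} → {y | p y = p x₁} := fun y => ⟨(γ y).symm x₁, by
      have := hγp y ((γ y).symm x₁)
      rw [Homeomorph.apply_symm_apply] at this
      exact this.symm⟩
    have hιF : ∀ y, F (ι y) = F x₁ - (F y - F x₁) := fun y => by
      have := hshift y ((γ y).symm x₁)
      rw [Homeomorph.apply_symm_apply] at this
      simp only [ι]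
      linarith
    have hιinj : Function.Injective ι := fun y y' hyy => hinj (z := ι y) (by
      conv_rhs => rw [hyy]
      simp [ι])
    refine (hcompl.image hιinj.injOn).mono ?_ hfin
    rintro _ ⟨y, hy, rfl⟩
    simp only [mem_compl_iff, mem_ofPred_eq, not_le] at hy ⊢
    rw [hιF]
    linarith
  obtain ⟨V₀, hV₀, hxV₀, hV₀inj⟩ := hp.isCovering.isLocalHomeomorph.isLocallyInjective x₁
  let V : Set N := V₀ ∩ (extChartAt (𝓡 n) x₁).source ∩ F ⁻¹' Ioi (F x₁ - 1)
  have hV : IsOpen V := (hV₀.inter (isOpen_extChartAt_source x₁)).inter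
    (isOpen_Ioi.preimage hFc)
  have hxV : x₁ ∈ V := ⟨⟨hxV₀, mem_extChartAt_source x₁⟩, by simp⟩
  let e := Infinite.natEmbedding {y : {y | p y = p x₁} | F x₁ ≤ F y}
  let T : ℕ → Set N := fun i => γ (e i).1 '' V
  have hTm : ∀ i, MeasurableSet (T i) := fun i => ((γ (e i).1).isOpenMap V hV).measurableSet
  have hTd : Pairwise (Function.onFun Disjoint T) := by
    intro i j hij
    refine Set.disjoint_left.2 ?_
    rintro _ ⟨a, ha, rfl⟩ ⟨b, hb, hab⟩
    have h1 : p a = p b := by rw [← hγp (e i).1 a, ← hab, hγp]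
    have h2 : a = b := hV₀inj ha.1.1 hb.1.1 h1
    rw [← h2] at hab
    exact hij (e.injective (Subtype.ext (hinj hab))).symm
  have hTμ : ∀ i, riemannianVolume (pullbackMetric p g) (T i) =
      riemannianVolume (pullbackMetric p g) V := fun i =>
    riemannianVolume_image_homeomorph hh (hp.contMDiff_deck (hγp _))
      (hp.pullbackMetric_deck g (hγp _)) hV.measurableSet fun x hx => hx.1.2
  have hTtop : riemannianVolume (pullbackMetric p g) (⋃ i, T i) = ⊤ := by
    rw [measure_iUnion hTd hTm, tsum_congr hTμ]
    exact ENNReal.tsum_const_eq_top_of_ne_zero (riemannianVolume_pos hh hV ⟨x₁, hxV⟩)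
  have hle := setLIntegral_mono (μ := riemannianVolume (pullbackMetric p g)) (s := ⋃ i, T i)
    (f := fun _ => ‖Real.exp (F x₁ - 1)‖ₑ ^ 2) (g := fun x => ‖Real.exp (F x)‖ₑ ^ 2)
    (by fun_prop) (by
      rintro x hx
      obtain ⟨i, a, ha, rfl⟩ := mem_iUnion.1 hx
      have h1 : F x₁ - 1 ≤ F (γ (e i).1 a) := by
        rw [hshift]
        have h2 : F x₁ - 1 < F a := ha.2
        have h3 : F x₁ ≤ F (e i).1 := (e i).2
        linarith
      gcongr
      rw [Real.enorm_of_nonneg (Real.exp_pos _).le, Real.enorm_of_nonneg (Real.exp_pos _).le]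
      exact ENNReal.ofReal_le_ofReal (Real.exp_le_exp.2 h1))
  rw [setLIntegral_const, hTtop, ENNReal.mul_top (by simp)] at hle
  exact top_le_iff.1 (hle.trans (setLIntegral_le_lintegral _ _))

theorem IsUniversalCovering.ae_eq_zero_of_locally_exp_primitive
    (hp : IsUniversalCovering (n := n) p) {m₀ : M} (hπ : Infinite (FundamentalGroup M m₀))
    (g : RiemannianMetricOn n M) {σ : N → Model n →L[ℝ] ℝ}
    (hσ : ∀ γ : N ≃ₜ N, (∀ z, p (γ z) = p z) → ∀ x (v : Model n),
      σ (γ x) (mfderiv (𝓡 n) (𝓡 n) γ x v) = σ x v) {r : N → ℝ}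
    (hr : ∀ x₀, ∃ U, IsOpen U ∧ x₀ ∈ U ∧
      ((∀ᵐ x ∂(riemannianVolume (pullbackMetric p g)), x ∈ U → r x = 0) ∨
      ∃ F : N → ℝ, (∀ x ∈ U, HasMFDerivAt (𝓡 n) 𝓘(ℝ, ℝ) F x (σ x)) ∧
        ∀ᵐ x ∂(riemannianVolume (pullbackMetric p g)), x ∈ U → r x = Real.exp (F x)))
    (hL2 : ∫⁻ x, ‖r x‖ₑ ^ 2 ∂(riemannianVolume (pullbackMetric p g)) ≠ ⊤) :
    ∀ᵐ x ∂(riemannianVolume (pullbackMetric p g)), r x = 0 := by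
  have := hp.simplyConnected
  refine (exists_primitive_or_ae_eq_zero (isRiemannian_pullbackMetric hp.isLocalDiffeomorph g)
    hr).resolve_right ?_
  rintro ⟨F, hF, hrF⟩
  refine hL2 ?_
  rw [← hp.lintegral_exp_primitive_eq_top hπ g hσ hF]
  refine lintegral_congr_ae ?_
  filter_upwards [hrF] with x hx
  rw [hx]

end Global

/-! ### Weak solutions of the twisted equation -/

section Covector

variable {E : Type*} [NormedAddCommGroup E] [NormedSpace ℝ E]

/-- An alternating `1`-form as a covector. -/
noncomputable def toCovector : (E [⋀^Fin 1]→L[ℝ] ℝ) ≃ₗᵢ[ℝ] (E →L[ℝ] ℝ) :=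
  (ContinuousAlternatingMap.ofSubsingletonLIE (𝕜 := ℝ) (E := E) (F := ℝ) (0 : Fin 1)).symm

theorem toCovector_apply (a : E [⋀^Fin 1]→L[ℝ] ℝ) (v : E) : toCovector a v = a fun _ => v := rfl

theorem fderiv_toCovector_symm {a : E → E [⋀^Fin 1]→L[ℝ] ℝ} {y : E}
    (ha : DifferentiableAt ℝ a y) (hd : extDeriv a y = 0) (u v : E) :
    fderiv ℝ (fun y => toCovector (a y)) y u v = fderiv ℝ (fun y => toCovector (a y)) y v u := by
  have h1 : HasFDerivAt (fun y => toCovector (a y))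
      ((toCovector (E := E)).toContinuousLinearEquiv.toContinuousLinearMap.comp (fderiv ℝ a y)) y :=
    (toCovector (E := E)).toContinuousLinearEquiv.toContinuousLinearMap.hasFDerivAt.comp y
      ha.hasFDerivAt
  rw [h1.fderiv]
  have h2 := congr_arg (fun A => A ![u, v]) hd
  simp only [extDeriv, ContinuousAlternatingMap.alternatizeUncurryFin_apply] at h2
  erw [Fin.sum_univ_two] at h2
  change fderiv ℝ a y u (fun _ => v) = fderiv ℝ a y v (fun _ => u)
  have h3 : (0 : Fin 2).removeNth ![u, v] = fun _ => v := by
    funext i; fin_cases i; rfl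
  have h4 : (1 : Fin 2).removeNth ![u, v] = fun _ => u := by
    funext i; fin_cases i; rfl
  rw [h3, h4] at h2
  simp at h2
  linarith

end Covector

section Weak

variable {n : ℕ} {M : Type*} [TopologicalSpace M] [ChartedSpace (Model n) M]
  [IsManifold (𝓡 n) ∞ M] {N : Type*} [TopologicalSpace N] [ChartedSpace (Model n) N]
  [IsManifold (𝓡 n) ∞ N] {p : N → M}

omit [IsManifold (𝓡 n) ∞ M] [IsManifold (𝓡 n) ∞ N] in
theorem IsUniversalCovering.pullback_deck (hp : IsUniversalCovering (n := n) p)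
    (θ : Form n M ℝ 1) {γ : N ≃ₜ N} (hγ : ∀ z, p (γ z) = p z) (x : N) (v : Model n) :
    (θ.pullback p (γ x) : Model n [⋀^Fin 1]→L[ℝ] ℝ) (fun _ => mfderiv (𝓡 n) (𝓡 n) γ x v) =
      (θ.pullback p x : Model n [⋀^Fin 1]→L[ℝ] ℝ) fun _ => v := by
  have h1 : ∀ m, m = p x → ∀ u : Model n, (θ m : Model n [⋀^Fin 1]→L[ℝ] ℝ) (fun _ => u) =
      (θ (p x) : Model n [⋀^Fin 1]→L[ℝ] ℝ) fun _ => u := by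
    rintro m rfl u; rfl
  refine (h1 _ (hγ x) _).trans ?_
  exact congr_arg (fun u : Model n => (θ (p x) : Model n [⋀^Fin 1]→L[ℝ] ℝ) fun _ => u)
    (hp.mfderiv_deck hγ x v)

omit [IsManifold (𝓡 n) ∞ M] in
theorem hasMFDerivAt_comp_extChartAt {τ : Form n N ℝ 1} {x₀ x : N}
    (hx : x ∈ (extChartAt (𝓡 n) x₀).source) {G : Model n → ℝ} {s : ℝ}
    (hG : HasFDerivAt G (s • toCovector (τ.inChart x₀ (extChartAt (𝓡 n) x₀ x)))
      (extChartAt (𝓡 n) x₀ x)) :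
    HasMFDerivAt (𝓡 n) 𝓘(ℝ, ℝ) (fun z => G (extChartAt (𝓡 n) x₀ z)) x
      (s • toCovector (E := Model n) (τ x)) := by
  have h1 := hG.hasMFDerivAt.comp x (mdifferentiableAt_extChartAt' hx).hasMFDerivAt
  refine h1.congr_mfderiv ?_
  refine ContinuousLinearMap.ext fun v => ?_
  have h2 : ∀ z, z = x → ∀ u : Model n, (τ z : Model n [⋀^Fin 1]→L[ℝ] ℝ) (fun _ => u) =
      (τ x : Model n [⋀^Fin 1]→L[ℝ] ℝ) fun _ => u := by
    rintro z rfl u; rfl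
  refine congr_arg (fun t : ℝ => s * t) ((h2 _ ((extChartAt (𝓡 n) x₀).left_inv hx) _).trans ?_)
  exact congr_arg (fun u : Model n => (τ x : Model n [⋀^Fin 1]→L[ℝ] ℝ) fun _ => u)
    (congr_arg (fun A : Model n →L[ℝ] Model n => A v) (mfderiv_extChartAt_symm_comp hx))

variable [ConnectedSpace M] [MeasurableSpace N] [BorelSpace N] [SecondCountableTopology N]

theorem IsUniversalCovering.ae_eq_zero_of_weak_solution
    (hp : IsUniversalCovering (n := n) p) {m₀ : M} (hπ : Infinite (FundamentalGroup M m₀))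
    (g : RiemannianMetricOn n M) {θ : Form n M ℝ 1} (hθ : θ.IsClosedForm) (s : ℝ) {r : N → ℝ}
    (hr : ∀ x₀, ∃ u : Model n → ℂ,
      (∀ y ∈ (extChartAt (𝓡 n) x₀).target, r ((extChartAt (𝓡 n) x₀).symm y) = ‖u y‖) ∧
      (∀ K ⊆ (extChartAt (𝓡 n) x₀).target, IsCompact K → IntegrableOn u K) ∧
      ∀ χ : Model n → ℝ, ContDiff ℝ ∞ χ → HasCompactSupport χ →
        tsupport χ ⊆ (extChartAt (𝓡 n) x₀).target → ∀ v : Model n,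
        ∫ y, (fderiv ℝ χ y v - s * (θ.pullback p).inChart x₀ y (fun _ => v) * χ y) • u y = 0)
    (hL2 : ∫⁻ x, ‖r x‖ₑ ^ 2 ∂(riemannianVolume (pullbackMetric p g)) ≠ ⊤) :
    ∀ᵐ x ∂(riemannianVolume (pullbackMetric p g)), r x = 0 := by
  have hh := isRiemannian_pullbackMetric hp.isLocalDiffeomorph g
  have hpc : ContMDiff (𝓡 n) (𝓡 n) ∞ p := hp.isLocalDiffeomorph.contMDiff
  refine hp.ae_eq_zero_of_locally_exp_primitive hπ g
    (σ := fun x => (-s) • toCovector (E := Model n) (θ.pullback p x)) ?_ (fun x₀ => ?_) hL2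
  · intro γ hγ x v
    exact congr_arg (fun t : ℝ => (-s) * t) (hp.pullback_deck θ hγ x v)
  obtain ⟨u, hru, hui, hweak⟩ := hr x₀
  obtain ⟨ε, hε, hball⟩ := Metric.isOpen_iff.1 (isOpen_extChartAt_target (I := 𝓡 n) x₀) _
    (mem_extChartAt_target x₀)
  have hlt : Metric.closedBall (extChartAt (𝓡 n) x₀ x₀) (ε / 2) ⊆
      Metric.ball (extChartAt (𝓡 n) x₀ x₀) ε := Metric.closedBall_subset_ball (by linarith)
  have hsm : ContDiffOn ℝ ∞ (fun y => toCovector ((θ.pullback p).inChart x₀ y))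
      (Metric.ball (extChartAt (𝓡 n) x₀ x₀) ε) :=
    (toCovector (E := Model n)).toContinuousLinearEquiv.contDiff.comp_contDiffOn
      ((hθ.1.pullback hpc x₀).mono hball)
  obtain ⟨G, hG⟩ := (convex_ball (extChartAt (𝓡 n) x₀ x₀) ε).exists_forall_hasFDerivAt_of_fderiv_symmetric
    Metric.isOpen_ball (hsm.differentiableOn (by simp)) (fun y hy v w => fderiv_toCovector_symm
      ((hθ.1.pullback hpc).differentiableAt_inChart (hball hy))
      (extDeriv_inChart_pullback_eq_zero hpc hθ (hball hy)) v w)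
  obtain ⟨C, hC⟩ := ae_eq_const_mul_exp_of_weak_solution (half_pos hε) Metric.isOpen_ball hlt
    (a := fun y => s • toCovector ((θ.pullback p).inChart x₀ y)) (G := fun y => s * G y) (w := u)
    (hsm.const_smul s) (fun y hy => (hG y hy).const_mul s)
    (hui _ (hlt.trans hball) (isCompact_closedBall _ _)) (fun χ hχ hχc hχs v => hweak χ hχ hχc
      (hχs.trans ((Metric.ball_subset_closedBall.trans hlt).trans hball)) v)
  have hsub : Metric.ball (extChartAt (𝓡 n) x₀ x₀) (ε / 2) ⊆ (extChartAt (𝓡 n) x₀).target :=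
    (Metric.ball_subset_closedBall.trans hlt).trans hball
  have himg : (extChartAt (𝓡 n) x₀).symm '' Metric.ball (extChartAt (𝓡 n) x₀ x₀) (ε / 2) =
      (extChartAt (𝓡 n) x₀).source ∩ extChartAt (𝓡 n) x₀ ⁻¹'
        Metric.ball (extChartAt (𝓡 n) x₀ x₀) (ε / 2) := by
    rw [← (extChartAt (𝓡 n) x₀).symm_image_eq_source_inter_preimage hsub]
  refine ⟨(extChartAt (𝓡 n) x₀).symm '' Metric.ball (extChartAt (𝓡 n) x₀ x₀) (ε / 2), ?_,
    ⟨_, Metric.mem_ball_self (half_pos hε), by simp⟩, ?_⟩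
  · rw [himg]
    exact (continuousOn_extChartAt x₀).isOpen_inter_preimage (isOpen_extChartAt_source x₀)
      Metric.isOpen_ball
  by_cases hC0 : C = 0
  · left
    refine ae_of_ae_chart hh x₀ hsub ?_
    filter_upwards [hC] with y hy hyB
    rw [hru y (hsub hyB), hy hyB, hC0]
    simp
  · right
    refine ⟨fun x => (-s) * G (extChartAt (𝓡 n) x₀ x) + Real.log ‖C‖, fun x hx => ?_, ?_⟩
    · rw [himg] at hx
      have h1 : HasFDerivAt (fun y => (-s) * G y + Real.log ‖C‖)
          ((-s) • toCovector ((θ.pullback p).inChart x₀ (extChartAt (𝓡 n) x₀ x)))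
          (extChartAt (𝓡 n) x₀ x) :=
        ((hG _ (hlt (Metric.ball_subset_closedBall hx.2))).const_mul (-s)).add_const _
      exact hasMFDerivAt_comp_extChartAt hx.1 h1
    · refine ae_of_ae_chart hh x₀ hsub ?_
      filter_upwards [hC] with y hy hyB
      rw [hru y (hsub hyB), hy hyB, (extChartAt (𝓡 n) x₀).right_inv (hsub hyB), Real.exp_add,
        Real.exp_log (norm_pos_iff.2 hC0), norm_mul, Complex.norm_real, Real.norm_eq_abs, Real.abs_exp,
        neg_mul, mul_comm]

end Weak

/-! ### Local consequences of square integrability -/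

theorem upperIntegral_eq_zero_of_ae {X : Type*} [MeasurableSpace X] {μ : Measure X}
    {f : X → ℝ≥0∞} (hf : ∀ᵐ x ∂μ, f x = 0) : upperIntegral μ f = 0 := by
  obtain ⟨Z, hZ, hZm, hZ0⟩ := exists_measurable_superset_of_null (ae_iff.1 hf)
  refine le_antisymm ?_ (by positivity)
  refine iInf_le_of_le (Z.indicator fun _ => ⊤) (iInf_le_of_le (measurable_const.indicator hZm)
    (iInf_le_of_le (fun x => ?_) ?_))
  · by_cases hx : x ∈ Z
    · simp [hx]
    · have : f x = 0 := by
        by_contra h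
        exact hx (hZ h)
      simp [this]
  · rw [lintegral_indicator hZm, setLIntegral_const, hZ0, mul_zero]

theorem lintegral_le_upperIntegral {X : Type*} [MeasurableSpace X] (μ : Measure X)
    (f : X → ℝ≥0∞) : ∫⁻ x, f x ∂μ ≤ upperIntegral μ f :=
  le_iInf fun _ => le_iInf fun _ => le_iInf fun h => lintegral_mono h

theorem sq_lintegral_mul_le {X : Type*} [MeasurableSpace X] {μ : Measure X}
    {f g : X → ℝ≥0∞} (hf : AEMeasurable f μ) (hg : AEMeasurable g μ) :
    (∫⁻ x, f x * g x ∂μ) ^ 2 ≤ (∫⁻ x, f x ^ 2 ∂μ) * ∫⁻ x, g x ^ 2 ∂μ := by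
  have h := ENNReal.lintegral_mul_le_Lp_mul_Lq μ Real.HolderConjugate.two_two hf hg
  simp only [ENNReal.rpow_two, Pi.mul_apply] at h
  refine (pow_le_pow_left' h 2).trans_eq ?_
  rw [mul_pow, ← ENNReal.rpow_two, ← ENNReal.rpow_two, ← ENNReal.rpow_mul, ← ENNReal.rpow_mul]
  norm_num

theorem enorm_integral_smul_sq_le {E : Type*} [MeasurableSpace E] {μ : Measure E} {K : Set E}
    {A : E → ℝ} (hA : AEStronglyMeasurable A (μ.restrict K))
    (hAK : ∀ y ∉ K, A y = 0) {f : E → ℂ} (hf : AEStronglyMeasurable f (μ.restrict K)) :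
    ‖∫ y, A y • f y ∂μ‖ₑ ^ 2 ≤ (∫⁻ y in K, ‖A y‖ₑ ^ 2 ∂μ) * ∫⁻ y in K, ‖f y‖ₑ ^ 2 ∂μ := by
  have h1 : ∫ y, A y • f y ∂μ = ∫ y in K, A y • f y ∂μ :=
    (setIntegral_eq_integral_of_forall_compl_eq_zero fun y hy => by rw [hAK y hy, zero_smul]).symm
  rw [h1]
  refine le_trans ?_ (sq_lintegral_mul_le hA.enorm hf.enorm)
  gcongr
  refine (enorm_integral_le_lintegral_enorm _).trans_eq ?_
  exact lintegral_congr fun y => enorm_smul _ _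

section Local

variable {n : ℕ} {N : Type*} [TopologicalSpace N] [ChartedSpace (Model n) N]
  [MeasurableSpace N] [BorelSpace N] {h : MetricTensor n N}

theorem integrableOn_of_lintegral_sq_lt_top {E : Type*} [TopologicalSpace E] [MeasurableSpace E]
    [OpensMeasurableSpace E] {μ : Measure E} [IsFiniteMeasureOnCompacts μ] {K : Set E}
    (hK : IsCompact K) {f : E → ℂ} (hf : AEStronglyMeasurable f (μ.restrict K))
    (h2 : ∫⁻ y in K, ‖f y‖ₑ ^ 2 ∂μ < ⊤) : IntegrableOn f K μ := by
  have : IsFiniteMeasure (μ.restrict K) := ⟨by simpa using hK.measure_lt_top⟩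
  have hm : MemLp f 2 (μ.restrict K) := by
    refine ⟨hf, ?_⟩
    rw [eLpNorm_lt_top_iff_lintegral_rpow_enorm_lt_top (by simp) (by simp)]
    simpa using h2
  exact hm.integrable (by norm_num)

omit [MeasurableSpace N] [BorelSpace N] in
/-- The values of a function are the coordinate expression of the corresponding `0`-form. -/
theorem inChart_zero_apply (w : Form n N ℂ 0) (x₀ : N) (y : Model n) :
    w.inChart x₀ y ![] = (w ((extChartAt (𝓡 n) x₀).symm y) : Model n [⋀^Fin 0]→L[ℝ] ℂ) ![] :=
  congr_arg (w ((extChartAt (𝓡 n) x₀).symm y) : Model n [⋀^Fin 0]→L[ℝ] ℂ) (Subsingleton.elim _ _)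

variable [IsManifold (𝓡 n) ∞ N] [SecondCountableTopology N]

theorem lintegral_inChart_le_l2Sq (hh : h.IsRiemannian) {k : ℕ} (w : Form n N ℂ k) (x₀ : N) :
    ∫⁻ y in (extChartAt (𝓡 n) x₀).target,
      density h x₀ y * altNormSq (chartMetric h x₀ y) (w.inChart x₀ y) ≤ w.l2Sq h := by
  refine le_iInf fun u => le_iInf fun hu => le_iInf fun hle => ?_
  refine le_trans ?_ (setLIntegral_le_lintegral (extChartAt (𝓡 n) x₀).source _)
  rw [setLIntegral_source hh x₀ hu]
  refine setLIntegral_mono' (measurableSet_target x₀) fun y hy => ?_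
  rw [← normSq_symm h w hy]
  gcongr
  exact hle _

omit [MeasurableSpace N] [BorelSpace N] [SecondCountableTopology N] in
theorem exists_density_ge (hh : h.IsRiemannian) {x₀ : N} {K : Set (Model n)}
    (hKt : K ⊆ (extChartAt (𝓡 n) x₀).target) (hK : IsCompact K) :
    ∃ c : ℝ≥0∞, c ≠ 0 ∧ c ≠ ⊤ ∧ ∀ y ∈ K, c ≤ density h x₀ y := by
  rcases K.eq_empty_or_nonempty with rfl | hne
  · exact ⟨1, by simp, by simp, by simp⟩
  obtain ⟨y, hy, hmin⟩ := hK.exists_isMinOn hne ((continuousOn_sqrt_det hh x₀).mono hKt)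
  exact ⟨density h x₀ y, density_ne_zero hh (hKt hy), ENNReal.ofReal_ne_top,
    fun z hz => ENNReal.ofReal_le_ofReal (hmin hz)⟩

theorem setLIntegral_altNormSq_le (hh : h.IsRiemannian) {x₀ : N} {K : Set (Model n)}
    (hKt : K ⊆ (extChartAt (𝓡 n) x₀).target) (hK : IsCompact K) :
    ∃ C : ℝ≥0∞, C ≠ ⊤ ∧ ∀ (k : ℕ) (w : Form n N ℂ k),
      ∫⁻ y in K, altNormSq (chartMetric h x₀ y) (w.inChart x₀ y) ≤ C * w.l2Sq h := by
  obtain ⟨c, hc0, hct, hc⟩ := exists_density_ge hh hKt hK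
  refine ⟨c⁻¹, ENNReal.inv_ne_top.2 hc0, fun k w => ?_⟩
  rw [← ENNReal.div_eq_inv_mul, ENNReal.le_div_iff_mul_le (Or.inl hc0) (Or.inl hct), mul_comm,
    ← lintegral_const_mul' _ _ hct]
  refine le_trans ?_ (lintegral_inChart_le_l2Sq hh w x₀)
  refine le_trans ?_ (lintegral_mono_set hKt)
  refine setLIntegral_mono' hK.measurableSet fun y hy => ?_
  gcongr
  exact hc y hy

theorem setLIntegral_zeroForm_le (hh : h.IsRiemannian) {x₀ : N} {K : Set (Model n)}
    (hKt : K ⊆ (extChartAt (𝓡 n) x₀).target) (hK : IsCompact K) :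
    ∃ C : ℝ≥0∞, C ≠ ⊤ ∧ ∀ w : Form n N ℂ 0,
      ∫⁻ y in K, ‖w.inChart x₀ y ![]‖ₑ ^ 2 ≤ C * w.l2Sq h := by
  obtain ⟨C, hC, hle⟩ := setLIntegral_altNormSq_le hh hKt hK
  refine ⟨C, hC, fun w => le_trans (setLIntegral_mono' hK.measurableSet fun y hy => ?_) (hle 0 w)⟩
  rw [(hh.chartMetric (hKt hy)).altNormSq_zero]

theorem setLIntegral_oneForm_le (hh : h.IsRiemannian) {x₀ : N} {K : Set (Model n)}
    (hKt : K ⊆ (extChartAt (𝓡 n) x₀).target) (hK : IsCompact K) (v : Model n) :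
    ∃ C : ℝ≥0∞, C ≠ ⊤ ∧ ∀ w : Form n N ℂ 1,
      ∫⁻ y in K, ‖w.inChart x₀ y (fun _ => v)‖ₑ ^ 2 ≤ C * w.l2Sq h := by
  obtain ⟨C, hC, hle⟩ := setLIntegral_altNormSq_le hh hKt hK
  obtain ⟨b, hb⟩ := hK.exists_bound_of_continuousOn ((hh.continuousOn_chartMetric x₀).comp
    (f := fun y => (y, v)) (by fun_prop) fun y hy => ⟨hKt hy, mem_univ _⟩)
  refine ⟨ENNReal.ofReal b * C, ENNReal.mul_ne_top ENNReal.ofReal_ne_top hC, fun w => ?_⟩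
  rw [mul_assoc]
  refine le_trans ?_ (mul_le_mul_right (hle 1 w) _)
  rw [← lintegral_const_mul' _ _ ENNReal.ofReal_ne_top]
  refine setLIntegral_mono' hK.measurableSet fun y hy => ?_
  refine ((hh.chartMetric (hKt hy)).enorm_apply_sq_le _ v).trans ?_
  gcongr
  exact (le_abs_self _).trans (hb y hy)

end Local

/-! ### Degree zero -/

section DegreeZero

variable {n : ℕ} {N : Type*} [TopologicalSpace N] [ChartedSpace (Model n) N]
  [IsManifold (𝓡 n) ∞ N]

theorem inChart_twistedD_zeroForm (τ : Form n N ℝ 1) {w : Form n N ℂ 0} (hw : w.Smooth) {x₀ : N}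
    {y : Model n} (hy : y ∈ (extChartAt (𝓡 n) x₀).target) (v : Model n) :
    (Form.twistedD τ w).inChart x₀ y (fun _ => v) =
      fderiv ℝ (fun y => w.inChart x₀ y ![]) y v + τ.inChart x₀ y (fun _ => v) • w.inChart x₀ y ![] := by
  have h1 : HasFDerivAt (fun y => w.inChart x₀ y ![])
      ((ContinuousAlternatingMap.apply ℝ (Model n) ℂ ![]).comp (fderiv ℝ (w.inChart x₀) y)) y :=
    (ContinuousAlternatingMap.apply ℝ (Model n) ℂ ![]).hasFDerivAt.comp y
      (hw.differentiableAt_inChart hy).hasFDerivAt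
  rw [inChart_twistedD τ hw hy, h1.fderiv, ContinuousAlternatingMap.add_apply, extMul_apply,
    extDeriv, ContinuousAlternatingMap.alternatizeUncurryFin_apply]
  have h2 : (0 : Fin 1).removeNth (fun _ : Fin 1 => v) = ![] := Subsingleton.elim _ _
  erw [Fin.sum_univ_one, Fin.sum_univ_one]
  rw [h2]
  simp

variable [MeasurableSpace N] [BorelSpace N] [SecondCountableTopology N] {h : MetricTensor n N}

theorem integral_cocycle_eq_zero (hh : h.IsRiemannian) {τ : Form n N ℝ 1} (hτ : τ.Smooth)
    {w : Form n N ℂ 0} (hw : w ∈ cocycles h τ 0) {x₀ : N} {χ : Model n → ℝ} (hχ : ContDiff ℝ ∞ χ)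
    (hχc : HasCompactSupport χ) (hχt : tsupport χ ⊆ (extChartAt (𝓡 n) x₀).target) (v : Model n) :
    ∫ y, (fderiv ℝ χ y v - τ.inChart x₀ y (fun _ => v) * χ y) • w.inChart x₀ y ![] = 0 := by
  have hwL : w.MemL2 h := hw.1
  have happ : ∀ ε > (0 : ℝ≥0∞), ∃ ζ ∈ smoothCore h τ 0,
    (w - ζ).l2Sq h < ε ∧ (0 - Form.twistedD τ ζ).l2Sq h < ε := hw.2.2
  set K := tsupport χ with hK
  have hKc : IsCompact K := hχc
  have hKm : MeasurableSet K := hKc.measurableSet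
  set A : Model n → ℝ := fun y => fderiv ℝ χ y v - τ.inChart x₀ y (fun _ => v) * χ y with hA
  have hτc : ContinuousOn (fun y => τ.inChart x₀ y fun _ => v) K :=
    (ContinuousAlternatingMap.apply ℝ (Model n) ℝ (fun _ => v)).continuous.comp_continuousOn
      ((hτ x₀).continuousOn.mono hχt)
  have hDχ : Continuous fun y => fderiv ℝ χ y v := (hχ.continuous_fderiv (by simp)).clm_apply
    continuous_const
  have hAc : ContinuousOn A K := hDχ.continuousOn.sub (hτc.mul hχ.continuous.continuousOn)
  have hχ0 : ∀ y ∉ K, χ y = 0 := fun y hy => image_eq_zero_of_notMem_tsupport hy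
  have hDχ0 : ∀ y ∉ K, fderiv ℝ χ y v = 0 := fun y hy => by
    rw [image_eq_zero_of_notMem_tsupport fun hy' => hy (tsupport_fderiv_subset ℝ hy')]
    rfl
  have hA0 : ∀ y ∉ K, A y = 0 := fun y hy => by simp [hA, hχ0 y hy, hDχ0 y hy]
  have hint : ∀ {B : Model n → ℝ} {f : Model n → ℂ}, ContinuousOn B K → (∀ y ∉ K, B y = 0) →
      IntegrableOn f K → Integrable fun y => B y • f y := by
    intro B f hB hB0 hf
    refine (integrableOn_iff_integrable_of_support_subset fun y hy => ?_).1
      (hf.continuousOn_smul hB hKc)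
    by_contra hyK
    exact hy (by simp [hB0 y hyK])
  obtain ⟨C₀, hC₀, hle₀⟩ := setLIntegral_zeroForm_le hh hχt hKc
  obtain ⟨C₁, hC₁, hle₁⟩ := setLIntegral_oneForm_le hh hχt hKc v
  have hmeas : ∀ {k : ℕ} {ζ : Form n N ℂ k} (u : Fin k → Model n), ζ.MemL2 h →
      AEStronglyMeasurable (fun y => ζ.inChart x₀ y u) (volume.restrict K) := fun {k ζ} u hζ =>
    ((ContinuousAlternatingMap.apply ℝ (Model n) ℂ u).continuous.comp_aestronglyMeasurable
      (hζ.1 x₀)).mono_measure (Measure.restrict_mono hχt le_rfl)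
  have hfin : ∀ {B : Model n → ℝ}, ContinuousOn B K → ∫⁻ y in K, ‖B y‖ₑ ^ 2 ≠ ⊤ := by
    intro B hB
    obtain ⟨b, hb⟩ := hKc.exists_bound_of_continuousOn hB
    refine ((setLIntegral_mono' (g := fun _ => ENNReal.ofReal b ^ 2) hKm fun y hy => ?_).trans_lt
      ?_).ne
    · gcongr
      rw [← ofReal_norm]
      exact ENNReal.ofReal_le_ofReal (hb y hy)
    · rw [setLIntegral_const]
      exact ENNReal.mul_lt_top (by simp) hKc.measure_lt_top
  have hcore : ∀ ζ ∈ smoothCore h τ 0, ∫ y, A y • w.inChart x₀ y ![] =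
      (∫ y, A y • (w - ζ).inChart x₀ y ![]) +
        ∫ y, χ y • (0 - Form.twistedD τ ζ).inChart x₀ y fun _ => v := by
    rintro ζ ⟨hζ, hζL, hdζL⟩
    have hζd : ∀ y ∈ K, DifferentiableAt ℝ (fun y => ζ.inChart x₀ y ![]) y := fun y hy =>
      (ContinuousAlternatingMap.apply ℝ (Model n) ℂ ![]).differentiableAt.comp y
        (hζ.differentiableAt_inChart (hχt hy))
    have hζs : ContDiffOn ℝ ∞ (fun y => ζ.inChart x₀ y ![]) (extChartAt (𝓡 n) x₀).target :=
      (ContinuousAlternatingMap.apply ℝ (Model n) ℂ ![]).contDiff.comp_contDiffOn (hζ x₀)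
    have hζc : IntegrableOn (fun y => ζ.inChart x₀ y ![]) K :=
      (hζs.continuousOn.mono hχt).integrableOn_compact hKc
    have hDζc : IntegrableOn (fun y => fderiv ℝ (fun y => ζ.inChart x₀ y ![]) y v) K :=
      (((hζs.continuousOn_fderiv_of_isOpen (isOpen_extChartAt_target x₀) (by simp)).mono
        hχt).clm_apply continuousOn_const).integrableOn_compact hKc
    have i1 := hint hAc hA0 hζc
    have i2 := hint hDχ.continuousOn hDχ0 hζc
    have i3 := hint hχ.continuous.continuousOn hχ0 hDζc
    have i4 := hint hχ.continuous.continuousOn hχ0 hζc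
    have i23 : Integrable fun y => fderiv ℝ χ y v • ζ.inChart x₀ y ![] +
      χ y • fderiv ℝ (fun y => ζ.inChart x₀ y ![]) y v := i2.add i3
    have ibp := integral_smul_fderiv_eq_neg_fderiv_smul_of_integrable (μ := volume) (𝕜 := ℝ)
      (f := χ) (g := fun y => ζ.inChart x₀ y ![]) (v := v) i2 i3 i4
      (fun y _ => hχ.differentiable (by simp) y) hζd
    have e1 : ∀ y, χ y • (0 - Form.twistedD τ ζ).inChart x₀ y (fun _ => v) =
        A y • ζ.inChart x₀ y ![] - (fderiv ℝ χ y v • ζ.inChart x₀ y ![] +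
          χ y • fderiv ℝ (fun y => ζ.inChart x₀ y ![]) y v) := fun y => by
      by_cases hy : y ∈ K
      · have e2 : (0 - Form.twistedD τ ζ).inChart x₀ y (fun _ => v) =
            0 - (Form.twistedD τ ζ).inChart x₀ y (fun _ => v) := rfl
        rw [e2, inChart_twistedD_zeroForm τ hζ (hχt hy)]
        simp only [hA, Complex.real_smul]
        push_cast
        ring
      · rw [hχ0 y hy, hDχ0 y hy, hA0 y hy]
        simp
    have e3 : ∀ y, A y • (w - ζ).inChart x₀ y ![] =
        A y • w.inChart x₀ y ![] - A y • ζ.inChart x₀ y ![] := fun y => smul_sub _ _ _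
    simp only [e1, e3]
    rw [integral_sub (hint hAc hA0 (integrableOn_of_lintegral_sq_lt_top hKc (hmeas _ hwL)
      ((hle₀ w).trans_lt (ENNReal.mul_lt_top hC₀.lt_top hwL.2)))) i1,
      integral_sub i1 i23, integral_add i2 i3, ibp]
    abel
  set I := ∫ y, A y • w.inChart x₀ y ![] with hI
  suffices hsmall : ∀ ε > (0 : ℝ≥0∞), ‖I‖ₑ ^ 2 ≤ ε by
    have h0 : ‖I‖ₑ ^ 2 = 0 := by
      by_contra hne
      obtain ⟨ε, hε, hlt⟩ := exists_between (pos_iff_ne_zero.2 hne)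
      exact absurd (hsmall ε hε) (not_le.2 hlt)
    simpa using h0
  intro ε hε
  obtain ⟨δ, hδ, hδε⟩ := exists_small (2 * ((∫⁻ y in K, ‖A y‖ₑ ^ 2) * C₀) +
    2 * ((∫⁻ y in K, ‖χ y‖ₑ ^ 2) * C₁)) ε (ENNReal.add_ne_top.2
      ⟨ENNReal.mul_ne_top (by simp) (ENNReal.mul_ne_top (hfin hAc) hC₀),
        ENNReal.mul_ne_top (by simp)
          (ENNReal.mul_ne_top (hfin hχ.continuous.continuousOn) hC₁)⟩) hε
  obtain ⟨ζ, hζ, h1, h2⟩ := happ δ hδ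
  rw [hcore ζ hζ]
  refine (enorm_add_sq_le _ _).trans (le_trans ?_ hδε)
  have hw' : (w - ζ).MemL2 h := by
    simpa [sub_eq_add_neg] using memL2_add hwL (memL2_smul (-1 : ℂ) hζ.2.1)
  have hd' : (0 - Form.twistedD τ ζ).MemL2 h := by
    simpa [sub_eq_add_neg] using memL2_smul (-1 : ℂ) hζ.2.2
  rw [add_mul, mul_assoc, mul_assoc, mul_assoc, mul_assoc]
  gcongr
  · refine (enorm_integral_smul_sq_le (hAc.aestronglyMeasurable hKm) hA0 (hmeas _ hw')).trans ?_
    gcongr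
    exact (hle₀ _).trans (by gcongr)
  · refine (enorm_integral_smul_sq_le (hχ.continuous.continuousOn.aestronglyMeasurable hKm) hχ0
      (hmeas _ hd')).trans ?_
    gcongr
    exact (hle₁ _).trans (by gcongr)

variable {M : Type*} [TopologicalSpace M] [ChartedSpace (Model n) M] [IsManifold (𝓡 n) ∞ M]
  [ConnectedSpace M] {p : N → M}

theorem IsUniversalCovering.l2Sq_cocycle_zero (hp : IsUniversalCovering (n := n) p) {m₀ : M}
    (hπ : Infinite (FundamentalGroup M m₀)) (g : RiemannianMetricOn n M) {θ : Form n M ℝ 1}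
    (hθ : θ.IsClosedForm) {w : Form n N ℂ 0}
    (hw : w ∈ cocycles (pullbackMetric p g) (θ.pullback p) 0) :
    w.l2Sq (pullbackMetric p g) = 0 := by
  have hh := isRiemannian_pullbackMetric hp.isLocalDiffeomorph g
  have hpc : ContMDiff (𝓡 n) (𝓡 n) ∞ p := hp.isLocalDiffeomorph.contMDiff
  have hns : ∀ x, w.normSq (pullbackMetric p g) x =
      ‖(w x : Model n [⋀^Fin 0]→L[ℝ] ℂ) ![]‖ₑ ^ 2 := fun x => by
    have hx := (extChartAt (𝓡 n) x).map_source (mem_extChartAt_source x)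
    have h1 := normSq_symm (pullbackMetric p g) w hx
    rw [(hh.chartMetric hx).altNormSq_zero, inChart_zero_apply] at h1
    have h2 : ∀ z, z = x → w.normSq (pullbackMetric p g) z =
        ‖(w z : Model n [⋀^Fin 0]→L[ℝ] ℂ) ![]‖ₑ ^ 2 → w.normSq (pullbackMetric p g) x =
        ‖(w x : Model n [⋀^Fin 0]→L[ℝ] ℂ) ![]‖ₑ ^ 2 := by rintro z rfl hz; exact hz
    exact h2 _ (extChartAt_to_inv x) h1
  have h0 := hp.ae_eq_zero_of_weak_solution hπ g hθ 1
    (r := fun x => ‖(w x : Model n [⋀^Fin 0]→L[ℝ] ℂ) ![]‖) (fun x₀ => ?_) ?_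
  · refine upperIntegral_eq_zero_of_ae ?_
    filter_upwards [h0] with x hx
    rw [hns x]
    simpa using hx
  · refine ⟨fun y => w.inChart x₀ y ![], fun y _ => congr_arg norm (inChart_zero_apply w x₀ y).symm,
      fun K hKt hK => ?_,
      fun χ hχ hχc hχt v => ?_⟩
    · obtain ⟨C, hC, hle⟩ := setLIntegral_zeroForm_le hh hKt hK
      refine integrableOn_of_lintegral_sq_lt_top hK
        (((ContinuousAlternatingMap.apply ℝ (Model n) ℂ ![]).continuous.comp_aestronglyMeasurable
          (hw.1.1 x₀)).mono_measure (Measure.restrict_mono hKt le_rfl))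
        ((hle w).trans_lt (ENNReal.mul_lt_top hC.lt_top hw.1.2))
    · simpa only [one_mul] using integral_cocycle_eq_zero hh (hθ.1.pullback hpc) hw hχ hχc hχt v
  · refine ne_of_eq_of_ne (lintegral_congr fun x => ?_)
      ((lintegral_le_upperIntegral _ _).trans_lt hw.1.2).ne
    simp [hns x]

end DegreeZero

/-! ### Forms of top degree as functions -/

theorem upperIntegral_eq_lintegral₀ {X : Type*} [MeasurableSpace X] {μ : Measure X}
    {f : X → ℝ≥0∞} (hf : AEMeasurable f μ) : upperIntegral μ f = ∫⁻ x, f x ∂μ := by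
  refine le_antisymm ?_ (lintegral_le_upperIntegral μ f)
  obtain ⟨Z, hZ, hZm, hZ0⟩ := exists_measurable_superset_of_null (ae_iff.1 hf.ae_eq_mk)
  refine iInf_le_of_le (fun x => hf.mk f x + Z.indicator (fun _ => ⊤) x) (iInf_le_of_le
    (hf.measurable_mk.add (measurable_const.indicator hZm)) (iInf_le_of_le (fun x => ?_) ?_))
  · by_cases hx : x ∈ Z
    · simp [hx]
    · have : f x = hf.mk f x := by
        by_contra h
        exact hx (hZ h)
      simp [hx, this]
  · rw [lintegral_add_left hf.measurable_mk, lintegral_indicator hZm, setLIntegral_const, hZ0,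
      mul_zero, add_zero, lintegral_congr_ae hf.ae_eq_mk]

section Top

variable {n : ℕ} {N : Type*} [TopologicalSpace N] [ChartedSpace (Model n) N]
  [IsManifold (𝓡 n) ∞ N] {h : MetricTensor n N}

/-- Evaluation of forms of top degree on the normalised coordinate frame of a chart. -/
noncomputable def evalFrame (h : MetricTensor n N) (x₀ z : N) :
    (Model n [⋀^Fin n]→L[ℝ] ℂ) →ₗ[ℂ] ℂ where
  toFun α := (Real.sqrt (gram h x₀ (extChartAt (𝓡 n) x₀ z)).det)⁻¹ •
    α fun i => mfderiv 𝓘(ℝ, Model n) (𝓡 n) (extChartAt (𝓡 n) x₀).symm (extChartAt (𝓡 n) x₀ z)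
      (stdVec i)
  map_add' _ _ := smul_add _ _ _
  map_smul' _ _ := smul_comm _ _ _

omit [IsManifold (𝓡 n) ∞ N] in
theorem evalFrame_apply {x₀ z : N} (hz : z ∈ (extChartAt (𝓡 n) x₀).source) (w : Form n N ℂ n) :
    evalFrame h x₀ z (w z) = (Real.sqrt (gram h x₀ (extChartAt (𝓡 n) x₀ z)).det)⁻¹ •
      w.inChart x₀ (extChartAt (𝓡 n) x₀ z) stdVec := by
  have h1 : ∀ z', z' = z → ∀ u : Fin n → Model n, (w z : Model n [⋀^Fin n]→L[ℝ] ℂ) u =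
      (w z' : Model n [⋀^Fin n]→L[ℝ] ℂ) u := by rintro z' rfl u; rfl
  exact congr_arg (fun t : ℂ => (Real.sqrt (gram h x₀ (extChartAt (𝓡 n) x₀ z)).det)⁻¹ • t)
    (h1 _ ((extChartAt (𝓡 n) x₀).left_inv hz) _)

theorem enorm_evalFrame_sq (hh : h.IsRiemannian) {x₀ z : N}
    (hz : z ∈ (extChartAt (𝓡 n) x₀).source) (w : Form n N ℂ n) :
    ‖evalFrame h x₀ z (w z)‖ₑ ^ 2 = w.normSq h z := by
  have hy := (extChartAt (𝓡 n) x₀).map_source hz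
  have h1 : ∀ z', z' = z → w.normSq h z = w.normSq h z' := by rintro z' rfl; rfl
  have hd := det_gram_pos hh hy
  rw [evalFrame_apply hz, enorm_smul, mul_pow, (hh.chartMetric hy).altNormSq_top,
    ← normSq_symm h w hy, stdGram_chartMetric, ← h1 _ ((extChartAt (𝓡 n) x₀).left_inv hz),
    ← mul_assoc, Real.enorm_of_nonneg (by positivity), ← ENNReal.ofReal_pow (by positivity),
    ← ENNReal.ofReal_mul (by positivity), inv_pow, Real.sq_sqrt hd.le, inv_mul_cancel₀ hd.ne',
    ENNReal.ofReal_one, one_mul]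

variable [MeasurableSpace N] [BorelSpace N] [SecondCountableTopology N]

theorem aestronglyMeasurable_comp_extChartAt (hh : h.IsRiemannian) (x₀ : N) {f : Model n → ℂ}
    (hf : AEStronglyMeasurable f (volume.restrict (extChartAt (𝓡 n) x₀).target)) :
    AEStronglyMeasurable (fun z => f (extChartAt (𝓡 n) x₀ z))
      ((riemannianVolume h).restrict (extChartAt (𝓡 n) x₀).source) := by
  have hφ : AEMeasurable (extChartAt (𝓡 n) x₀)
      ((riemannianVolume h).restrict (extChartAt (𝓡 n) x₀).source) :=
    (continuousOn_extChartAt x₀).aemeasurable (measurableSet_source x₀)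
  refine (hf.stronglyMeasurable_mk.aestronglyMeasurable.comp_aemeasurable hφ).congr ?_
  have h1 := ae_of_ae_chart hh x₀ (W := (extChartAt (𝓡 n) x₀).target) subset_rfl
    (P := fun z => f (extChartAt (𝓡 n) x₀ z) = hf.mk f (extChartAt (𝓡 n) x₀ z)) (by
      have h2 := (ae_restrict_iff' (measurableSet_target x₀)).1 hf.ae_eq_mk
      filter_upwards [h2] with y hy hyt
      rw [(extChartAt (𝓡 n) x₀).right_inv hyt, hy hyt])
  rw [(extChartAt (𝓡 n) x₀).symm_image_target_eq_source] at h1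
  filter_upwards [(ae_restrict_iff' (measurableSet_source x₀)).2 h1] with z hz
  exact hz.symm

/-- A measurable trivialization of the bundle of forms of top degree, isometric at each point. -/
theorem exists_isometric_trivialization (hh : h.IsRiemannian) :
    ∃ T : ∀ _ : N, (Model n [⋀^Fin n]→L[ℝ] ℂ) →ₗ[ℂ] ℂ,
      (∀ (w : Form n N ℂ n) z, ‖T z (w z)‖ₑ ^ 2 = w.normSq h z) ∧
      ∀ w : Form n N ℂ n, (∀ x₀, AEStronglyMeasurable (w.inChart x₀)
        (volume.restrict (extChartAt (𝓡 n) x₀).target)) →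
        AEStronglyMeasurable (fun z => T z (w z)) (riemannianVolume h) := by
  rcases isEmpty_or_nonempty N with hN | hN
  · exact ⟨fun _ => 0, fun _ z => isEmptyElim z, fun w _ => by
      have : riemannianVolume h = 0 := Measure.eq_zero_of_isEmpty _
      rw [this]; exact aestronglyMeasurable_zero_measure _⟩
  obtain ⟨x, hx⟩ := exists_countable_charts (n := n) (N := N)
  let P : ℕ → Set N := disjointed fun i => (extChartAt (𝓡 n) (x i)).source
  have hPm : ∀ i, MeasurableSet (P i) := .disjointed fun i => measurableSet_source (x i)
  have hPd : Pairwise (Function.onFun Disjoint P) := disjoint_disjointed _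
  have hPs : ∀ i, P i ⊆ (extChartAt (𝓡 n) (x i)).source := fun i => disjointed_subset _ i
  have hPU : ⋃ i, P i = univ := by rw [iUnion_disjointed, hx]
  have hJ : ∀ z, ∃ i, z ∈ P i := fun z => mem_iUnion.1 (hPU ▸ mem_univ z)
  choose J hJ using hJ
  have hJu : ∀ {z i}, z ∈ P i → J z = i := fun {z i} hz => by
    by_contra hne
    exact disjoint_left.1 (hPd hne) (hJ z) hz
  refine ⟨fun z => evalFrame h (x (J z)) z, fun w z => enorm_evalFrame_sq hh (hPs _ (hJ z)) w,
    fun w hw => ?_⟩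
  rw [← Measure.restrict_univ (μ := riemannianVolume h), ← hPU, aestronglyMeasurable_iUnion_iff]
  intro i
  have h1 : AEStronglyMeasurable (fun y => (Real.sqrt (gram h (x i) y).det)⁻¹ •
      w.inChart (x i) y stdVec) (volume.restrict (extChartAt (𝓡 n) (x i)).target) :=
    (((continuousOn_sqrt_det hh (x i)).aemeasurable
      (measurableSet_target (x i))).inv.aestronglyMeasurable).smul
      ((ContinuousAlternatingMap.apply ℝ (Model n) ℂ stdVec).continuous.comp_aestronglyMeasurable
        (hw (x i)))
  refine ((aestronglyMeasurable_comp_extChartAt hh (x i) h1).mono_measure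
    (Measure.restrict_mono (hPs i) le_rfl)).congr ?_
  filter_upwards [ae_restrict_mem (hPm i)] with z hz
  rw [hJu hz, evalFrame_apply (hPs i hz)]

end Top

/-! ### Compactly supported forms in a chart -/

section ChartForm

variable {n : ℕ} {N : Type*} [TopologicalSpace N] [ChartedSpace (Model n) N]
  {F : Type*} [NormedAddCommGroup F] [NormedSpace ℝ F] {k : ℕ}

open Classical in
/-- The form with a given expression in a chart, extended by zero. -/
noncomputable def chartForm (x₀ : N) (f : Model n → Model n [⋀^Fin k]→L[ℝ] F) : Form n N F k :=
  fun z => if z ∈ (extChartAt (𝓡 n) x₀).source then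
    (f (extChartAt (𝓡 n) x₀ z)).compContinuousLinearMap
      (mfderiv (𝓡 n) 𝓘(ℝ, Model n) (extChartAt (𝓡 n) x₀) z) else 0

theorem chartForm_eq_zero {x₀ : N} {f : Model n → Model n [⋀^Fin k]→L[ℝ] F} {K : Set (Model n)}
    (hf : ∀ y ∉ K, f y = 0) {z : N} (hz : z ∉ (extChartAt (𝓡 n) x₀).symm '' K) :
    chartForm x₀ f z = 0 := by
  by_cases h : z ∈ (extChartAt (𝓡 n) x₀).source
  · rw [chartForm, if_pos h, hf _ fun hK => hz ⟨_, hK, (extChartAt (𝓡 n) x₀).left_inv h⟩]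
    rfl
  · rw [chartForm, if_neg h]

/-- If a form vanishes near a point, so does its twisted differential. -/
theorem twistedD_eq_zero_of_eventuallyEq (τ : Form n N ℝ 1) {w : Form n N F k} {z : N}
    (hw : ∀ᶠ x in 𝓝 z, w x = 0) : Form.twistedD τ w z = 0 := by
  have h1 : w.inChart z =ᶠ[𝓝 (extChartAt (𝓡 n) z z)] fun _ => 0 := by
    have hc := (continuousAt_extChartAt_symm (I := 𝓡 n) z)
    rw [ContinuousAt, extChartAt_to_inv] at hc
    filter_upwards [hc.eventually hw] with y hy
    rw [Form.inChart, hy]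
    rfl
  have h2 : w.d z = 0 := by
    rw [Form.d, extDeriv, h1.fderiv_eq]
    refine ContinuousAlternatingMap.ext fun v => ?_
    change ContinuousAlternatingMap.alternatizeUncurryFin
      (fderiv ℝ (fun _ : Model n => (0 : Model n [⋀^Fin k]→L[ℝ] F)) _) _ = 0
    rw [ContinuousAlternatingMap.alternatizeUncurryFin_apply]
    simp
  have h3 : Form.e τ w z = 0 := by
    refine ContinuousAlternatingMap.ext fun v => ?_
    refine (extMul_apply (E := Model n) (τ z) (w z) v).trans ?_
    rw [hw.self_of_nhds]
    exact Finset.sum_eq_zero fun i _ => by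
      change _ • _ • (0 : F) = 0
      simp
  rw [Form.twistedD, Pi.add_apply, h2, h3, add_zero]

variable [IsManifold (𝓡 n) ∞ N]

theorem inChart_chartForm {x₀ : N} (f : Model n → Model n [⋀^Fin k]→L[ℝ] F) {y : Model n}
    (hy : y ∈ (extChartAt (𝓡 n) x₀).target) : (chartForm x₀ f).inChart x₀ y = f y := by
  rw [Form.inChart, chartForm, if_pos ((extChartAt (𝓡 n) x₀).map_target hy)]
  refine ContinuousAlternatingMap.ext fun v => ?_
  have h1 : ∀ y', y' = y → ∀ u, f y' u = f y u := by rintro y' rfl u; rfl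
  refine (h1 _ ((extChartAt (𝓡 n) x₀).right_inv hy) _).trans ?_
  refine congr_arg (f y) (funext fun i => ?_)
  exact congr_arg (fun A : Model n →L[ℝ] Model n => A (v i)) (mfderiv_extChartAt_comp_symm hy)

omit [IsManifold (𝓡 n) ∞ N] in
theorem isCompact_symm_image {x₀ : N} {K : Set (Model n)} (hK : IsCompact K)
    (hKt : K ⊆ (extChartAt (𝓡 n) x₀).target) : IsCompact ((extChartAt (𝓡 n) x₀).symm '' K) :=
  hK.image_of_continuousOn ((continuousOn_extChartAt_symm x₀).mono hKt)

theorem smooth_chartForm [T2Space N] {x₀ : N} {f : Model n → Model n [⋀^Fin k]→L[ℝ] F}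
    (hf : ContDiffOn ℝ ∞ f (extChartAt (𝓡 n) x₀).target) {K : Set (Model n)} (hK : IsCompact K)
    (hKt : K ⊆ (extChartAt (𝓡 n) x₀).target) (hf0 : ∀ y ∉ K, f y = 0) :
    (chartForm x₀ f).Smooth := by
  intro x₁
  have h1 : ContDiffOn ℝ ∞ ((chartForm x₀ f).inChart x₁) (coordDom id x₁ x₀) := by
    have := contDiffOn_inChart_pullback (n := n) (x₀ := x₁) contMDiff_id (chartForm x₀ f)
      (hf.congr fun y hy => inChart_chartForm f hy)
    rw [pullback_id] at this
    exact this.mono fun y hy => ⟨hy, coordMap_mem_target hy⟩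
  intro y hy
  by_cases hyK : (extChartAt (𝓡 n) x₁).symm y ∈ (extChartAt (𝓡 n) x₀).symm '' K
  · have hyd : y ∈ coordDom id x₁ x₀ := by
      obtain ⟨z, hz, hzy⟩ := hyK
      refine ⟨hy, ?_⟩
      rw [mem_preimage, mem_preimage, id, ← hzy]
      exact (extChartAt (𝓡 n) x₀).map_target (hKt hz)
    exact (h1.contDiffAt ((isOpen_coordDom continuous_id x₁ x₀).mem_nhds hyd)).contDiffWithinAt
  · have ho : IsOpen ((extChartAt (𝓡 n) x₁).target ∩ (extChartAt (𝓡 n) x₁).symm ⁻¹'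
        ((extChartAt (𝓡 n) x₀).symm '' K)ᶜ) :=
      (continuousOn_extChartAt_symm x₁).isOpen_inter_preimage (isOpen_extChartAt_target x₁)
        (isCompact_symm_image hK hKt).isClosed.isOpen_compl
    have h2 : (chartForm x₀ f).inChart x₁ =ᶠ[𝓝 y] fun _ => 0 := by
      filter_upwards [ho.mem_nhds ⟨hy, hyK⟩] with z hz
      rw [Form.inChart, chartForm_eq_zero hf0 hz.2]
      rfl
    exact (contDiffAt_const.congr_of_eventuallyEq h2).contDiffWithinAt

variable [MeasurableSpace N] [BorelSpace N] [SecondCountableTopology N] {h : MetricTensor n N}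

theorem riemannianVolume_symm_image_lt_top [T2Space N] (hh : h.IsRiemannian) {x₀ : N}
    {K : Set (Model n)} (hK : IsCompact K) (hKt : K ⊆ (extChartAt (𝓡 n) x₀).target) :
    riemannianVolume h ((extChartAt (𝓡 n) x₀).symm '' K) < ⊤ := by
  have hm : MeasurableSet ((extChartAt (𝓡 n) x₀).symm '' K) :=
    (isCompact_symm_image hK hKt).measurableSet
  have hs : (extChartAt (𝓡 n) x₀).symm '' K ⊆ (extChartAt (𝓡 n) x₀).source := by
    rintro _ ⟨y, hy, rfl⟩
    exact (extChartAt (𝓡 n) x₀).map_target (hKt hy)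
  rw [riemannianVolume_eq_chartVolume hh hm hs, chartVolume_apply hh x₀ hm]
  have hsub : (extChartAt (𝓡 n) x₀).target ∩ (extChartAt (𝓡 n) x₀).symm ⁻¹'
      ((extChartAt (𝓡 n) x₀).symm '' K) ⊆ K := by
    rintro y ⟨hy, z, hz, hzy⟩
    rwa [← (extChartAt (𝓡 n) x₀).symm.injOn (hKt hz) hy hzy]
  obtain ⟨b, hb⟩ := hK.exists_bound_of_continuousOn ((continuousOn_sqrt_det hh x₀).mono hKt)
  refine (lintegral_mono_set hsub).trans_lt ?_
  refine (setLIntegral_mono' (g := fun _ => ENNReal.ofReal b) hK.measurableSet fun y hy =>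
    ENNReal.ofReal_le_ofReal ((le_abs_self _).trans (hb y hy))).trans_lt ?_
  rw [setLIntegral_const]
  exact ENNReal.mul_lt_top ENNReal.ofReal_lt_top hK.measure_lt_top

theorem memL2_of_compact_support [T2Space N] (hh : h.IsRiemannian) {w : Form n N ℂ k}
    (hw : ∀ x, ContinuousOn (w.inChart x) (extChartAt (𝓡 n) x).target) {x₀ : N}
    {K : Set (Model n)} (hK : IsCompact K) (hKt : K ⊆ (extChartAt (𝓡 n) x₀).target)
    (hw0 : ∀ z ∉ (extChartAt (𝓡 n) x₀).symm '' K, w z = 0) : w.MemL2 h := by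
  refine ⟨fun x => (hw x).aestronglyMeasurable (measurableSet_target x), ?_⟩
  have hm : MeasurableSet ((extChartAt (𝓡 n) x₀).symm '' K) :=
    (isCompact_symm_image hK hKt).measurableSet
  obtain ⟨b, hb⟩ := hK.exists_bound_of_continuousOn ((hw x₀).mono hKt)
  obtain ⟨C, hC⟩ := hh.exists_bound hK hKt
  set D : ℝ≥0∞ := Fintype.card (Fin k ↪o Fin n) * ENNReal.ofReal (b * |C| ^ k) ^ 2 with hD
  refine upperIntegral_lt_iff.2 ⟨((extChartAt (𝓡 n) x₀).symm '' K).indicator fun _ => D,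
    measurable_const.indicator hm, fun z => ?_, ?_⟩
  · by_cases hz : z ∈ (extChartAt (𝓡 n) x₀).symm '' K
    · rw [indicator_of_mem hz]
      obtain ⟨y, hy, rfl⟩ := hz
      rw [normSq_symm h w (hKt hy)]
      refine (altNormSq_le (C := |C|) (fun v hv => (hC y hy v hv).trans (le_abs_self C)) _).trans ?_
      rw [hD]
      gcongr
      exact hb y hy
    · rw [indicator_of_notMem hz]
      refine iSup₂_le fun e he => ?_
      rw [hw0 z hz]
      simp
  · rw [lintegral_indicator hm, setLIntegral_const]
    refine ENNReal.mul_lt_top ?_ (riemannianVolume_symm_image_lt_top hh hK hKt)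
    exact ENNReal.mul_lt_top (by simp) (by simp)

theorem chartForm_mem_smoothCore [T2Space N] (hh : h.IsRiemannian) {τ : Form n N ℝ 1}
    (hτ : τ.Smooth) {x₀ : N}
    {f : Model n → Model n [⋀^Fin k]→L[ℝ] ℂ}
    (hf : ContDiffOn ℝ ∞ f (extChartAt (𝓡 n) x₀).target) {K : Set (Model n)} (hK : IsCompact K)
    (hKt : K ⊆ (extChartAt (𝓡 n) x₀).target) (hf0 : ∀ y ∉ K, f y = 0) :
    chartForm x₀ f ∈ smoothCore h τ k := by
  have hs := smooth_chartForm hf hK hKt hf0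
  refine ⟨hs, memL2_of_compact_support hh (fun x => (hs x).continuousOn) hK hKt
    fun z hz => chartForm_eq_zero hf0 hz, memL2_of_compact_support hh
    (fun x => continuousOn_inChart_twistedD hτ hs x) hK hKt fun z hz => ?_⟩
  refine twistedD_eq_zero_of_eventuallyEq τ ?_
  filter_upwards [(isCompact_symm_image hK hKt).isClosed.isOpen_compl.mem_nhds hz] with x hx
  exact chartForm_eq_zero hf0 hx

end ChartForm

/-! ### Test forms in degree `dim - 1` -/

section TestForm

variable {k : ℕ} {N : Type*} [TopologicalSpace N] [ChartedSpace (Model (k + 1)) N]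
  [IsManifold (𝓡 (k + 1)) ∞ N]

/-- The twisted differential of `χ ι_v (dy₀ ∧ ⋯ ∧ dy_k)`. -/
theorem inChart_twistedD_testForm (τ : Form (k + 1) N ℝ 1) {x₀ : N} {χ : Model (k + 1) → ℝ}
    (hχ : ContDiff ℝ ∞ χ) (v : Model (k + 1))
    (hs : (chartForm x₀ fun y => χ y • (detForm (k + 1)).curryLeft v).Smooth)
    {y : Model (k + 1)} (hy : y ∈ (extChartAt (𝓡 (k + 1)) x₀).target) :
    (Form.twistedD τ (chartForm x₀ fun y => χ y • (detForm (k + 1)).curryLeft v)).inChart x₀ y =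
      (fderiv ℝ χ y v + τ.inChart x₀ y (fun _ => v) * χ y) • detForm (k + 1) := by
  rw [inChart_twistedD τ hs hy, inChart_chartForm _ hy]
  have h1 : (chartForm x₀ fun y => χ y • (detForm (k + 1)).curryLeft v).inChart x₀ =ᶠ[𝓝 y]
      fun y => χ y • (detForm (k + 1)).curryLeft v := by
    filter_upwards [(isOpen_extChartAt_target x₀).mem_nhds hy] with z hz
    exact inChart_chartForm _ hz
  have h2 : fderiv ℝ (fun y => χ y • (detForm (k + 1)).curryLeft v) y =
      (fderiv ℝ χ y).smulRight ((detForm (k + 1)).curryLeft v) :=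
    ((hχ.differentiable (by simp) y).hasFDerivAt.smul_const _).fderiv
  refine ContinuousAlternatingMap.ext fun w => ?_
  rw [ContinuousAlternatingMap.add_apply, extDeriv, h1.fderiv_eq, h2,
    ContinuousAlternatingMap.alternatizeUncurryFin_apply, extMul_apply,
    ContinuousAlternatingMap.smul_apply, add_smul]
  congr 1
  · exact alternatizeUncurryFin_smulRight_curryLeft _ v w
  · have h3 := alternatizeUncurryFin_smulRight_curryLeft (toCovector (τ.inChart x₀ y)) v w
    rw [toCovector_apply] at h3
    rw [mul_comm, mul_smul, ← h3, Finset.smul_sum]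
    refine Finset.sum_congr rfl fun i _ => ?_
    rw [smul_comm (χ y), toCovector_apply, smul_comm (χ y)]
    rfl

end TestForm

/-! ### Top degree -/

section Transfer

variable {n : ℕ} {N : Type*} [TopologicalSpace N] [ChartedSpace (Model n) N]
  [IsManifold (𝓡 n) ∞ N] [MeasurableSpace N] [BorelSpace N] {h : MetricTensor n N}

theorem aestronglyMeasurable_comp_symm (hh : h.IsRiemannian) (x₀ : N) {f : N → ℂ}
    (hf : AEStronglyMeasurable f (riemannianVolume h)) :
    AEStronglyMeasurable (fun y => f ((extChartAt (𝓡 n) x₀).symm y))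
      (volume.restrict (extChartAt (𝓡 n) x₀).target) := by
  refine (hf.stronglyMeasurable_mk.aestronglyMeasurable.comp_aemeasurable
    (aemeasurable_symm x₀)).congr ?_
  filter_upwards [ae_chart_of_ae hh x₀ hf.ae_eq_mk] with y hy using hy.symm

variable [SecondCountableTopology N]

theorem setIntegral_source (hh : h.IsRiemannian) (x₀ : N) {f : N → ℂ}
    (hf : AEStronglyMeasurable f (riemannianVolume h)) :
    ∫ z in (extChartAt (𝓡 n) x₀).source, f z ∂(riemannianVolume h) =
      ∫ y in (extChartAt (𝓡 n) x₀).target,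
        Real.sqrt (gram h x₀ y).det • f ((extChartAt (𝓡 n) x₀).symm y) := by
  have hf' : AEStronglyMeasurable f (chartVolume h x₀) :=
    hf.mono_measure (le_iSup (chartVolume h) x₀)
  rw [riemannianVolume_restrict_source hh, chartVolume, integral_map
    ((aemeasurable_symm x₀).mono_ac (withDensity_absolutelyContinuous _ _)) hf']
  refine (integral_withDensity_eq_integral_toReal_smul₀ (aemeasurable_density hh x₀)
    (Filter.Eventually.of_forall fun _ => ENNReal.ofReal_lt_top) _).trans ?_
  refine integral_congr_ae (Filter.Eventually.of_forall fun y => ?_)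
  simp only [density, ENNReal.toReal_ofReal (Real.sqrt_nonneg _)]

omit [MeasurableSpace N] [BorelSpace N] [SecondCountableTopology N] in
theorem aestronglyMeasurable_inChart_chartForm {k : ℕ} {x₀ : N}
    {f : Model n → Model n [⋀^Fin k]→L[ℝ] ℂ}
    (hf : ContDiffOn ℝ ∞ f (extChartAt (𝓡 n) x₀).target) (x₁ : N) :
    AEStronglyMeasurable ((chartForm x₀ f).inChart x₁)
      (volume.restrict (extChartAt (𝓡 n) x₁).target) := by
  have ho := isOpen_coordDom (n := n) (continuous_id (X := N)) x₁ x₀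
  have h1 : ContinuousOn ((chartForm x₀ f).inChart x₁) (coordDom id x₁ x₀) := by
    have := contDiffOn_inChart_pullback (n := n) (x₀ := x₁) contMDiff_id (chartForm x₀ f)
      (hf.congr fun y hy => inChart_chartForm f hy)
    rw [pullback_id] at this
    exact (this.mono fun y hy => ⟨hy, coordMap_mem_target hy⟩).continuousOn
  have h2 : AEStronglyMeasurable
      ((coordDom id x₁ x₀).indicator ((chartForm x₀ f).inChart x₁))
      (volume.restrict (extChartAt (𝓡 n) x₁).target) := by
    rw [aestronglyMeasurable_indicator_iff ho.measurableSet]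
    exact (h1.aestronglyMeasurable ho.measurableSet).mono_measure
      (Measure.restrict_mono_measure Measure.restrict_le_self _)
  refine h2.congr ?_
  filter_upwards [ae_restrict_mem (measurableSet_target x₁)] with y hy
  by_cases hyd : y ∈ coordDom (n := n) (id : N → N) x₁ x₀
  · rw [indicator_of_mem hyd]
  · rw [indicator_of_notMem hyd, Form.inChart, chartForm, if_neg
      (show (extChartAt (𝓡 n) x₁).symm y ∉ (extChartAt (𝓡 n) x₀).source from fun hs => hyd ⟨hy, hs⟩)]
    rfl

end Transfer

section TopDegree

variable {k : ℕ} {N : Type*} [TopologicalSpace N] [ChartedSpace (Model (k + 1)) N]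
  [IsManifold (𝓡 (k + 1)) ∞ N] [MeasurableSpace N] [BorelSpace N] [SecondCountableTopology N]
  [T2Space N] {M : Type*} [TopologicalSpace M] [ChartedSpace (Model (k + 1)) M]
  [IsManifold (𝓡 (k + 1)) ∞ M] [ConnectedSpace M] {p : N → M}

theorem IsUniversalCovering.ae_eq_zero_of_orthogonal (hp : IsUniversalCovering (n := k + 1) p)
    {m₀ : M} (hπ : Infinite (FundamentalGroup M m₀)) (g : RiemannianMetricOn (k + 1) M)
    {θ : Form (k + 1) M ℝ 1} (hθ : θ.IsClosedForm)
    {T : ∀ _ : N, (Model (k + 1) [⋀^Fin (k + 1)]→L[ℝ] ℂ) →ₗ[ℂ] ℂ}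
    (hT : ∀ (w : Form (k + 1) N ℂ (k + 1)) z, ‖T z (w z)‖ₑ ^ 2 = w.normSq (pullbackMetric p g) z)
    (hTm : ∀ w : Form (k + 1) N ℂ (k + 1), (∀ x₀, AEStronglyMeasurable (w.inChart x₀)
      (volume.restrict (extChartAt (𝓡 (k + 1)) x₀).target)) →
      AEStronglyMeasurable (fun z => T z (w z)) (riemannianVolume (pullbackMetric p g)))
    {u : N → ℂ} (hum : StronglyMeasurable u)
    (hu2 : ∫⁻ z, ‖u z‖ₑ ^ 2 ∂(riemannianVolume (pullbackMetric p g)) < ⊤)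
    (hu : ∀ η ∈ smoothCore (pullbackMetric p g) (θ.pullback p) k,
      ∫ z, starRingEnd ℂ (u z) * T z (Form.twistedD (θ.pullback p) η z)
        ∂(riemannianVolume (pullbackMetric p g)) = 0) :
    ∀ᵐ z ∂(riemannianVolume (pullbackMetric p g)), u z = 0 := by
  have hh := isRiemannian_pullbackMetric hp.isLocalDiffeomorph g
  have hpc : ContMDiff (𝓡 (k + 1)) (𝓡 (k + 1)) ∞ p := hp.isLocalDiffeomorph.contMDiff
  set h := pullbackMetric p g with hdef
  set τ := θ.pullback p with hτdef
  have hτ : τ.Smooth := hθ.1.pullback hpc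
  suffices h0 : ∀ᵐ z ∂(riemannianVolume h), ‖u z‖ = 0 by
    filter_upwards [h0] with z hz using norm_eq_zero.1 hz
  refine hp.ae_eq_zero_of_weak_solution hπ g hθ (-1) (fun x₀ => ?_) (by simpa using hu2.ne)
  set φ := extChartAt (𝓡 (k + 1)) x₀ with hφ
  let Ω : Form (k + 1) N ℂ (k + 1) := chartForm x₀ fun _ => detForm (k + 1)
  have hΩm := hTm Ω fun x₁ => aestronglyMeasurable_inChart_chartForm contDiffOn_const x₁
  let O : Model (k + 1) → ℂ := fun y => T (φ.symm y) (Ω (φ.symm y))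
  have hO : ∀ y ∈ φ.target, Real.sqrt (gram h x₀ y).det * ‖O y‖ = 1 := fun y hy => by
    have h1 : ‖O y‖ₑ ^ 2 = _ := hT Ω (φ.symm y)
    have h2 := (hh.chartMetric hy).altNormSq_top (Ω.inChart x₀ y)
    rw [← normSq_symm h Ω hy, ← h1, inChart_chartForm _ hy, detForm_std, stdGram_chartMetric] at h2
    have hd := det_gram_pos hh hy
    rw [← ofReal_norm (O y), ← ENNReal.ofReal_pow (norm_nonneg _), ← ENNReal.ofReal_mul hd.le] at h2
    have h3 : (gram h x₀ y).det * ‖O y‖ ^ 2 = 1 := by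
      rw [← ENNReal.toReal_ofReal (by positivity : 0 ≤ (gram h x₀ y).det * ‖O y‖ ^ 2), ← h2]
      simp
    have h4 : (Real.sqrt (gram h x₀ y).det * ‖O y‖) ^ 2 = 1 := by
      rw [mul_pow, Real.sq_sqrt hd.le, h3]
    exact (pow_eq_one_iff_of_nonneg (by positivity) two_ne_zero).1 h4
  let U : Model (k + 1) → ℂ := fun y =>
    Real.sqrt (gram h x₀ y).det • (starRingEnd ℂ (u (φ.symm y)) * O y)
  have hU : ∀ y ∈ φ.target, ‖u (φ.symm y)‖ = ‖U y‖ := fun y hy => by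
    simp only [U]
    rw [norm_smul, norm_mul, RCLike.norm_conj, Real.norm_of_nonneg (Real.sqrt_nonneg _),
      mul_left_comm, hO y hy, mul_one]
  have hUm : AEStronglyMeasurable U (volume.restrict φ.target) :=
    ((continuousOn_sqrt_det hh x₀).aestronglyMeasurable (measurableSet_target x₀)).smul
      (((RCLike.continuous_conj (K := ℂ)).comp_aestronglyMeasurable
        (aestronglyMeasurable_comp_symm hh x₀ hum.aestronglyMeasurable)).mul
        (aestronglyMeasurable_comp_symm hh x₀ hΩm))
  refine ⟨U, hU, fun K hKt hK => ?_, fun χ hχ hχc hχt v => ?_⟩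
  · refine integrableOn_of_lintegral_sq_lt_top hK
      (hUm.mono_measure (Measure.restrict_mono hKt le_rfl)) ?_
    obtain ⟨c, hc0, hct, hc⟩ := exists_density_ge hh hKt hK
    have h1 : c * ∫⁻ y in K, ‖U y‖ₑ ^ 2 ≤ ∫⁻ z, ‖u z‖ₑ ^ 2 ∂(riemannianVolume h) := by
      refine le_trans ?_ (setLIntegral_le_lintegral φ.source _)
      rw [setLIntegral_source hh x₀ (hum.enorm.pow_const 2), ← lintegral_const_mul' _ _ hct]
      refine le_trans ?_ (lintegral_mono_set hKt)
      refine setLIntegral_mono' hK.measurableSet fun y hy => ?_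
      rw [← ofReal_norm (U y), ← hU y (hKt hy), ofReal_norm]
      gcongr
      exact hc y hy
    by_contra htop
    rw [not_lt_top_iff.1 htop, ENNReal.mul_top hc0] at h1
    exact (h1.trans_lt hu2).ne rfl
  · set c : Model (k + 1) → ℝ := fun y =>
      fderiv ℝ χ y v - -1 * (τ.inChart x₀ y fun _ => v) * χ y with hcdef
    have hχ0 : ∀ y ∉ tsupport χ, χ y • (detForm (k + 1)).curryLeft v = 0 := fun y hy => by
      rw [image_eq_zero_of_notMem_tsupport hy, zero_smul]
    have hcore := chartForm_mem_smoothCore hh hτ (x₀ := x₀)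
      (f := fun y => χ y • (detForm (k + 1)).curryLeft v)
      (hχ.contDiffOn.smul contDiffOn_const) hχc hχt hχ0
    set η := chartForm x₀ fun y => χ y • (detForm (k + 1)).curryLeft v with hη
    have hdη : ∀ y ∈ φ.target, T (φ.symm y) (Form.twistedD τ η (φ.symm y)) = c y * O y := by
      intro y hy
      have h1 := hT (Form.twistedD τ η - (c y : ℂ) • Ω) (φ.symm y)
      have h2 : (Form.twistedD τ η - (c y : ℂ) • Ω).inChart x₀ y = 0 := by
        have h3 : (Form.twistedD τ η - (c y : ℂ) • Ω).inChart x₀ y =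
          (Form.twistedD τ η).inChart x₀ y - (c y : ℂ) • Ω.inChart x₀ y := rfl
        rw [h3, inChart_twistedD_testForm τ hχ v hcore.1 hy, inChart_chartForm _ hy]
        refine ContinuousAlternatingMap.ext fun w => ?_
        change _ = (0 : ℂ)
        simp only [hcdef, ContinuousAlternatingMap.sub_apply, ContinuousAlternatingMap.smul_apply,
          Complex.real_smul, smul_eq_mul]
        push_cast
        ring
      rw [normSq_symm h _ hy, h2] at h1
      have h4 : altNormSq (chartMetric h x₀ y)
          (0 : Model (k + 1) [⋀^Fin (k + 1)]→L[ℝ] ℂ) = 0 := by simp [altNormSq]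
      rw [h4] at h1
      have h5 : T (φ.symm y) ((Form.twistedD τ η - (c y : ℂ) • Ω) (φ.symm y)) = 0 := by
        simpa using h1
      have h6 : T (φ.symm y) ((Form.twistedD τ η - (c y : ℂ) • Ω) (φ.symm y)) =
          T (φ.symm y) (Form.twistedD τ η (φ.symm y)) - (c y : ℂ) • O y := by
        refine (map_sub (T (φ.symm y)) _ _).trans ?_
        exact congr_arg _ (map_smul (T (φ.symm y)) _ _)
      rw [h6, sub_eq_zero] at h5
      exact h5
    have hdη0 : ∀ z ∉ φ.source, Form.twistedD τ η z = 0 := fun z hz => by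
      refine twistedD_eq_zero_of_eventuallyEq τ ?_
      have hz' : z ∉ φ.symm '' tsupport χ := by
        rintro ⟨y, hy, rfl⟩
        exact hz (φ.map_target (hχt hy))
      filter_upwards [(isCompact_symm_image hχc hχt).isClosed.isOpen_compl.mem_nhds hz'] with x hx
      exact chartForm_eq_zero hχ0 hx
    have h1 := hu η hcore
    rw [← setIntegral_eq_integral_of_forall_compl_eq_zero (s := φ.source) fun z hz => by
      rw [hdη0 z hz]; exact mul_eq_zero_of_right _ (map_zero (T z))] at h1
    have hF : AEStronglyMeasurable
        (fun z => starRingEnd ℂ (u z) * T z (Form.twistedD τ η z)) (riemannianVolume h) :=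
      ((RCLike.continuous_conj (K := ℂ)).comp_aestronglyMeasurable
        hum.aestronglyMeasurable).mul (hTm _ hcore.2.2.1)
    rw [setIntegral_source hh x₀ hF] at h1
    rw [← h1, ← setIntegral_eq_integral_of_forall_compl_eq_zero (s := φ.target)]
    · refine setIntegral_congr_fun (measurableSet_target x₀) fun y hy => ?_
      simp only [U]
      rw [hdη y hy, smul_comm]
      congr 1
      simp only [Complex.real_smul, hcdef]
      ring
    · intro y hy
      have hy' : y ∉ tsupport χ := fun h => hy (hχt h)
      have hD : fderiv ℝ χ y = 0 :=
        image_eq_zero_of_notMem_tsupport fun h => hy' (tsupport_fderiv_subset ℝ h)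
      rw [image_eq_zero_of_notMem_tsupport hy', hD]
      simp

end TopDegree

/-! ### Density of the exact forms of top degree and vanishing of the cohomology -/

section Density

theorem eLpNorm_two_sq {X : Type*} [MeasurableSpace X] (μ : Measure X) (f : X → ℂ) :
    eLpNorm f 2 μ ^ 2 = ∫⁻ x, ‖f x‖ₑ ^ 2 ∂μ := by
  have := eLpNorm_nnreal_pow_eq_lintegral (μ := μ) (f := f) (p := 2) two_ne_zero
  simpa using this

variable {k : ℕ} {N : Type*} [TopologicalSpace N] [ChartedSpace (Model (k + 1)) N]
  [IsManifold (𝓡 (k + 1)) ∞ N] [MeasurableSpace N] [BorelSpace N] [SecondCountableTopology N]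
  [T2Space N] {M : Type*} [TopologicalSpace M] [ChartedSpace (Model (k + 1)) M]
  [IsManifold (𝓡 (k + 1)) ∞ M] [ConnectedSpace M] {p : N → M}

theorem IsUniversalCovering.exists_twistedD_close (hp : IsUniversalCovering (n := k + 1) p)
    {m₀ : M} (hπ : Infinite (FundamentalGroup M m₀)) (g : RiemannianMetricOn (k + 1) M)
    {θ : Form (k + 1) M ℝ 1} (hθ : θ.IsClosedForm) {w : Form (k + 1) N ℂ (k + 1)}
    (hw : w.MemL2 (pullbackMetric p g)) {ε : ℝ≥0∞} (hε : 0 < ε) :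
    ∃ η ∈ smoothCore (pullbackMetric p g) (θ.pullback p) k,
      (w - Form.twistedD (θ.pullback p) η).l2Sq (pullbackMetric p g) < ε := by
  have hh := isRiemannian_pullbackMetric hp.isLocalDiffeomorph g
  obtain ⟨T, hT, hTm⟩ := exists_isometric_trivialization hh
  set h := pullbackMetric p g
  set τ := θ.pullback p
  have hl2 : ∀ {α : Form (k + 1) N ℂ (k + 1)}, α.MemL2 h →
      α.l2Sq h = eLpNorm (fun z => T z (α z)) 2 (riemannianVolume h) ^ 2 := fun {α} hα => by
    have h1 : α.normSq h = fun z => ‖T z (α z)‖ₑ ^ 2 := funext fun z => (hT α z).symm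
    rw [eLpNorm_two_sq, Form.l2Sq, h1, upperIntegral_eq_lintegral₀ ((hTm α hα.1).enorm.pow_const 2)]
  have hmem : ∀ {α : Form (k + 1) N ℂ (k + 1)}, α.MemL2 h →
      MemLp (fun z => T z (α z)) 2 (riemannianVolume h) := fun {α} hα => by
    refine ⟨hTm α hα.1, ?_⟩
    have h1 := hα.2
    rw [hl2 hα] at h1
    by_contra htop
    rw [not_lt_top_iff.1 htop] at h1
    simp at h1
  have hadd : ∀ η ∈ smoothCore h τ k, ∀ ζ ∈ smoothCore h τ k,
      (fun z => T z (Form.twistedD τ (η + ζ) z)) =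
        (fun z => T z (Form.twistedD τ η z)) + fun z => T z (Form.twistedD τ ζ z) := by
    intro η hη ζ hζ
    funext z
    rw [twistedD_add τ hη.1 hζ.1]
    exact map_add (T z) _ _
  have hsmul : ∀ (c : ℂ), ∀ η ∈ smoothCore h τ k,
      (fun z => T z (Form.twistedD τ (c • η) z)) = c • fun z => T z (Form.twistedD τ η z) := by
    intro c η hη
    funext z
    rw [twistedD_smul τ c hη.1]
    exact map_smul (T z) _ _
  have hD : ∀ η : smoothCore h τ k, MemLp (fun z => T z (Form.twistedD τ η.1 z)) 2
      (riemannianVolume h) := fun η => hmem η.2.2.2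
  let L : smoothCore h τ k →ₗ[ℂ] Lp ℂ 2 (riemannianVolume h) :=
    { toFun := fun η => (hD η).toLp _
      map_add' := fun η ζ => (MemLp.toLp_congr (hD (η + ζ)) ((hD η).add (hD ζ))
        (Filter.Eventually.of_forall (congr_fun (hadd η.1 η.2 ζ.1 ζ.2)))).trans
          (MemLp.toLp_add (hD η) (hD ζ))
      map_smul' := fun c η => (MemLp.toLp_congr (hD (c • η)) ((hD η).const_smul c)
        (Filter.Eventually.of_forall (congr_fun (hsmul c η.1 η.2)))).trans
          (MemLp.toLp_const_smul c (hD η)) }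
  have hdense : (LinearMap.range L).topologicalClosure = ⊤ := by
    rw [Submodule.topologicalClosure_eq_top_iff, Submodule.eq_bot_iff]
    intro u hu
    refine (Lp.eq_zero_iff_ae_eq_zero).2 ?_
    refine hp.ae_eq_zero_of_orthogonal hπ g hθ hT hTm (Lp.stronglyMeasurable u) ?_ fun η hη => ?_
    · rw [← eLpNorm_two_sq]
      exact ENNReal.pow_lt_top (Lp.memLp u).2
    · have h1 := (Submodule.mem_orthogonal' _ _).1 hu (L ⟨η, hη⟩) ⟨_, rfl⟩
      rw [L2.inner_def] at h1
      rw [← h1]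
      refine integral_congr_ae ?_
      filter_upwards [(hmem hη.2.2).coeFn_toLp] with z hz
      change _ = inner ℂ (u z) ((hmem hη.2.2).toLp _ z)
      rw [hz, RCLike.inner_apply, mul_comm]
  have hcl : (hmem hw).toLp _ ∈ closure (LinearMap.range L : Set (Lp ℂ 2 (riemannianVolume h))) := by
    rw [← Submodule.topologicalClosure_coe, hdense]
    exact mem_univ _
  obtain ⟨_, ⟨η, rfl⟩, hη⟩ := EMetric.mem_closure_iff.1 hcl (min ε 1) (by simp [hε])
  refine ⟨η, η.2, ?_⟩
  have hsub : (w - Form.twistedD τ η).MemL2 h := by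
    have := memL2_add hw (memL2_smul (-1 : ℂ) η.2.2.2)
    simpa [sub_eq_add_neg] using this
  rw [hl2 hsub]
  have h2 : edist ((hmem hw).toLp _) (L η) =
      eLpNorm (fun z => T z ((w - Form.twistedD τ η.1 : Form (k + 1) N ℂ (k + 1)) z)) 2 (riemannianVolume h) := by
    refine (Lp.edist_toLp_toLp _ _ (hmem hw) (hmem η.2.2.2)).trans ?_
    congr 1
    funext z
    exact (map_sub (T z) _ _).symm
  rw [← h2, sq]
  calc _ ≤ edist ((hmem hw).toLp _) (L η) * 1 := by
        gcongr
        exact (hη.trans_le (min_le_right _ _)).le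
    _ < ε := by rw [mul_one]; exact hη.trans_le (min_le_left _ _)

theorem IsUniversalCovering.mem_l2Closure_imageD (hp : IsUniversalCovering (n := k + 1) p)
    {m₀ : M} (hπ : Infinite (FundamentalGroup M m₀)) (g : RiemannianMetricOn (k + 1) M)
    {θ : Form (k + 1) M ℝ 1} (hθ : θ.IsClosedForm) {w : Form (k + 1) N ℂ (k + 1)}
    (hw : w.MemL2 (pullbackMetric p g)) :
    w ∈ l2Closure (pullbackMetric p g) (imageD (pullbackMetric p g) (θ.pullback p) (k + 1)) := by
  refine ⟨hw, fun ε hε => ?_⟩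
  obtain ⟨η, hη, hlt⟩ := hp.exists_twistedD_close hπ g hθ hw hε
  refine ⟨_, ⟨(η, Form.twistedD (θ.pullback p) η), ⟨hη.2.1, hη.2.2, fun δ hδ =>
    ⟨η, hη, ?_, ?_⟩⟩, rfl⟩, hlt⟩
  · simpa [l2Sq_zero] using hδ
  · simpa [l2Sq_zero] using hδ

end Density

section Vanishing

variable {n : ℕ} {N : Type*} [TopologicalSpace N] [ChartedSpace (Model n) N] [MeasurableSpace N]

theorem subsingleton_cohomology {h : MetricTensor n N} {τ : Form n N ℝ 1} {k : ℕ}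
    (H : ∀ w ∈ cocycles h τ k, w ∈ l2Closure h (imageD h τ k)) :
    Subsingleton (Cohomology h τ k) := by
  refine Submodule.Quotient.subsingleton_iff.2 (eq_top_iff.2 fun w _ => ?_)
  exact H w.1 w.2

variable [IsManifold (𝓡 n) ∞ N] [BorelSpace N] [SecondCountableTopology N]
  {M : Type*} [TopologicalSpace M] [ChartedSpace (Model n) M] [IsManifold (𝓡 n) ∞ M]
  [ConnectedSpace M] {p : N → M}

theorem IsUniversalCovering.subsingleton_cohomology_zero (hp : IsUniversalCovering (n := n) p)
    {m₀ : M} (hπ : Infinite (FundamentalGroup M m₀)) (g : RiemannianMetricOn n M)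
    {θ : Form n M ℝ 1} (hθ : θ.IsClosedForm) :
    Subsingleton (TwistedL2Cohomology p g θ 0) :=
  subsingleton_cohomology fun w hw => ⟨hw.1, fun ε hε => ⟨0, Submodule.zero_mem _, by
    rw [sub_zero, hp.l2Sq_cocycle_zero hπ g hθ hw]
    exact hε⟩⟩

theorem IsUniversalCovering.subsingleton_cohomology_top [T2Space N]
    (hp : IsUniversalCovering (n := n) p)
    {m₀ : M} (hπ : Infinite (FundamentalGroup M m₀)) (g : RiemannianMetricOn n M)
    {θ : Form n M ℝ 1} (hθ : θ.IsClosedForm) :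
    Subsingleton (TwistedL2Cohomology p g θ n) := by
  cases n with
  | zero => exact hp.subsingleton_cohomology_zero hπ g hθ
  | succ k => exact subsingleton_cohomology fun w hw => hp.mem_l2Closure_imageD hπ g hθ hw.1

end Vanishing

end TwistedL2

theorem lemma5p1 {n : ℕ}
    {M : Type*} [TopologicalSpace M] [ChartedSpace (TwistedL2.Model n) M]
    [IsManifold (𝓡 n) ∞ M] [T2Space M] [CompactSpace M] [ConnectedSpace M]
    (g : TwistedL2.RiemannianMetricOn n M)
    {Mt : Type*} [TopologicalSpace Mt] [ChartedSpace (TwistedL2.Model n) Mt]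
    [IsManifold (𝓡 n) ∞ Mt] [T2Space Mt] [SecondCountableTopology Mt]
    [MeasurableSpace Mt] [BorelSpace Mt]
    (p : Mt → M) (hp : TwistedL2.IsUniversalCovering (n := n) p)
    (x₀ : M) (hπ : Infinite (FundamentalGroup M x₀))
    (θ : TwistedL2.Form n M ℝ 1) (hθ : θ.IsClosedForm) :
    Subsingleton (TwistedL2.TwistedL2Cohomology p g θ 0) ∧
      Subsingleton (TwistedL2.TwistedL2Cohomology p g θ n) :=
  ⟨hp.subsingleton_cohomology_zero hπ g hθ, hp.subsingleton_cohomology_top hπ g hθ⟩
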